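/- Let $A=\bigoplus_{n\ge 0}A_n$ be a standard graded algebra over a field $A_0=k$ (so $A$ is generated as a $k$-algebra by the finite-dimensional space $A_1$), of Krull dimension $d$. A filtration $\mathcal F=\{I_n\}_{n\in\mathbb N}$ of homogeneous ideals of $A$ (that is, $I_0=A$, $I_{n+1}\subseteq I_n$, $I_nI_m\subseteq I_{n+m}$) is called Noetherian if there is $m\ge 1$ with $I_nI_m=I_{n+m}$ for all $n\ge m$. Put $H^0_{\mathcal F}(A)=\{x\in A: I_nx=0\text{ for some }n\}$ and $d^{\mathcal F}=\dim A/H^0_{\mathcal F}(A)$, and define the density function, for real $x\ge 0$, by $$f_{A,\mathcal F}(x)=\limsup_{n\to\infty}\frac{\ell_k\big((I_n)_{\lfloor xn\rfloor}\big)}{n^{d^{\mathcal F}-1}/d^{\mathcal F}!}.$$ (A) Let $\mathcal F=\{I_n\}$ be a Noetherian filtration of homogeneous ideals of $A$ with $d^{\mathcal F}\ge 1$. Let the Rees algebra $R=\bigoplus_n I_nt^n$, bigraded by $R_{m,n}=(I_n)_mt^n$, be generated over $A$ by finitely many bihomogeneous elements of bidegrees in $\mathbb N\times\mathbb N_{>0}$.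 Let $d_1/e_1<\dots<d_l/e_l$ ($l\ge 1$) be the distinct ratios $m/n$ of the bidegrees $(m,n)$ of these generators, where each $(d_j,e_j)$ is the bidegree of a generator, and put $d_{l+1}/e_{l+1}=\infty$. Assume that $R$ has a nonzerodivisor of bidegree $(d_1,e_1)$. Then, for every real $x\ge 0$ with $x\ne d_1/e_1$, the limit $$\lim_{n\to\infty}\frac{\ell_k\big((I_n)_{\lfloor xn\rfloor}\big)}{n^{d-1}/d!}$$ exists and equals $f_{A,\mathcal F}(x)$. The function $f_{A,\mathcal F}$ is continuous on $(d_1/e_1,\infty)$ and vanishes on $[0,d_1/e_1)$. There are nonzero polynomials $\mathbf p_1,\dots,\mathbf p_l\in\mathbb Q[x]$ of degree at most $d-1$, with $\mathbf p_l$ of degree exactly $d-1$, such that $f_{A,\mathcal F}(x)=\mathbf p_j(x)$ for every $1\le j\le l$ and every $x>d_1/e_1$ with $d_j/e_j\le x\le d_{j+1}/e_{j+1}$. (B) Suppose moreover that $A$ is a domain and $d\ge 2$, and let $0\ne I\subsetneq A$ be a homogeneous ideal that is minimally generated in degrees $d_1<\dots<d_l$. Then, with $\mathcal F=\{I^n\}$,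 the limit $$\lim_{n\to\infty}\frac{\ell_k\big((I^n)_{\lfloor xn\rfloor}\big)}{n^{d-1}/d!}$$ exists and equals $f_{A,\{I^n\}}(x)$ for every real $x\ge 0$. The function $f_{A,\{I^n\}}$ is continuous on $[0,\infty)\setminus\{d_1\}$ and vanishes on $[0,d_1)$. There are nonzero polynomials $\mathbf p_1,\dots,\mathbf p_l\in\mathbb Q[x]$ of degree at most $d-1$, with $\mathbf p_l$ of degree exactly $d-1$, such that $f_{A,\{I^n\}}(x)=\mathbf p_j(x)$ for every $1\le j\le l$ and every $x>d_1$ with $d_j\le x\le d_{j+1}$ (where $d_{l+1}=\infty$). For every integer $c>0$, $f_{A,\{I^n\}}$ is integrable on $[0,c]$ and $$\int_0^c f_{A,\{I^n\}}(x)\,dx=\lim_{n\to\infty}\frac{\sum_{m=0}^{cn}\ell_k\big((I^n)_m\big)}{n^d/d!}.$$ -/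

import Mathlib

/-- A standard graded algebra over a field `k`: `A₀ = k`, and `A` is generated as a `k`-algebra
by `A₁`, which is a finite-dimensional `k`-vector space. -/
structure IsStandardGraded {k A : Type*} [Field k] [CommRing A] [Algebra k A]
    (𝒜 : ℕ → Submodule k A) [GradedAlgebra 𝒜] : Prop where
  injective : Function.Injective (algebraMap k A)
  degree_zero : 𝒜 0 = LinearMap.range (Algebra.linearMap k A)
  generated : Algebra.adjoin k (𝒜 1 : Set A) = ⊤
  finite : Module.Finite k (𝒜 1)

/-- A filtration of ideals: `I₀ = A`, `Iₙ₊₁ ⊆ Iₙ`, `Iₙ Iₘ ⊆ Iₙ₊ₘ`. -/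
structure IdealFiltration (A : Type*) [CommRing A] where
  ideal : ℕ → Ideal A
  zero_eq : ideal 0 = ⊤
  succ_le : ∀ n, ideal (n + 1) ≤ ideal n
  mul_le : ∀ n m, ideal n * ideal m ≤ ideal (n + m)

namespace IdealFiltration

variable {A : Type*} [CommRing A]

theorem antitone (F : IdealFiltration A) : Antitone F.ideal :=
  antitone_nat_of_succ_le F.succ_le

/-- A filtration is Noetherian if `Iₙ Iₘ = Iₙ₊ₘ` for some `m ≥ 1` and all `n ≥ m`. -/
def IsNoetherianFiltration (F : IdealFiltration A) : Prop :=
  ∃ m : ℕ, 1 ≤ m ∧ ∀ n, m ≤ n → F.ideal n * F.ideal m = F.ideal (n + m)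

/-- The filtration `{Iⁿ}` of powers of an ideal. -/
def powers (I : Ideal A) : IdealFiltration A where
  ideal n := I ^ n
  zero_eq := by simp [Ideal.one_eq_top]
  succ_le n := Ideal.pow_le_pow_right (Nat.le_succ n)
  mul_le n m := le_of_eq (pow_add I n m).symm

/-- The Rees algebra `⊕ₙ Iₙ tⁿ`, as a subalgebra of `A[t]`. -/
def rees (F : IdealFiltration A) : Subalgebra A (Polynomial A) where
  carrier := {f | ∀ n, f.coeff n ∈ F.ideal n}
  add_mem' {f g} hf hg n := by
    rw [Polynomial.coeff_add]
    exact add_mem (hf n) (hg n)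
  mul_mem' {f g} hf hg n := by
    rw [Polynomial.coeff_mul]
    refine sum_mem fun x hx => ?_
    rw [← Finset.HasAntidiagonal.mem_antidiagonal.mp hx]
    exact F.mul_le _ _ (Ideal.mul_mem_mul (hf _) (hg _))
  algebraMap_mem' r n := by
    rw [Polynomial.algebraMap_apply, Algebra.algebraMap_self, RingHom.id_apply,
      Polynomial.coeff_C]
    split_ifs with h
    · subst h
      simp [F.zero_eq]
    · exact zero_mem _

/-- The ideal `H⁰(A) = {x | Iₙ x = 0 for some n}`. -/
def H0 (F : IdealFiltration A) : Ideal A where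
  carrier := {x | ∃ n, ∀ y ∈ F.ideal n, y * x = 0}
  zero_mem' := ⟨0, fun y _ => mul_zero y⟩
  add_mem' := by
    rintro a b ⟨n, hn⟩ ⟨m, hm⟩
    refine ⟨max n m, fun y hy => ?_⟩
    rw [mul_add, hn y (F.antitone (le_max_left n m) hy),
      hm y (F.antitone (le_max_right n m) hy), add_zero]
  smul_mem' := by
    rintro c x ⟨n, hn⟩
    refine ⟨n, fun y hy => ?_⟩
    rw [smul_eq_mul, mul_left_comm, hn y hy, mul_zero]

/-- The Krull dimension of `A / H⁰(A)`, as a natural number. -/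
noncomputable def dim (F : IdealFiltration A) : ℕ :=
  ((ringKrullDim (A ⧸ F.H0)).unbotD 0).toNat

variable {k : Type*} [Field k] [Algebra k A]

/-- All ideals of the filtration are homogeneous. -/
def IsHomogeneousFiltration (F : IdealFiltration A) (𝒜 : ℕ → Submodule k A)
    [GradedAlgebra 𝒜] : Prop :=
  ∀ n, (F.ideal n).IsHomogeneous 𝒜

/-- The `k`-length (that is, dimension) of the degree-`m` component `(Iₙ)ₘ`. -/
noncomputable def len (F : IdealFiltration A) (𝒜 : ℕ → Submodule k A) (n m : ℕ) : ℕ :=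
  Module.finrank k ↥((F.ideal n).restrictScalars k ⊓ 𝒜 m)

/-- The density function `x ↦ limsup ℓ((Iₙ)_{⌊xn⌋}) / (n^{δ-1}/δ!)` of the filtration, where
`δ = dim A / H⁰(A)`. Only its values at `x ≥ 0` are meaningful. -/
noncomputable def density (F : IdealFiltration A) (𝒜 : ℕ → Submodule k A) (x : ℝ) : ℝ :=
  Filter.limsup (fun n : ℕ => (F.len 𝒜 n ⌊x * n⌋₊ : ℝ) /
    ((n : ℝ) ^ (F.dim - 1) / (Nat.factorial F.dim : ℝ))) Filter.atTop

/-- `f` lies in the component `(Iₙ)ₘ tⁿ` of bidegree `(m, n)` of the Rees algebra. -/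
def HasBidegree (F : IdealFiltration A) (𝒜 : ℕ → Submodule k A) (f : F.rees) (m n : ℕ) : Prop :=
  ∃ a : A, a ∈ 𝒜 m ∧ a ∈ F.ideal n ∧ (f : Polynomial A) = Polynomial.monomial n a

/-- The Rees algebra is generated over `A` by finitely many bihomogeneous elements of positive
`t`-degree; `d₁/e₁ < ⋯ < d_l/e_l` (`l ≥ 1`) are the distinct values of `m/n` over the bidegrees
`(m, n)` of these generators, and each `(dⱼ, eⱼ)` is itself the bidegree of a generator. -/
def IsGeneratedInBidegrees (F : IdealFiltration A) (𝒜 : ℕ → Submodule k A)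
    (l : ℕ) (d e : ℕ → ℕ) : Prop :=
  1 ≤ l ∧
  (∀ i j, 1 ≤ i → i < j → j ≤ l → (d i : ℚ) / e i < (d j : ℚ) / e j) ∧
  ∃ (G : Finset F.rees) (m n : F.rees → ℕ),
    Algebra.adjoin A (G : Set F.rees) = ⊤ ∧
    (∀ g ∈ G, 0 < n g ∧ F.HasBidegree 𝒜 g (m g) (n g)) ∧
    (∀ g ∈ G, ∃ j, 1 ≤ j ∧ j ≤ l ∧ (m g : ℚ) / n g = (d j : ℚ) / e j) ∧
    (∀ j, 1 ≤ j → j ≤ l → ∃ g ∈ G, m g = d j ∧ n g = e j)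

end IdealFiltration

/-- The ideal `I` is minimally generated in degrees `d₁ < ⋯ < d_l`: it has a finite minimal
generating set of homogeneous elements whose degrees are exactly `d₁, …, d_l`. -/
def IsMinimallyGeneratedInDegrees {k A : Type*} [Field k] [CommRing A] [Algebra k A]
    (𝒜 : ℕ → Submodule k A) (I : Ideal A) (l : ℕ) (d : ℕ → ℕ) : Prop :=
  (∀ i j, 1 ≤ i → i < j → j ≤ l → d i < d j) ∧
  ∃ S : Finset A, Ideal.span (S : Set A) = I ∧
    (∀ s ∈ S, s ∉ Ideal.span ((S : Set A) \ {s})) ∧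
    (∀ s ∈ S, ∃ j, 1 ≤ j ∧ j ≤ l ∧ s ∈ 𝒜 (d j)) ∧
    (∀ j, 1 ≤ j → j ≤ l → ∃ s ∈ S, s ∈ 𝒜 (d j))

/-! Write H(n, m) for ℓ((I_n)_m) and call m / n the slope of (m, n). The Rees algebra is generated
over k by a spanning set of A_1, in bidegree (1, 0), and by the given generators. Hence its bigraded
Hilbert series is rational with denominator ∏ (1 - X^b), b running over these bidegrees
(`exists_hilbertSeries_mul_prod_eq`). By partial fractions in two variables, in an open cone
containing none of the b the coefficients at the points of a sublattice are given by a polynomial,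
far from the walls (`HasDenominator.exists_isEventuallyPolynomial`). Noether normalisation gives
ℓ(A_m) the exact order m^(d-1). Since H(n, m) ≤ ℓ(A_m), the forms of degree above d-1 in that
polynomial vanish, and its form of degree d-1, dehomogenised, is a polynomial in the slope
(`exists_leading_polynomial`).

The nonzerodivisor h of bidegree (d_1, e_1) does the rest. H decreases in n and eventually increases
in m (`exists_len_mono`), so its value at any point is squeezed between values on the sublattice
(`hasLeadingTerm_of_dilation`). At a wall, monotonicity in m gives one inequality between the two
neighbouring leading terms. Multiplication by powers of h drags a slope just above the wall to one
just below it, at the cost of a factor tending to 1, and this gives the other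
(`HasLeadingTerm.eq_at_wall`). The argument needs a wall above d_1/e_1, a slope that such shifts
leave fixed. Finally h^s embeds the component of A of degree m - s d_1 in (I_n)_m when s e_1 ≥ n. So
the leading term is at least c (x - d_1/e_1)^(d-1): no p_j is zero, and p_l has degree d-1. Below
d_1/e_1 there are no monomials and H = 0.

For powers of an ideal in a domain, a nonzero generator of least degree supplies h. On the ray of
slope d_1 only the generators of degree d_1 contribute, so H(n, d_1 n) is the Hilbert function of an
algebra generated in degree one and the limit exists there too. The integral formula is dominated
convergence for step functions. -/

-- Greedy basis: adding the vectors in increasing order, the dimension jumps by one exactly at those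
-- outside the span of their predecessors. This turns Hilbert functions into counts of exponents.
open scoped Classical in
theorem finrank_span_image_eq_card_filter {K V τ : Type*} [Field K] [AddCommGroup V] [Module K V]
    [LinearOrder τ] (v : τ → V) (s : Finset τ) :
    Module.finrank K (Submodule.span K (v '' s)) =
      (s.filter fun a => v a ∉ Submodule.span K (v '' {b | b ∈ s ∧ b < a})).card := by
  induction s using Finset.induction_on_max with
  | empty =>
    rw [Finset.coe_empty, Set.image_empty, Submodule.span_empty, finrank_bot, Finset.filter_empty,
      Finset.card_empty]
  | insert a s has ih =>
    have hna : a ∉ s := fun h => lt_irrefl _ (has a h)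
    have hset : ∀ c ∈ s, {b | b ∈ insert a s ∧ b < c} = {b | b ∈ s ∧ b < c} := by
      intro c hc
      ext b
      simp only [Finset.mem_insert, Set.mem_ofPred_eq]
      constructor
      · rintro ⟨rfl | hb, h⟩
        · exact absurd h (not_lt.2 (has c hc).le)
        · exact ⟨hb, h⟩
      · rintro ⟨hb, h⟩
        exact ⟨Or.inr hb, h⟩
    have hseta : {b | b ∈ insert a s ∧ b < a} = (s : Set τ) := by
      ext b
      simp only [Finset.mem_insert, Set.mem_ofPred_eq, Finset.mem_coe]
      constructor
      · rintro ⟨rfl | hb, h⟩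
        · exact absurd h (lt_irrefl _)
        · exact hb
      · exact fun hb => ⟨Or.inr hb, has b hb⟩
    have hfil : (s.filter fun c => v c ∉ Submodule.span K (v '' {b | b ∈ insert a s ∧ b < c})) =
        s.filter fun c => v c ∉ Submodule.span K (v '' {b | b ∈ s ∧ b < c}) := by
      refine Finset.filter_congr fun c hc => ?_
      rw [hset c hc]
    rw [Finset.filter_insert, hseta, hfil, Finset.coe_insert, Set.image_insert_eq]
    have hfin : Module.Finite K (Submodule.span K (v '' s)) :=
      Module.Finite.span_of_finite K ((s.finite_toSet).image v)
    by_cases h : v a ∈ Submodule.span K (v '' s)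
    · rw [if_neg (not_not.2 h), Submodule.span_insert_eq_span h, ih]
    · rw [if_pos h, Finset.card_insert_of_notMem (by simp [hna]), ← ih, Submodule.span_insert,
        sup_comm]
      have h0 : v a ≠ 0 := fun h0 => h (h0 ▸ zero_mem _)
      have h1 := Submodule.finrank_sup_add_finrank_inf_eq (Submodule.span K (v '' s))
        (Submodule.span K {v a})
      rw [(Submodule.disjoint_span_singleton_of_notMem h).eq_bot, finrank_bot,
        finrank_span_singleton h0, add_zero] at h1
      exact h1

/-! ### Counting exponents in a lower set: rationality of the generating series -/

section CountSeries

variable {κ : Type*} {N : ℕ}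

/-- The multidegree `∑ αᵢ bᵢ` of a monomial with exponents `α` in variables of degrees `bᵢ`. -/
noncomputable def multidegree (b : Fin N → κ →₀ ℕ) (α : Fin N → ℕ) : κ →₀ ℕ := ∑ i, α i • b i

theorem multidegree_add (b : Fin N → κ →₀ ℕ) (α β : Fin N → ℕ) :
    multidegree b (α + β) = multidegree b α + multidegree b β := by
  simp [multidegree, add_smul, Finset.sum_add_distrib]

/-- Each `b i` has total degree at least 1, so every exponent is bounded by the total degree of `u`.
Without this finiteness the `ncard` in `countSeries` could be the default value 0. -/
theorem finite_multidegree_eq {b : Fin N → κ →₀ ℕ} (hb : ∀ i, b i ≠ 0) (u : κ →₀ ℕ) :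
    {α | multidegree b α = u}.Finite := by
  refine (Set.finite_Iic (fun _ : Fin N => u.degree)).subset ?_
  rintro α rfl i
  have h1 : 1 ≤ (b i).degree := Nat.one_le_iff_ne_zero.2 fun h =>
    hb i ((Finsupp.degree_eq_zero_iff _).1 h)
  have h2 : α i * (b i).degree ≤ ∑ j, α j * (b j).degree :=
    Finset.single_le_sum (f := fun j => α j * (b j).degree) (fun j _ => Nat.zero_le _)
      (Finset.mem_univ i)
  calc α i ≤ α i * (b i).degree := Nat.le_mul_of_pos_right _ h1
    _ ≤ ∑ j, α j * (b j).degree := h2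
    _ = (multidegree b α).degree := by simp [multidegree, map_sum]

/-- The generating series of the number of exponents in `W` of given multidegree. -/
noncomputable def countSeries (b : Fin N → κ →₀ ℕ) (W : Set (Fin N → ℕ)) : MvPowerSeries κ ℚ :=
  fun u => ({α | α ∈ W ∧ multidegree b α = u}.ncard : ℚ)

theorem coeff_countSeries (b : Fin N → κ →₀ ℕ) (W : Set (Fin N → ℕ)) (u : κ →₀ ℕ) :
    MvPowerSeries.coeff u (countSeries b W) =
      ({α | α ∈ W ∧ multidegree b α = u}.ncard : ℚ) := rfl

/-- Exponents with first entry 0 give the first term; from all others one unit of the first entry is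
removed, which shifts the multidegree by `b 0`. -/
theorem countSeries_succ {b : Fin (N + 1) → κ →₀ ℕ} (hb : ∀ i, b i ≠ 0)
    (W : Set (Fin (N + 1) → ℕ)) :
    countSeries b W =
      countSeries (Fin.tail b) {α | (Fin.cons 0 α : Fin (N + 1) → ℕ) ∈ W} +
        MvPowerSeries.monomial (b 0) 1 * countSeries b {α | α + Pi.single 0 1 ∈ W} := by
  ext u
  have hcons : ∀ α : Fin N → ℕ,
      multidegree b (Fin.cons 0 α) = multidegree (Fin.tail b) α := by
    intro α
    simp [multidegree, Fin.sum_univ_succ, Fin.tail]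
  have hsingle : ∀ α : Fin (N + 1) → ℕ,
      multidegree b (α + Pi.single 0 1) = multidegree b α + b 0 := by
    intro α
    rw [multidegree_add]
    congr 1
    simp [multidegree]
  have hsplit : {α | α ∈ W ∧ multidegree b α = u} =
      (fun α : Fin N → ℕ => (Fin.cons 0 α : Fin (N + 1) → ℕ)) ''
        {α | (Fin.cons 0 α : Fin (N + 1) → ℕ) ∈ W ∧ multidegree (Fin.tail b) α = u} ∪
      (fun α : Fin (N + 1) → ℕ => α + Pi.single 0 1) ''
        {α | α + Pi.single 0 1 ∈ W ∧ multidegree b α + b 0 = u} := by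
    ext α
    simp only [Set.mem_ofPred_eq, Set.mem_union, Set.mem_image]
    constructor
    · rintro ⟨hW, hu⟩
      rcases Nat.eq_zero_or_pos (α 0) with h0 | h0
      · left
        have : (Fin.cons 0 (Fin.tail α) : Fin (N + 1) → ℕ) = α := by
          rw [← h0]; exact Fin.cons_self_tail α
        exact ⟨Fin.tail α, ⟨by rwa [this], by rw [← hcons, this, hu]⟩, this⟩
      · right
        have : α - Pi.single 0 1 + Pi.single 0 1 = α := by
          funext i
          by_cases hi : i = 0
          · subst hi; simp; omega
          · simp [hi]
        exact ⟨α - Pi.single 0 1, ⟨by rwa [this], by rw [← hsingle, this, hu]⟩, this⟩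
    · rintro (⟨α', ⟨hW, hu⟩, rfl⟩ | ⟨α', ⟨hW, hu⟩, rfl⟩)
      · exact ⟨hW, by rw [hcons, hu]⟩
      · exact ⟨hW, by rw [hsingle, hu]⟩
  have hdisj : Disjoint
      ((fun α : Fin N → ℕ => (Fin.cons 0 α : Fin (N + 1) → ℕ)) ''
        {α | (Fin.cons 0 α : Fin (N + 1) → ℕ) ∈ W ∧ multidegree (Fin.tail b) α = u})
      ((fun α : Fin (N + 1) → ℕ => α + Pi.single 0 1) ''
        {α | α + Pi.single 0 1 ∈ W ∧ multidegree b α + b 0 = u}) := by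
    rw [Set.disjoint_left]
    rintro _ ⟨α, -, rfl⟩ ⟨β, -, h⟩
    have := congr_fun h 0
    simp at this
  have hfin := (finite_multidegree_eq hb u).subset
    (fun α (hα : α ∈ {α | α ∈ W ∧ multidegree b α = u}) => hα.2)
  rw [hsplit] at hfin
  rw [map_add, MvPowerSeries.coeff_monomial_mul, coeff_countSeries, coeff_countSeries, hsplit,
    Set.ncard_union_eq hdisj (hfin.subset Set.subset_union_left)
      (hfin.subset Set.subset_union_right),
    Set.ncard_image_of_injective _ (fun x y h => by simpa using h),
    Set.ncard_image_of_injective _ (add_left_injective _), Nat.cast_add]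
  congr 1
  split_ifs with h
  · rw [one_mul, coeff_countSeries]
    congr 2
    ext α
    rw [Set.mem_ofPred_eq, Set.mem_ofPred_eq, eq_tsub_iff_add_eq_of_le h]
    rfl
  · rw [Nat.cast_eq_zero]
    refine (congr_arg Set.ncard (Set.eq_empty_of_forall_notMem ?_)).trans (Set.ncard_empty _)
    rintro α ⟨-, rfl⟩
    exact h le_add_self

/-- Dickson's lemma: otherwise there are `α s` witnessing failure for every `s`. Well-quasi-ordering
gives `s < t` with `α s ≤ α t`, so `α s + (s + 1) e₀ ≤ α t + t e₀` lies in the lower set, a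
contradiction. -/
theorem exists_stable_of_isLowerSet {W : Set (Fin (N + 1) → ℕ)} (hW : IsLowerSet W) :
    ∃ s : ℕ, ∀ α : Fin (N + 1) → ℕ, α + Pi.single 0 s ∈ W → α + Pi.single 0 (s + 1) ∈ W := by
  by_contra! h
  choose α hα hα' using h
  obtain ⟨s, t, hst, hle⟩ := wellQuasiOrdered_le α
  refine hα' s (hW ?_ (hα t))
  intro i
  by_cases hi : i = 0
  · subst hi
    have : α s 0 ≤ α t 0 := hle 0
    simp only [Pi.add_apply, Pi.single_eq_same]
    exact Nat.add_le_add this hst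
  · simpa [hi] using hle i

/-- **Hilbert–Serre** for monomials: the generating series of a lower set of exponents is
rational. -/
theorem exists_countSeries_mul_prod_eq {b : Fin N → κ →₀ ℕ} (hb : ∀ i, b i ≠ 0)
    {W : Set (Fin N → ℕ)} (hW : IsLowerSet W) :
    ∃ Q : MvPolynomial κ ℚ,
      countSeries b W * ∏ i, (1 - MvPowerSeries.monomial (b i) 1) = (Q : MvPowerSeries κ ℚ) := by
  induction N with
  | zero =>
    by_cases h : (0 : Fin 0 → ℕ) ∈ W
    · classical
      refine ⟨1, ?_⟩
      have hW1 : W = {0} := Set.eq_singleton_iff_unique_mem.2 ⟨h, fun x _ => Subsingleton.elim _ _⟩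
      ext u
      simp only [Finset.univ_eq_empty, Finset.prod_empty, mul_one, coeff_countSeries,
        MvPolynomial.coeff_coe, hW1, multidegree,
        Finset.sum_empty, Set.mem_singleton_iff]
      rw [MvPolynomial.coeff_one]
      by_cases hu : 0 = u
      · simp [hu]
      · simp [hu]
    · refine ⟨0, ?_⟩
      have hW1 : W = ∅ := Set.eq_empty_of_forall_notMem fun x hx => h (by
        rwa [Subsingleton.elim (0 : Fin 0 → ℕ) x])
      ext u
      simp [coeff_countSeries, hW1]
  | succ N ih =>
    obtain ⟨s, hs⟩ := exists_stable_of_isLowerSet hW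
    -- Replacing `W` by its shift `{α | α + e₀ ∈ W}` lowers the stabilising index by one.
    induction s generalizing W with
    | zero =>
      -- For index 0 the set equals its own shift, so the recurrence becomes `(1 - X^(b 0)) C_W =
      -- C_slice`, with the slice in one variable fewer.
      have hWW : {α | α + Pi.single 0 1 ∈ W} = W := by
        ext α
        exact ⟨fun h => hW (le_add_of_nonneg_right (by simp)) h, fun h => hs α (by simpa using h)⟩
      have h1 := countSeries_succ hb W
      rw [hWW] at h1
      obtain ⟨Q, hQ⟩ := ih (b := Fin.tail b) (fun i => hb _)
        (W := {α | (Fin.cons 0 α : Fin (N + 1) → ℕ) ∈ W})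
        (fun α β h hα => hW (Fin.cons_le_cons.2 ⟨le_rfl, h⟩) hα)
      refine ⟨Q, ?_⟩
      rw [Fin.prod_univ_succ, ← hQ]
      simp only [Fin.tail]
      linear_combination (∏ i : Fin N, (1 - MvPowerSeries.monomial (b i.succ) (1 : ℚ))) * h1
    | succ s ihs =>
      have h1 := countSeries_succ hb W
      obtain ⟨Q, hQ⟩ := ih (b := Fin.tail b) (fun i => hb _)
        (W := {α | (Fin.cons 0 α : Fin (N + 1) → ℕ) ∈ W})
        (fun α β h hα => hW (Fin.cons_le_cons.2 ⟨le_rfl, h⟩) hα)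
      obtain ⟨Q', hQ'⟩ := ihs (W := {α | α + Pi.single 0 1 ∈ W})
        (fun α β h hα => hW (add_le_add_left h _) hα) (by
          intro α hα
          have := hs α (by
            simpa [add_assoc, ← Pi.single_add] using hα)
          simpa [add_assoc, ← Pi.single_add] using this)
      refine ⟨(1 - MvPolynomial.monomial (b 0) 1) * Q + MvPolynomial.monomial (b 0) 1 * Q', ?_⟩
      rw [MvPolynomial.coe_add, MvPolynomial.coe_mul, MvPolynomial.coe_mul, ← hQ, ← hQ',
        Fin.prod_univ_succ, h1]
      have h2 : ((1 - MvPolynomial.monomial (b 0) 1 : MvPolynomial κ ℚ) : MvPowerSeries κ ℚ) =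
          1 - MvPowerSeries.monomial (b 0) 1 := by
        have := map_sub (MvPolynomial.coeToMvPowerSeries.ringHom (σ := κ) (R := ℚ)) 1
          (MvPolynomial.monomial (b 0) 1)
        simpa using this
      rw [h2, MvPolynomial.coe_monomial]
      simp only [Fin.tail]
      ring

end CountSeries

/-! ### Hilbert series of algebras with multigraded generators -/

section HilbertSeries

variable {k A κ : Type*} [Field k] [CommRing A] [Algebra k A] {N : ℕ}

/-- The monomial of exponents `α` in the elements `zᵢ`. -/
def monomialValue (z : Fin N → A) (α : Fin N → ℕ) : A := ∏ i, z i ^ α i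

theorem monomialValue_add (z : Fin N → A) (α β : Fin N → ℕ) :
    monomialValue z (α + β) = monomialValue z α * monomialValue z β := by
  simp [monomialValue, pow_add, Finset.prod_mul_distrib]

/-- The span of the monomials of multidegree `u`. -/
def monomialSpan (k : Type*) [Field k] [Algebra k A] (z : Fin N → A) (b : Fin N → κ →₀ ℕ)
    (u : κ →₀ ℕ) : Submodule k A :=
  Submodule.span k (monomialValue z '' {α | multidegree b α = u})

/-- The exponents whose monomial is not in the span of the lexicographically smaller monomials of
the same multidegree. -/
def standardExponents (k : Type*) [Field k] [Algebra k A] (z : Fin N → A)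
    (b : Fin N → κ →₀ ℕ) : Set (Fin N → ℕ) :=
  {α | monomialValue z α ∉ Submodule.span k
    (monomialValue z '' {β | multidegree b β = multidegree b α ∧ toLex β < toLex α})}

/-- The lexicographic order is compatible with addition: a relation expressing a monomial through
smaller ones remains such a relation after multiplication by any monomial. -/
theorem isLowerSet_standardExponents (z : Fin N → A) (b : Fin N → κ →₀ ℕ) :
    IsLowerSet (standardExponents k z b) := by
  intro α β hle hα hβ
  obtain ⟨γ, rfl⟩ := le_iff_exists_add.1 hle
  apply hα
  have h1 : LinearMap.mulRight k (monomialValue z γ) (monomialValue z β) ∈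
      (Submodule.span k (monomialValue z '' {δ | multidegree b δ = multidegree b β ∧
        toLex δ < toLex β})).map (LinearMap.mulRight k (monomialValue z γ)) :=
    Submodule.mem_map_of_mem hβ
  rw [LinearMap.mulRight_apply, ← monomialValue_add, Submodule.map_span] at h1
  refine Submodule.span_mono ?_ h1
  rintro _ ⟨_, ⟨δ, ⟨hδ, hlt⟩, rfl⟩, rfl⟩
  refine ⟨δ + γ, ⟨?_, ?_⟩, ?_⟩
  · rw [multidegree_add, multidegree_add, hδ]
  · rw [toLex_add, toLex_add]
    exact add_lt_add_left hlt _
  · rw [LinearMap.mulRight_apply, monomialValue_add]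

/-- The greedy basis for the lexicographic order consists of the standard monomials of multidegree
`u`. -/
theorem finrank_monomialSpan (z : Fin N → A) {b : Fin N → κ →₀ ℕ} (hb : ∀ i, b i ≠ 0)
    (u : κ →₀ ℕ) :
    Module.finrank k (monomialSpan k z b u) =
      {α | α ∈ standardExponents k z b ∧ multidegree b α = u}.ncard := by
  classical
  have hfin := finite_multidegree_eq hb u
  have h1 := finrank_span_image_eq_card_filter (K := k) (τ := Lex (Fin N → ℕ))
    (fun α => monomialValue z (ofLex α)) (hfin.toFinset.map toLex.toEmbedding)
  have h2 : (fun α : Lex (Fin N → ℕ) => monomialValue z (ofLex α)) ''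
      (hfin.toFinset.map toLex.toEmbedding : Finset (Lex (Fin N → ℕ))) =
      monomialValue z '' {α | multidegree b α = u} := by
    rw [Finset.coe_map, Set.image_image]
    simp
  rw [h2] at h1
  rw [monomialSpan, h1, ← Set.ncard_coe_finset]
  rw [← Set.ncard_image_of_injective {α | α ∈ standardExponents k z b ∧ multidegree b α = u}
    (toLex (α := Fin N → ℕ)).injective]
  congr 1
  ext α
  obtain ⟨α, rfl⟩ := toLex.surjective α
  have h3 : (fun α : Lex (Fin N → ℕ) => monomialValue z (ofLex α)) ''
      {β | β ∈ hfin.toFinset.map toLex.toEmbedding ∧ β < toLex α} =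
      monomialValue z '' {β | multidegree b β = u ∧ toLex β < toLex α} := by
    ext y
    constructor
    · rintro ⟨β, ⟨hβ, hlt⟩, rfl⟩
      obtain ⟨β, rfl⟩ := toLex.surjective β
      exact ⟨β, ⟨by simpa using hβ, hlt⟩, rfl⟩
    · rintro ⟨β, ⟨hβ, hlt⟩, rfl⟩
      exact ⟨toLex β, ⟨by simpa using hβ, hlt⟩, rfl⟩
  simp only [Finset.coe_filter, Set.mem_ofPred_eq]
  erw [h3]
  simp only [Finset.mem_map_equiv, standardExponents, Set.mem_image, Set.mem_ofPred_eq]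
  constructor
  · rintro ⟨hu, h⟩
    have hu' : multidegree b α = u := by simpa using hu
    exact ⟨α, ⟨by rw [hu']; exact h, hu'⟩, rfl⟩
  · rintro ⟨β, ⟨h, hu⟩, hβ⟩
    obtain rfl := toLex.injective hβ
    exact ⟨by simpa using hu, by rw [hu] at h; exact h⟩

/-- The Hilbert series of the algebra generated by the multigraded elements `zᵢ`. -/
noncomputable def monomialHilbertSeries (k : Type*) [Field k] [Algebra k A] (z : Fin N → A)
    (b : Fin N → κ →₀ ℕ) : MvPowerSeries κ ℚ :=
  fun u => (Module.finrank k (monomialSpan k z b u) : ℚ)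

theorem coeff_monomialHilbertSeries (z : Fin N → A) (b : Fin N → κ →₀ ℕ) (u : κ →₀ ℕ) :
    MvPowerSeries.coeff u (monomialHilbertSeries k z b) =
      (Module.finrank k (monomialSpan k z b u) : ℚ) := rfl

/-- The **Hilbert–Serre theorem** for the algebra generated by finitely many multigraded
elements. -/
theorem exists_hilbertSeries_mul_prod_eq (z : Fin N → A) {b : Fin N → κ →₀ ℕ}
    (hb : ∀ i, b i ≠ 0) :
    ∃ Q : MvPolynomial κ ℚ,
      monomialHilbertSeries k z b * ∏ i, (1 - MvPowerSeries.monomial (b i) 1) =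
        (Q : MvPowerSeries κ ℚ) := by
  obtain ⟨Q, hQ⟩ := exists_countSeries_mul_prod_eq hb (isLowerSet_standardExponents (k := k) z b)
  refine ⟨Q, ?_⟩
  rw [← hQ]
  congr 1
  ext u
  rw [coeff_monomialHilbertSeries, coeff_countSeries, finrank_monomialSpan z hb]

/-- The Hilbert function of an algebra generated by elements of degree one is eventually
polynomial. -/
theorem exists_hilbertPoly (z : Fin N → A) :
    ∃ (q : Polynomial ℚ) (M : ℕ), ∀ m, M ≤ m →
      (Module.finrank k (Submodule.span k
        (monomialValue z '' {α | ∑ i, α i = m})) : ℚ) = q.eval (m : ℚ) := by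
  obtain ⟨Q, hQ⟩ := exists_hilbertSeries_mul_prod_eq (k := k) (κ := Unit) z
    (b := fun _ => Finsupp.single () 1) (fun i => by simp)
  set F : PowerSeries ℚ := monomialHilbertSeries k z
    (fun _ => (Finsupp.single () 1 : Unit →₀ ℕ)) with hF
  set p : Polynomial ℚ := MvPolynomial.aeval (fun _ => Polynomial.X) Q with hp
  have hpQ : (p : PowerSeries ℚ) = (Q : MvPowerSeries Unit ℚ) := by
    have : ((Polynomial.coeToPowerSeries.algHom ℚ).comp
        (MvPolynomial.aeval (R := ℚ) fun _ => Polynomial.X) :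
          MvPolynomial Unit ℚ →ₐ[ℚ] PowerSeries ℚ) =
        MvPolynomial.coeToMvPowerSeries.algHom ℚ := by
      ext
      simp
      rfl
    have h := DFunLike.congr_fun this Q
    simpa using h
  rw [Finset.prod_const, Finset.card_univ, Fintype.card_fin, ← hpQ] at hQ
  -- `PowerSeries` unfolds to `MvPowerSeries Unit`, so this is the same equation.
  replace hQ : F * (1 - PowerSeries.X) ^ N = (p : PowerSeries ℚ) := hQ
  have hF' : F = p * (PowerSeries.invOneSubPow ℚ N : PowerSeries ℚ) := by
    rw [← hQ]
    have h := (PowerSeries.invOneSubPow ℚ N).inv_val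
    rw [PowerSeries.invOneSubPow_inv_eq_one_sub_pow] at h
    rw [mul_assoc, h, mul_one]
  refine ⟨p.hilbertPoly N, p.natDegree + 1, fun m hm => ?_⟩
  rw [← Polynomial.coeff_mul_invOneSubPow_eq_hilbertPoly_eval N (Nat.lt_of_succ_le hm), ← hF']
  change _ = (Module.finrank k (monomialSpan k z
    (fun _ => Finsupp.single () 1) (Finsupp.single () m)) : ℚ)
  rw [monomialSpan]
  have : ∀ α : Fin N → ℕ, multidegree (fun _ => Finsupp.single () 1) α = Finsupp.single () m ↔
      ∑ i, α i = m := by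
    intro α
    rw [Finsupp.unique_ext_iff]
    simp [multidegree]
  have hset : {α : Fin N → ℕ | multidegree (fun _ => Finsupp.single () 1) α =
      Finsupp.single () m} = {α | ∑ i, α i = m} := Set.ext this
  rw [hset]

end HilbertSeries

/-! ### Partial fractions for denominators ∏ (1 - X^p) -/

section PartialFractions

/-- The product of the factors `1 - X^p`, `p ∈ S`. -/
noncomputable def denominator {κ : Type*} (S : Multiset (κ →₀ ℕ)) : MvPolynomial κ ℚ :=
  (S.map fun p => 1 - MvPolynomial.monomial p 1).prod

/-- `f` is a rational function with denominator `∏ (1 - X^p)`, `p ∈ S`. -/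
def HasDenominator {κ : Type*} (S : Multiset (κ →₀ ℕ)) (f : MvPowerSeries κ ℚ) : Prop :=
  ∃ Q : MvPolynomial κ ℚ, f * (denominator S : MvPowerSeries κ ℚ) = (Q : MvPowerSeries κ ℚ)

variable {κ : Type*}

@[simp] theorem denominator_zero : denominator (0 : Multiset (κ →₀ ℕ)) = 1 := by
  simp [denominator]

@[simp] theorem denominator_cons (p : κ →₀ ℕ) (S : Multiset (κ →₀ ℕ)) :
    denominator (p ::ₘ S) = (1 - MvPolynomial.monomial p 1) * denominator S := by
  simp [denominator]

@[simp] theorem denominator_add (S T : Multiset (κ →₀ ℕ)) :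
    denominator (S + T) = denominator S * denominator T := by
  simp [denominator]

theorem one_sub_monomial_dvd (p : κ →₀ ℕ) (n : ℕ) :
    (1 - MvPolynomial.monomial p 1 : MvPolynomial κ ℚ) ∣
      1 - MvPolynomial.monomial (n • p) 1 := by
  have h := sub_dvd_pow_sub_pow (1 : MvPolynomial κ ℚ) (MvPolynomial.monomial p 1) n
  rwa [one_pow, MvPolynomial.monomial_pow, one_pow] at h

/-- Since `1 - y` divides `1 - y ^ n`, factors may be replaced by multiples on the same ray; this is
how denominators on one ray are brought to a common form. -/
theorem denominator_dvd_map (S : Multiset (κ →₀ ℕ)) (φ : (κ →₀ ℕ) → κ →₀ ℕ)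
    (h : ∀ p ∈ S, ∃ n : ℕ, φ p = n • p) : denominator S ∣ denominator (S.map φ) := by
  rw [denominator, denominator, Multiset.map_map]
  refine Multiset.prod_dvd_prod_of_dvd _ _ fun p hp => ?_
  obtain ⟨n, hn⟩ := h p hp
  simp only [Function.comp_apply, hn]
  exact one_sub_monomial_dvd p n

theorem HasDenominator.of_dvd {S T : Multiset (κ →₀ ℕ)} {f : MvPowerSeries κ ℚ}
    (h : HasDenominator S f) (hST : denominator S ∣ denominator T) : HasDenominator T f := by
  obtain ⟨Q, hQ⟩ := h
  obtain ⟨R, hR⟩ := hST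
  refine ⟨Q * R, ?_⟩
  rw [hR, MvPolynomial.coe_mul, MvPolynomial.coe_mul, ← hQ, mul_assoc]

theorem HasDenominator.of_le {S T : Multiset (κ →₀ ℕ)} {f : MvPowerSeries κ ℚ}
    (h : HasDenominator S f) (hST : S ≤ T) : HasDenominator T f := by
  obtain ⟨U, rfl⟩ := Multiset.le_iff_exists_add.1 hST
  exact h.of_dvd (by rw [denominator_add]; exact dvd_mul_right _ _)

theorem HasDenominator.zero (S : Multiset (κ →₀ ℕ)) : HasDenominator S 0 := ⟨0, by simp⟩

theorem HasDenominator.add {S : Multiset (κ →₀ ℕ)} {f g : MvPowerSeries κ ℚ}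
    (hf : HasDenominator S f) (hg : HasDenominator S g) : HasDenominator S (f + g) := by
  obtain ⟨Q, hQ⟩ := hf
  obtain ⟨R, hR⟩ := hg
  exact ⟨Q + R, by rw [add_mul, hQ, hR, MvPolynomial.coe_add]⟩

theorem coe_one_sub_monomial (p : κ →₀ ℕ) :
    ((1 - MvPolynomial.monomial p 1 : MvPolynomial κ ℚ) : MvPowerSeries κ ℚ) =
      1 - MvPowerSeries.monomial p 1 := by
  have := map_sub (MvPolynomial.coeToMvPowerSeries.ringHom (σ := κ) (R := ℚ)) 1
    (MvPolynomial.monomial p 1)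
  simpa using this

theorem isUnit_one_sub_monomial {p : κ →₀ ℕ} (hp : p ≠ 0) :
    IsUnit (1 - MvPowerSeries.monomial p 1 : MvPowerSeries κ ℚ) := by
  classical
  rw [MvPowerSeries.isUnit_iff_constantCoeff]
  rw [map_sub, map_one, ← MvPowerSeries.coeff_zero_eq_constantCoeff_apply,
    MvPowerSeries.coeff_monomial, if_neg hp.symm, sub_zero]
  exact isUnit_one

/-- Partial fraction decomposition: if every `p ∈ a` and every `q ∈ r` have `w` in the interior of
the cone they span, then a fraction with denominator `a + r` is a sum of one without `r` and one
without `a`, at the cost of multiples of `w` in the denominators. -/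
theorem HasDenominator.exists_add {w : κ →₀ ℕ} (hw : w ≠ 0) (n : ℕ) :
    ∀ (a r c : Multiset (κ →₀ ℕ)) (f : MvPowerSeries κ ℚ), a.card + r.card = n →
      (∀ p ∈ a, ∀ q ∈ r, ∃ C α ε : ℕ, 0 < C ∧ C • w = α • p + ε • q) →
      (∀ p ∈ c, ∃ t : ℕ, 0 < t ∧ p = t • w) → HasDenominator (a + c + r) f →
      ∃ (f₁ f₂ : MvPowerSeries κ ℚ) (c₁ c₂ : Multiset (κ →₀ ℕ)), f = f₁ + f₂ ∧
        (∀ p ∈ c₁, ∃ t : ℕ, 0 < t ∧ p = t • w) ∧ (∀ p ∈ c₂, ∃ t : ℕ, 0 < t ∧ p = t • w) ∧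
        HasDenominator (a + c₁) f₁ ∧ HasDenominator (c₂ + r) f₂ := by
  induction n with
  | zero =>
    intro a r c f hn _ hc hf
    obtain rfl : a = 0 := Multiset.card_eq_zero.1 (by omega)
    exact ⟨0, f, 0, c, by simp, by simp, hc, .zero _, by simpa using hf⟩
  | succ n ih =>
    intro a r c f hn har hc hf
    induction a using Multiset.induction_on with
    | empty => exact ⟨0, f, 0, c, by simp, by simp, hc, .zero _, by simpa using hf⟩
    | cons p a _ =>
      induction r using Multiset.induction_on with
      | empty => exact ⟨f, 0, c, 0, by simp, hc, by simp, by simpa using hf, .zero _⟩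
      | cons q r _ =>
        rw [Multiset.card_cons, Multiset.card_cons] at hn
        obtain ⟨C, α, ε, hC, hrel⟩ :=
          har p (Multiset.mem_cons_self _ _) q (Multiset.mem_cons_self _ _)
        have hCw : C • w ≠ 0 := smul_ne_zero hC.ne' hw
        obtain ⟨Z, hZ⟩ := isUnit_one_sub_monomial hCw
        obtain ⟨gp, hgp⟩ := one_sub_monomial_dvd p α
        obtain ⟨gq, hgq⟩ := one_sub_monomial_dvd q ε
        have hgp' := congr_arg (fun P : MvPolynomial κ ℚ => (P : MvPowerSeries κ ℚ)) hgp
        have hgq' := congr_arg (fun P : MvPolynomial κ ℚ => (P : MvPowerSeries κ ℚ)) hgq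
        simp only [MvPolynomial.coe_mul, coe_one_sub_monomial] at hgp' hgq'
        -- As `C w = α p + ε q`, the unit `1 - X^(C w)` splits as shown. Dividing `f` times this
        -- identity by the unit writes `f` as two terms: the first has its factor `1 - X^p`
        -- cancelled, the second its factor `1 - X^q`, each at the price of one new factor `1 - X^(C
        -- w)`. Both then have fewer factors off the ray of `w`.
        have hZrel : (1 - MvPowerSeries.monomial (C • w) 1 : MvPowerSeries κ ℚ) =
            (1 - MvPowerSeries.monomial (α • p) 1) + MvPowerSeries.monomial (α • p) 1 *
              (1 - MvPowerSeries.monomial (ε • q) 1) := by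
          rw [hrel, mul_sub, MvPowerSeries.monomial_mul_monomial]
          simp
        have hZinv : (1 - MvPowerSeries.monomial (C • w) 1 : MvPowerSeries κ ℚ) *
            (↑Z⁻¹ : MvPowerSeries κ ℚ) = 1 := by
          rw [← hZ]; exact Z.mul_inv
        obtain ⟨Q, hQ⟩ := hf
        simp only [denominator_add, denominator_cons, MvPolynomial.coe_mul,
          coe_one_sub_monomial] at hQ
        have hc' : ∀ x ∈ (C • w) ::ₘ c, ∃ t : ℕ, 0 < t ∧ x = t • w := by
          intro x hx
          rcases Multiset.mem_cons.1 hx with rfl | hx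
          · exact ⟨C, hC, rfl⟩
          · exact hc x hx
        obtain ⟨f₁, f₂, c₁, c₂, hf, hc₁, hc₂, hf₁, hf₂⟩ := ih a (q ::ₘ r) ((C • w) ::ₘ c)
          (f * (1 - MvPowerSeries.monomial (α • p) 1) * (↑Z⁻¹ : MvPowerSeries κ ℚ))
          (by rw [Multiset.card_cons]; omega)
          (fun x hx y hy => har x (Multiset.mem_cons_of_mem hx) y hy) hc'
          ⟨Q * gp, by
            simp only [denominator_add, denominator_cons, MvPolynomial.coe_mul,
              coe_one_sub_monomial]
            rw [← hQ, hgp']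
            linear_combination (f * (1 - MvPowerSeries.monomial p 1) * (gp : MvPowerSeries κ ℚ) *
              (denominator a : MvPowerSeries κ ℚ) * (denominator c : MvPowerSeries κ ℚ) *
              (1 - MvPowerSeries.monomial q 1) * (denominator r : MvPowerSeries κ ℚ)) * hZinv⟩
        obtain ⟨g₁, g₂, e₁, e₂, hg, he₁, he₂, hg₁, hg₂⟩ := ih (p ::ₘ a) r ((C • w) ::ₘ c)
          (f * (MvPowerSeries.monomial (α • p) 1 * (1 - MvPowerSeries.monomial (ε • q) 1)) *
            (↑Z⁻¹ : MvPowerSeries κ ℚ))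
          (by rw [Multiset.card_cons]; omega)
          (fun x hx y hy => har x hx y (Multiset.mem_cons_of_mem hy)) hc'
          ⟨Q * MvPolynomial.monomial (α • p) 1 * gq, by
            simp only [denominator_add, denominator_cons, MvPolynomial.coe_mul,
              coe_one_sub_monomial, MvPolynomial.coe_monomial]
            rw [← hQ, hgq']
            linear_combination (f * (1 - MvPowerSeries.monomial p 1) * (gq : MvPowerSeries κ ℚ) *
              MvPowerSeries.monomial (α • p) 1 *
              (denominator a : MvPowerSeries κ ℚ) * (denominator c : MvPowerSeries κ ℚ) *
              (1 - MvPowerSeries.monomial q 1) * (denominator r : MvPowerSeries κ ℚ)) * hZinv⟩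
        refine ⟨f₁ + g₁, f₂ + g₂, c₁ + e₁, c₂ + e₂, ?_, ?_, ?_, ?_, ?_⟩
        · calc f = f * (1 - MvPowerSeries.monomial (C • w) 1) * (↑Z⁻¹ : MvPowerSeries κ ℚ) := by
                rw [mul_assoc, hZinv, mul_one]
            _ = _ := by
                rw [hZrel, mul_add, add_mul, hf, hg]
                ring
        · intro x hx
          rcases Multiset.mem_add.1 hx with hx | hx
          exacts [hc₁ x hx, he₁ x hx]
        · intro x hx
          rcases Multiset.mem_add.1 hx with hx | hx
          exacts [hc₂ x hx, he₂ x hx]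
        · refine (hf₁.of_le ?_).add (hg₁.of_le ?_)
          · exact add_le_add (Multiset.le_cons_self _ _) (Multiset.le_add_right _ _)
          · exact add_le_add le_rfl (Multiset.le_add_left _ _)
        · refine (hf₂.of_le ?_).add (hg₂.of_le ?_)
          · exact add_le_add (Multiset.le_add_right _ _) le_rfl
          · exact add_le_add (Multiset.le_add_left _ _) (Multiset.le_cons_self _ _)

/-- A fraction whose denominators lie in the half-space `φ ≥ 0` has support in a half-space
`φ ≥ -C`. -/
theorem HasDenominator.exists_coeff_eq_zero (φ : (κ →₀ ℕ) →+ ℤ) {S : Multiset (κ →₀ ℕ)}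
    (hS : ∀ p ∈ S, p ≠ 0 ∧ 0 ≤ φ p) {f : MvPowerSeries κ ℚ} (hf : HasDenominator S f) :
    ∃ C : ℤ, ∀ u, φ u < C → MvPowerSeries.coeff u f = 0 := by
  classical
  induction S using Multiset.induction_on generalizing f with
  | empty =>
    obtain ⟨Q, hQ⟩ := hf
    rw [denominator_zero, MvPolynomial.coe_one, mul_one] at hQ
    subst hQ
    obtain ⟨C, hC⟩ := (Q.support.image φ).finite_toSet.bddBelow
    refine ⟨C, fun u hu => ?_⟩
    rw [MvPolynomial.coeff_coe]
    by_contra h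
    exact absurd (hC (Finset.mem_coe.2 (Finset.mem_image_of_mem φ
      (MvPolynomial.mem_support_iff.2 h)))) (not_le.2 hu)
  | cons p S ih =>
    obtain ⟨Q, hQ⟩ := hf
    rw [denominator_cons, MvPolynomial.coe_mul, ← mul_assoc, coe_one_sub_monomial] at hQ
    obtain ⟨C, hC⟩ := ih (fun q hq => hS q (Multiset.mem_cons_of_mem hq)) ⟨Q, hQ⟩
    obtain ⟨hp, hφ⟩ := hS p (Multiset.mem_cons_self _ _)
    refine ⟨C, fun u => ?_⟩
    -- Where `φ u < C`, the coefficient of `f * (1 - X^p)` vanishes, so that of `f` at `u` equals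
    -- the one at `u - p` (or is 0). There `φ` is no larger and the total degree is smaller.
    induction hd : u.degree using Nat.strong_induction_on generalizing u with
    | _ d ihd =>
      intro hu
      have h := hC u hu
      rw [mul_sub, mul_one, map_sub, MvPowerSeries.coeff_mul_monomial] at h
      split_ifs at h with hpu
      · have hsum : u - p + p = u := tsub_add_cancel_of_le hpu
        have h1 : (u - p).degree + p.degree = u.degree := by rw [← map_add, hsum]
        have h2 : φ (u - p) + φ p = φ u := by rw [← map_add, hsum]
        have h3 : p.degree ≠ 0 := fun h => hp ((Finsupp.degree_eq_zero_iff _).1 h)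
        rw [ihd (u - p).degree (by omega) (u - p) rfl (by omega), zero_mul, sub_zero] at h
        exact h
      · simpa using h

/-- The coefficients of `(1 - X)⁻ʳ`, extended by zero to negative indices. -/
noncomputable def invOneSubPowCoeff (r : ℕ) (i : ℤ) : ℚ :=
  if i < 0 then 0 else PowerSeries.coeff i.toNat (PowerSeries.invOneSubPow ℚ r : PowerSeries ℚ)

theorem invOneSubPowCoeff_of_neg (r : ℕ) {i : ℤ} (hi : i < 0) : invOneSubPowCoeff r i = 0 :=
  if_pos hi

theorem invOneSubPow_succ_mul (r : ℕ) :
    (PowerSeries.invOneSubPow ℚ (r + 1) : PowerSeries ℚ) * (1 - PowerSeries.X) =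
      (PowerSeries.invOneSubPow ℚ r : PowerSeries ℚ) := by
  have h := PowerSeries.one_sub_pow_mul_invOneSubPow_val_add_eq_invOneSubPow_val ℚ r 1
  rw [pow_one] at h
  rw [mul_comm]
  exact h

/-- The extension by zero to negative indices lets the difference equation coming from
multiplication by `1 - X` hold for all integers. -/
theorem invOneSubPowCoeff_sub (r : ℕ) (i : ℤ) :
    invOneSubPowCoeff (r + 1) i - invOneSubPowCoeff (r + 1) (i - 1) = invOneSubPowCoeff r i := by
  rcases lt_trichotomy i 0 with hi | rfl | hi
  · rw [invOneSubPowCoeff_of_neg _ hi, invOneSubPowCoeff_of_neg _ hi,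
      invOneSubPowCoeff_of_neg _ (by omega), sub_zero]
  · rw [invOneSubPowCoeff_of_neg (i := 0 - 1) _ (by omega), sub_zero]
    simp only [invOneSubPowCoeff, lt_irrefl, if_false, Int.toNat_zero]
    rw [← invOneSubPow_succ_mul r]
    simp
  · obtain ⟨n, rfl⟩ : ∃ n : ℕ, i = (n : ℤ) + 1 := ⟨(i - 1).toNat, by omega⟩
    have h1 : ¬ ((n : ℤ) + 1 < 0) := by omega
    have h2 : ¬ ((n : ℤ) + 1 - 1 < 0) := by omega
    have h3 : ((n : ℤ) + 1).toNat = n + 1 := by omega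
    have h4 : ((n : ℤ) + 1 - 1).toNat = n := by omega
    rw [invOneSubPowCoeff, invOneSubPowCoeff, invOneSubPowCoeff, if_neg h1, if_neg h1, if_neg h2,
      h3, h4, ← invOneSubPow_succ_mul r, mul_sub, mul_one, map_sub, PowerSeries.coeff_succ_mul_X]

theorem invOneSubPowCoeff_succ_of_nonpos (r : ℕ) {i : ℤ} (hi : i ≤ 0) :
    invOneSubPowCoeff (r + 1) i = invOneSubPowCoeff r i := by
  rw [← invOneSubPowCoeff_sub r, invOneSubPowCoeff_of_neg (i := i - 1) _ (by omega), sub_zero]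

/-- Index 0 is excluded because of `r = 0`, where the series is 1 and the Hilbert polynomial is 0.
-/
theorem invOneSubPowCoeff_eq_eval (r : ℕ) {i : ℤ} (hi : 0 < i) :
    invOneSubPowCoeff r i = (Polynomial.hilbertPoly (1 : Polynomial ℚ) r).eval (i : ℚ) := by
  obtain ⟨n, rfl⟩ : ∃ n : ℕ, i = n := ⟨i.toNat, by omega⟩
  have h := Polynomial.coeff_mul_invOneSubPow_eq_hilbertPoly_eval (F := ℚ) (p := 1) r (n := n)
    (by simpa using hi)
  rw [Polynomial.coe_one, one_mul] at h
  rw [invOneSubPowCoeff, if_neg (by omega), Int.toNat_natCast, h]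
  simp

theorem invOneSubPowCoeff_zero (i : ℤ) : invOneSubPowCoeff 0 i = if i = 0 then 1 else 0 := by
  rcases lt_trichotomy i 0 with hi | rfl | hi
  · rw [invOneSubPowCoeff_of_neg _ hi, if_neg hi.ne]
  · simp [invOneSubPowCoeff, PowerSeries.invOneSubPow_zero]
  · rw [invOneSubPowCoeff_eq_eval _ hi, Polynomial.hilbertPoly_zero_right, if_neg hi.ne']
    simp

/-- The expansion of `(1 - X^V)⁻ʳ (1 - X^V')⁻ˢ`, where `φ / Δ` and `ψ / Δ` are the coordinates
with respect to `V` and `V'`. -/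
noncomputable def twoRaySeries (φ ψ : (κ →₀ ℕ) →+ ℤ) (Δ : ℤ) (r s : ℕ) : MvPowerSeries κ ℚ :=
  fun u => open scoped Classical in if Δ ∣ φ u ∧ Δ ∣ ψ u then
    invOneSubPowCoeff r (φ u / Δ) * invOneSubPowCoeff s (ψ u / Δ) else 0

theorem coeff_twoRaySeries (φ ψ : (κ →₀ ℕ) →+ ℤ) (Δ : ℤ) (r s : ℕ) (u : κ →₀ ℕ) :
    MvPowerSeries.coeff u (twoRaySeries φ ψ Δ r s) =
      open scoped Classical in if Δ ∣ φ u ∧ Δ ∣ ψ u then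
        invOneSubPowCoeff r (φ u / Δ) * invOneSubPowCoeff s (ψ u / Δ) else 0 := rfl

theorem twoRaySeries_comm (φ ψ : (κ →₀ ℕ) →+ ℤ) (Δ : ℤ) (r s : ℕ) :
    twoRaySeries φ ψ Δ r s = twoRaySeries ψ φ Δ s r := by
  ext u
  rw [coeff_twoRaySeries, coeff_twoRaySeries]
  exact if_congr and_comm (mul_comm _ _) rfl

variable {φ ψ : (κ →₀ ℕ) →+ ℤ} {Δ : ℤ} {V V' : κ →₀ ℕ}

/-- Subtracting `V` lowers the coordinate `φ / Δ` by one and keeps `ψ / Δ`, so the product is a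
first difference. When `V ≤ u` fails, `hmono` forces a negative second coordinate or a nonpositive
first one, and there both sides agree without the subtracted term. -/
theorem twoRaySeries_succ_mul (hΔ : 0 < Δ)
    (hmono : ∀ u w, φ u ≤ φ w → ψ u ≤ ψ w → u ≤ w) (hφ : φ V = Δ) (hψ : ψ V = 0) (r s : ℕ) :
    twoRaySeries φ ψ Δ (r + 1) s * (1 - MvPowerSeries.monomial V 1) =
      twoRaySeries φ ψ Δ r s := by
  classical
  ext u
  rw [mul_sub, mul_one, map_sub, MvPowerSeries.coeff_mul_monomial]
  split_ifs with hVu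
  · have hsum : u - V + V = u := tsub_add_cancel_of_le hVu
    have h1 : φ (u - V) = φ u - Δ := by rw [← hφ, eq_sub_iff_add_eq, ← map_add, hsum]
    have h2 : ψ (u - V) = ψ u := by
      have : ψ (u - V) + ψ V = ψ u := by rw [← map_add, hsum]
      rwa [hψ, add_zero] at this
    simp only [coeff_twoRaySeries, h1, h2, dvd_sub_self_right, mul_one]
    split_ifs with hdvd
    · rw [← invOneSubPowCoeff_sub r (φ u / Δ)]
      have : (φ u - Δ) / Δ = φ u / Δ - 1 := by
        have := Int.add_mul_ediv_right (φ u) (-1) hΔ.ne'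
        rw [← sub_eq_add_neg] at this
        rw [← this]; congr 1; ring
      rw [this]
      ring
    · simp
  · simp only [coeff_twoRaySeries, sub_zero]
    split_ifs with hdvd
    · rcases lt_or_ge (ψ u / Δ) 0 with hneg | hpos
      · rw [invOneSubPowCoeff_of_neg _ hneg, mul_zero, mul_zero]
      · rw [invOneSubPowCoeff_succ_of_nonpos]
        by_contra! h
        refine hVu (hmono V u ?_ ?_)
        · rw [hφ]
          have := Int.mul_le_of_le_ediv hΔ (Int.add_one_le_iff.2 h)
          simpa using this
        · rw [hψ]
          simpa using Int.mul_le_of_le_ediv hΔ hpos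
    · rfl

theorem twoRaySeries_mul_pow (hΔ : 0 < Δ)
    (hmono : ∀ u w, φ u ≤ φ w → ψ u ≤ ψ w → u ≤ w) (hφ : φ V = Δ) (hψ : ψ V = 0) (r s : ℕ) :
    twoRaySeries φ ψ Δ r s * (1 - MvPowerSeries.monomial V 1) ^ r = twoRaySeries φ ψ Δ 0 s := by
  induction r with
  | zero => simp
  | succ r ih => rw [pow_succ', ← mul_assoc, twoRaySeries_succ_mul hΔ hmono hφ hψ, ih]

theorem twoRaySeries_mul_eq_one (hΔ : 0 < Δ)
    (hmono : ∀ u w, φ u ≤ φ w → ψ u ≤ ψ w → u ≤ w) (hφ : φ V = Δ) (hψ : ψ V = 0)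
    (hφ' : φ V' = 0) (hψ' : ψ V' = Δ) (r s : ℕ) :
    twoRaySeries φ ψ Δ r s * ((1 - MvPowerSeries.monomial V 1) ^ r *
      (1 - MvPowerSeries.monomial V' 1) ^ s) = 1 := by
  classical
  rw [← mul_assoc, twoRaySeries_mul_pow hΔ hmono hφ hψ, twoRaySeries_comm,
    twoRaySeries_mul_pow hΔ (fun u w h1 h2 => hmono u w h2 h1) hψ' hφ']
  ext u
  rw [coeff_twoRaySeries, MvPowerSeries.coeff_one, invOneSubPowCoeff_zero, invOneSubPowCoeff_zero]
  by_cases hu : u = 0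
  · simp [hu]
  · rw [if_neg hu]
    split_ifs with h1 h2 h3
    · exfalso
      apply hu
      have e1 : φ u = 0 := by rw [← Int.ediv_mul_cancel h1.2, h3, zero_mul]
      have e2 : ψ u = 0 := by rw [← Int.ediv_mul_cancel h1.1, h2, zero_mul]
      exact le_antisymm (hmono u 0 (by simp [e1]) (by simp [e2])) zero_le
    · simp
    · simp
    · simp
    · rfl

end PartialFractions

/-! ### Polynomiality of coefficients inside a chamber of slopes -/

section Chamber

/-- The coefficients of `f` at the multiples of some `Δ` are given by a polynomial, deep inside the
cone where the linear forms `φ` and `ψ` are nonnegative. -/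
def IsEventuallyPolynomial (φ ψ : (Fin 2 →₀ ℕ) →+ ℤ) (Δ : ℕ) (f : MvPowerSeries (Fin 2) ℚ) :
    Prop :=
  ∃ (P : MvPolynomial (Fin 2) ℚ) (K : ℤ), ∀ u : Fin 2 →₀ ℕ, K ≤ φ u → K ≤ ψ u →
    MvPowerSeries.coeff (Δ • u) f = MvPolynomial.eval (fun i => (u i : ℚ)) P

variable {φ ψ : (Fin 2 →₀ ℕ) →+ ℤ} {Δ : ℕ}

theorem IsEventuallyPolynomial.add {f g : MvPowerSeries (Fin 2) ℚ}
    (hf : IsEventuallyPolynomial φ ψ Δ f) (hg : IsEventuallyPolynomial φ ψ Δ g) :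
    IsEventuallyPolynomial φ ψ Δ (f + g) := by
  obtain ⟨P, K, hP⟩ := hf
  obtain ⟨P', K', hP'⟩ := hg
  refine ⟨P + P', max K K', fun u h1 h2 => ?_⟩
  rw [map_add, map_add, hP u (le_of_max_le_left h1) (le_of_max_le_left h2),
    hP' u (le_of_max_le_right h1) (le_of_max_le_right h2)]

theorem exists_eval_eq_addMonoidHom (φ : (Fin 2 →₀ ℕ) →+ ℤ) :
    ∃ L : MvPolynomial (Fin 2) ℚ, ∀ u : Fin 2 →₀ ℕ,
      MvPolynomial.eval (fun i => (u i : ℚ)) L = (φ u : ℚ) := by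
  refine ⟨∑ i, MvPolynomial.C (φ (Finsupp.single i 1) : ℚ) * MvPolynomial.X i, fun u => ?_⟩
  have hu : u = ∑ i, u i • Finsupp.single i 1 := by
    ext j
    fin_cases j <;> simp
  conv_rhs => rw [hu, map_sum]
  simp only [map_sum, map_nsmul, map_mul, MvPolynomial.eval_C, MvPolynomial.eval_X, nsmul_eq_mul,
    Int.cast_sum, Int.cast_mul, Int.cast_natCast, mul_comm]

/-- If `Δ` divides `φ a` and `ψ a`, the coefficient at `Δ • u` is `c` times a product of two Hilbert
polynomials evaluated at `φ u - φ a / Δ` and `ψ u - ψ a / Δ`. Otherwise no multiple of `Δ` lies in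
the support. Restricting to multiples of `Δ` thus avoids quasi-polynomials. -/
theorem isEventuallyPolynomial_monomial_mul (hΔ : 0 < Δ)
    (hmono : ∀ u w, φ u ≤ φ w → ψ u ≤ ψ w → u ≤ w) (r s : ℕ) (a : Fin 2 →₀ ℕ) (c : ℚ) :
    IsEventuallyPolynomial φ ψ Δ (MvPowerSeries.monomial a c * twoRaySeries φ ψ Δ r s) := by
  classical
  obtain ⟨L, hL⟩ := exists_eval_eq_addMonoidHom φ
  obtain ⟨L', hL'⟩ := exists_eval_eq_addMonoidHom ψ
  have hΔ' : (0 : ℤ) < Δ := by exact_mod_cast hΔ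
  by_cases hdvd : (Δ : ℤ) ∣ φ a ∧ (Δ : ℤ) ∣ ψ a
  · obtain ⟨⟨x, hx⟩, ⟨y, hy⟩⟩ := hdvd
    refine ⟨MvPolynomial.C c *
      (Polynomial.aeval (L - MvPolynomial.C (x : ℚ)) (Polynomial.hilbertPoly (1 : Polynomial ℚ) r) *
       Polynomial.aeval (L' - MvPolynomial.C (y : ℚ)) (Polynomial.hilbertPoly (1 : Polynomial ℚ) s)),
      max (x + 1) (y + 1), fun u h1 h2 => ?_⟩
    have h1' : 0 < φ u - x := by have := le_of_max_le_left h1; omega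
    have h2' : 0 < ψ u - y := by have := le_of_max_le_right h2; omega
    have hau : a ≤ Δ • u := by
      refine hmono _ _ ?_ ?_
      · rw [hx, map_nsmul, nsmul_eq_mul]
        exact mul_le_mul_of_nonneg_left (by omega) hΔ'.le
      · rw [hy, map_nsmul, nsmul_eq_mul]
        exact mul_le_mul_of_nonneg_left (by omega) hΔ'.le
    have hsum : Δ • u - a + a = Δ • u := tsub_add_cancel_of_le hau
    have e1 : φ (Δ • u - a) = Δ * (φ u - x) := by
      have : φ (Δ • u - a) + φ a = φ (Δ • u) := by rw [← map_add, hsum]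
      rw [map_nsmul, nsmul_eq_mul, hx] at this
      linear_combination this
    have e2 : ψ (Δ • u - a) = Δ * (ψ u - y) := by
      have : ψ (Δ • u - a) + ψ a = ψ (Δ • u) := by rw [← map_add, hsum]
      rw [map_nsmul, nsmul_eq_mul, hy] at this
      linear_combination this
    rw [MvPowerSeries.coeff_monomial_mul, if_pos hau, coeff_twoRaySeries, e1, e2,
      if_pos ⟨dvd_mul_right _ _, dvd_mul_right _ _⟩, Int.mul_ediv_cancel_left _ hΔ'.ne',
      Int.mul_ediv_cancel_left _ hΔ'.ne', invOneSubPowCoeff_eq_eval _ h1',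
      invOneSubPowCoeff_eq_eval _ h2']
    have key : ∀ (p : Polynomial ℚ) (M : MvPolynomial (Fin 2) ℚ) (g : Fin 2 → ℚ),
        MvPolynomial.eval g (Polynomial.aeval M p) = p.eval (MvPolynomial.eval g M) := by
      intro p M g
      rw [← MvPolynomial.coe_aeval_eq_eval, ← Polynomial.coe_aeval_eq_eval]
      exact (Polynomial.aeval_algHom_apply (MvPolynomial.aeval g) M p).symm
    simp only [map_mul, MvPolynomial.eval_C, key, map_sub, hL, hL', Int.cast_sub]
  · refine ⟨0, 0, fun u _ _ => ?_⟩
    rw [MvPowerSeries.coeff_monomial_mul, map_zero]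
    split_ifs with hau
    · have hsum : Δ • u - a + a = Δ • u := tsub_add_cancel_of_le hau
      rw [coeff_twoRaySeries, if_neg, mul_zero]
      rintro ⟨h1, h2⟩
      apply hdvd
      constructor
      · have : φ (Δ • u - a) + φ a = φ (Δ • u) := by rw [← map_add, hsum]
        rw [map_nsmul, nsmul_eq_mul] at this
        exact (dvd_add_right h1).1 (this ▸ dvd_mul_right _ _)
      · have : ψ (Δ • u - a) + ψ a = ψ (Δ • u) := by rw [← map_add, hsum]
        rw [map_nsmul, nsmul_eq_mul] at this
        exact (dvd_add_right h2).1 (this ▸ dvd_mul_right _ _)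
    · rfl

theorem isEventuallyPolynomial_coe_mul (hΔ : 0 < Δ)
    (hmono : ∀ u w, φ u ≤ φ w → ψ u ≤ ψ w → u ≤ w) (r s : ℕ) (Q : MvPolynomial (Fin 2) ℚ) :
    IsEventuallyPolynomial φ ψ Δ
      ((Q : MvPowerSeries (Fin 2) ℚ) * twoRaySeries φ ψ Δ r s) := by
  induction Q using MvPolynomial.induction_on' with
  | monomial a c =>
    rw [MvPolynomial.coe_monomial]
    exact isEventuallyPolynomial_monomial_mul hΔ hmono r s a c
  | add p q hp hq =>
    rw [MvPolynomial.coe_add, add_mul]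
    exact hp.add hq

/-- The determinant of two vectors of `ℕ²`; it is nonnegative if the slope `m / n` of `u = (m, n)`
is at most that of `w`. -/
def slopeDet (u w : Fin 2 →₀ ℕ) : ℤ := u 1 * w 0 - u 0 * w 1

/-- `slopeDet` as an additive map in its first argument. -/
noncomputable def slopeDetLeft (w : Fin 2 →₀ ℕ) : (Fin 2 →₀ ℕ) →+ ℤ :=
  AddMonoidHom.mk' (fun u => slopeDet u w) fun a b => by simp [slopeDet]; ring

/-- `slopeDet` as an additive map in its second argument. -/
noncomputable def slopeDetRight (u : Fin 2 →₀ ℕ) : (Fin 2 →₀ ℕ) →+ ℤ :=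
  AddMonoidHom.mk' (fun w => slopeDet u w) fun a b => by simp [slopeDet]; ring

@[simp] theorem slopeDetLeft_apply (u w : Fin 2 →₀ ℕ) : slopeDetLeft w u = slopeDet u w := rfl

@[simp] theorem slopeDetRight_apply (u w : Fin 2 →₀ ℕ) : slopeDetRight u w = slopeDet u w := rfl

theorem slopeDet_smul_left (t : ℕ) (u w : Fin 2 →₀ ℕ) :
    slopeDet (t • u) w = t * slopeDet u w := by simp [slopeDet]; ring

theorem slopeDet_smul_right (t : ℕ) (u w : Fin 2 →₀ ℕ) :
    slopeDet u (t • w) = t * slopeDet u w := by simp [slopeDet]; ring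

theorem slopeDet_self (u : Fin 2 →₀ ℕ) : slopeDet u u = 0 := by simp [slopeDet]; ring

theorem slopeDet_cramer (p w q : Fin 2 →₀ ℕ) (i : Fin 2) :
    slopeDet p q * w i = slopeDet w q * p i + slopeDet p w * q i := by
  fin_cases i <;> simp [slopeDet] <;> ring

/-- Transitivity of the order by slope. All vectors lie in the closed first quadrant, so if the
determinant were nonpositive, Cramer's rule would equate a nonpositive vector with a sum of
nonnegative ones, and all of them would vanish. -/
theorem slopeDet_pos_of_le {p w q : Fin 2 →₀ ℕ} (hp : p ≠ 0) (hq : q ≠ 0)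
    (h1 : 0 ≤ slopeDet p w) (h2 : 0 ≤ slopeDet w q) (h : 0 < slopeDet p w ∨ 0 < slopeDet w q) :
    0 < slopeDet p q := by
  by_contra! hle
  have key : ∀ i, slopeDet w q * p i = 0 ∧ slopeDet p w * q i = 0 := by
    intro i
    have e := slopeDet_cramer p w q i
    have a1 : slopeDet p q * w i ≤ 0 := mul_nonpos_of_nonpos_of_nonneg hle (Int.natCast_nonneg _)
    have a2 : 0 ≤ slopeDet w q * p i := mul_nonneg h2 (Int.natCast_nonneg _)
    have a3 : 0 ≤ slopeDet p w * q i := mul_nonneg h1 (Int.natCast_nonneg _)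
    constructor <;> linarith
  rcases h with h | h
  · apply hq
    ext i
    have := (key i).2
    simpa [h.ne'] using this
  · apply hp
    ext i
    have := (key i).1
    simpa [h.ne'] using this

theorem slopeDet_relation {p w q : Fin 2 →₀ ℕ} (h1 : 0 < slopeDet p w) (h2 : 0 < slopeDet w q)
    (h : 0 < slopeDet p q) : ∃ C α ε : ℕ, 0 < C ∧ C • w = α • p + ε • q := by
  refine ⟨(slopeDet p q).toNat, (slopeDet w q).toNat, (slopeDet p w).toNat, by omega, ?_⟩
  ext i
  have := slopeDet_cramer p w q i
  zify
  simp only [Pi.smul_apply, Pi.add_apply, smul_eq_mul,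
    Nat.cast_add, Nat.cast_mul, Int.toNat_of_nonneg h1.le, Int.toNat_of_nonneg h2.le,
    Int.toNat_of_nonneg h.le]
  exact this

theorem smul_eq_smul_of_slopeDet_eq_zero {p w : Fin 2 →₀ ℕ} (h : slopeDet p w = 0) :
    w.degree • p = p.degree • w := by
  have h' : (p 1 : ℤ) * w 0 = p 0 * w 1 := by rw [slopeDet] at h; linarith
  have h' : p 1 * w 0 = p 0 * w 1 := by exact_mod_cast h'
  ext i
  fin_cases i
  · simp [Finsupp.degree_eq_sum, Fin.sum_univ_two]
    linarith
  · simp [Finsupp.degree_eq_sum, Fin.sum_univ_two]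
    linarith

theorem slopeDet_swap (u w : Fin 2 →₀ ℕ) : slopeDet u w = -slopeDet w u := by
  simp [slopeDet]; ring

theorem exists_common_multiple {w : Fin 2 →₀ ℕ} {c : Multiset (Fin 2 →₀ ℕ)}
    (hc : ∀ p ∈ c, ∃ t : ℕ, 0 < t ∧ p = t • w) :
    ∃ M : ℕ, 0 < M ∧ ∀ p ∈ c, ∃ n : ℕ, M • w = n • p := by
  induction c using Multiset.induction_on with
  | empty => exact ⟨1, one_pos, by simp⟩
  | cons p c ih =>
    obtain ⟨M, hM, h⟩ := ih fun q hq => hc q (Multiset.mem_cons_of_mem hq)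
    obtain ⟨t, ht, rfl⟩ := hc p (Multiset.mem_cons_self _ _)
    refine ⟨t * M, Nat.mul_pos ht hM, fun q hq => ?_⟩
    rcases Multiset.mem_cons.1 hq with rfl | hq
    · exact ⟨M, by rw [smul_smul, mul_comm]⟩
    · obtain ⟨n, hn⟩ := h q hq
      exact ⟨t * n, by rw [mul_smul, hn, smul_smul]⟩

/-- A fraction whose denominators lie on the two rays through `v` and `v'` has eventually
polynomial coefficients in the cone they span. -/
theorem HasDenominator.isEventuallyPolynomial_of_two_rays {v v' : Fin 2 →₀ ℕ}
    (hdet : 0 < slopeDet v v') {c c' : Multiset (Fin 2 →₀ ℕ)}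
    (hc : ∀ p ∈ c, ∃ t : ℕ, 0 < t ∧ p = t • v) (hc' : ∀ p ∈ c', ∃ t : ℕ, 0 < t ∧ p = t • v')
    {f : MvPowerSeries (Fin 2) ℚ} (hf : HasDenominator (c + c') f) :
    ∃ Δ₀ : ℕ, 0 < Δ₀ ∧
      IsEventuallyPolynomial (slopeDetLeft v') (slopeDetRight v) Δ₀ f := by
  obtain ⟨M, hM, hMc⟩ := exists_common_multiple hc
  obtain ⟨M', hM', hMc'⟩ := exists_common_multiple hc'
  -- On each ray all factors divide a single `1 - X^(M v)`, respectively `1 - X^(M' v')`. The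
  -- denominator becomes a product of powers of two factors, whose inverse is `twoRaySeries`.
  have hf' : HasDenominator (c.map (fun _ => M • v) + c'.map (fun _ => M' • v')) f := by
    refine hf.of_dvd ?_
    rw [denominator_add, denominator_add]
    exact mul_dvd_mul (denominator_dvd_map c _ hMc) (denominator_dvd_map c' _ hMc')
  have hΔ : 0 < slopeDet (M • v) (M' • v') := by
    rw [slopeDet_smul_left, slopeDet_smul_right]
    positivity
  obtain ⟨Δ₀, hΔ₀⟩ : ∃ Δ₀ : ℕ, (Δ₀ : ℤ) = slopeDet (M • v) (M' • v') :=
    ⟨_, Int.toNat_of_nonneg hΔ.le⟩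
  have hΔ₀pos : 0 < Δ₀ := by omega
  -- By Cramer's rule the entries of a vector are combinations of its two determinants with
  -- nonnegative coefficients.
  have hmono : ∀ u w, slopeDetLeft (M' • v') u ≤ slopeDetLeft (M' • v') w →
      slopeDetRight (M • v) u ≤ slopeDetRight (M • v) w → u ≤ w := by
    intro u w h1 h2 i
    rw [slopeDetLeft_apply, slopeDetLeft_apply] at h1
    rw [slopeDetRight_apply, slopeDetRight_apply] at h2
    have hu := slopeDet_cramer (M • v) u (M' • v') i
    have hw := slopeDet_cramer (M • v) w (M' • v') i
    have e1 := mul_le_mul_of_nonneg_right h1 (Int.natCast_nonneg ((M • v) i))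
    have e2 := mul_le_mul_of_nonneg_right h2 (Int.natCast_nonneg ((M' • v') i))
    have : slopeDet (M • v) (M' • v') * u i ≤ slopeDet (M • v) (M' • v') * w i := by linarith
    exact_mod_cast le_of_mul_le_mul_left this hΔ
  obtain ⟨Q, hQ⟩ := hf'
  have hone := twoRaySeries_mul_eq_one (φ := slopeDetLeft (M' • v')) (ψ := slopeDetRight (M • v))
    (V := M • v) (V' := M' • v') (Δ := Δ₀) (by omega) hmono (by simp [hΔ₀])
    (by simp [slopeDet_self]) (by simp [slopeDet_self]) (by simp [hΔ₀]) c.card c'.card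
  have hfQ : f = (Q : MvPowerSeries (Fin 2) ℚ) *
      twoRaySeries (slopeDetLeft (M' • v')) (slopeDetRight (M • v)) Δ₀ c.card c'.card := by
    rw [← hQ, denominator_add, MvPolynomial.coe_mul]
    simp only [denominator, Multiset.map_const', Multiset.map_replicate,
      Multiset.prod_replicate, MvPolynomial.coe_pow, coe_one_sub_monomial]
    rw [mul_assoc, mul_comm (_ * _) (twoRaySeries _ _ _ _ _), hone, mul_one]
  obtain ⟨P, K, hP⟩ := isEventuallyPolynomial_coe_mul hΔ₀pos hmono c.card c'.card Q
  rw [← hfQ] at hP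
  -- The determinants against `M' v'` and `M v` are those against `v'` and `v` multiplied by `M'`
  -- and `M`; taking `|K|` makes the bound survive this even if `K` is negative.
  refine ⟨Δ₀, hΔ₀pos, P, |K|, fun u h1 h2 => hP u ?_ ?_⟩
  · rw [slopeDetLeft_apply] at h1 ⊢
    rw [slopeDet_smul_right]
    have : (1 : ℤ) ≤ M' := by exact_mod_cast hM'
    nlinarith [le_abs_self K, abs_nonneg K]
  · rw [slopeDetRight_apply] at h2 ⊢
    rw [slopeDet_smul_left]
    have : (1 : ℤ) ≤ M := by exact_mod_cast hM
    nlinarith [le_abs_self K, abs_nonneg K]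

theorem IsEventuallyPolynomial.of_eventually_zero {φ ψ : (Fin 2 →₀ ℕ) →+ ℤ} {Δ : ℕ}
    {f : MvPowerSeries (Fin 2) ℚ} (K : ℤ)
    (h : ∀ u, K ≤ φ u → K ≤ ψ u → MvPowerSeries.coeff (Δ • u) f = 0) :
    IsEventuallyPolynomial φ ψ Δ f :=
  ⟨0, K, fun u h1 h2 => by rw [h u h1 h2, map_zero]⟩

/-- The coefficients of a rational function are given, on a sublattice, by a polynomial inside each
open cone that contains none of the denominators. -/
theorem HasDenominator.exists_isEventuallyPolynomial {v v' : Fin 2 →₀ ℕ}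
    (hdet : 0 < slopeDet v v') {S : Multiset (Fin 2 →₀ ℕ)} (hS0 : ∀ p ∈ S, p ≠ 0)
    (hS : ∀ p ∈ S, 0 ≤ slopeDet p v ∨ 0 ≤ slopeDet v' p)
    {f : MvPowerSeries (Fin 2) ℚ} (hf : HasDenominator S f) :
    ∃ Δ : ℕ, 0 < Δ ∧ IsEventuallyPolynomial (slopeDetLeft v') (slopeDetRight v) Δ f := by
  classical
  have hv : v ≠ 0 := by rintro rfl; simp [slopeDet] at hdet
  have hv' : v' ≠ 0 := by rintro rfl; simp [slopeDet] at hdet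
  have hdeg : ∀ {p : Fin 2 →₀ ℕ}, p ≠ 0 → 0 < p.degree := fun hp =>
    Nat.pos_of_ne_zero fun h => hp ((Finsupp.degree_eq_zero_iff _).1 h)
  -- The denominators are sorted by slope: `a` below the ray of `v`, `c` on it, `r` above it and
  -- hence, by `hS`, on or beyond the ray of `v'`. A decomposition at `v` separates `a` from `r`; a
  -- second one at `v'` separates the ray of `v` from the part of `r` strictly beyond `v'`.
  set a := S.filter fun p => 0 < slopeDet p v with ha
  set r := S.filter fun p => slopeDet p v < 0 with hr
  set c := (S.filter fun p => slopeDet p v = 0) with hc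
  have hsplit : S = a + c + r := by
    ext p
    simp only [ha, hr, hc, Multiset.count_add, Multiset.count_filter]
    rcases lt_trichotomy (slopeDet p v) 0 with h | h | h
    · simp [h, h.ne, h.le]
    · simp [h]
    · simp [h, h.ne', h.le]
  have hr' : ∀ q ∈ r, 0 ≤ slopeDet v' q := by
    intro q hq
    obtain ⟨hq, hlt⟩ := Multiset.mem_filter.1 hq
    exact (hS q hq).resolve_left (not_le.2 hlt)
  have hvr : ∀ q ∈ r, 0 < slopeDet v q := by
    intro q hq
    rw [slopeDet_swap]
    linarith [(Multiset.mem_filter.1 hq).2]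
  have hr0 : ∀ q ∈ r, q ≠ 0 := fun q hq => hS0 q (Multiset.mem_filter.1 hq).1
  have ha0 : ∀ p ∈ a, p ≠ 0 := fun p hp => hS0 p (Multiset.mem_filter.1 hp).1
  have hapos : ∀ p ∈ a, 0 < slopeDet p v := fun p hp => (Multiset.mem_filter.1 hp).2
  have hf1 : HasDenominator (a + c.map (fun p => p.degree • v) + r) f := by
    rw [hsplit] at hf
    refine hf.of_dvd ?_
    simp only [denominator_add]
    refine mul_dvd_mul (mul_dvd_mul dvd_rfl (denominator_dvd_map c _ fun p hp => ?_)) dvd_rfl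
    exact ⟨v.degree, (smul_eq_smul_of_slopeDet_eq_zero (Multiset.mem_filter.1 hp).2).symm⟩
  obtain ⟨f₁, f₂, c₁, c₂, rfl, hc₁, hc₂, hf₁, hf₂⟩ := HasDenominator.exists_add hv _ a r _ f rfl
    (fun p hp q hq => slopeDet_relation (hapos p hp) (hvr q hq)
      (slopeDet_pos_of_le (ha0 p hp) (hr0 q hq) (hapos p hp).le (hvr q hq).le
        (Or.inl (hapos p hp))))
    (fun p hp => by
      obtain ⟨q, hq, rfl⟩ := Multiset.mem_map.1 hp
      exact ⟨q.degree, hdeg (hS0 q (Multiset.mem_filter.1 hq).1), rfl⟩) hf1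
  clear_value r
  set r₁ := r.filter fun p => 0 < slopeDet v' p with hr₁
  set r₀ := r.filter fun p => slopeDet v' p = 0 with hr₀
  have hsplit' : r = r₀ + r₁ := by
    ext p
    simp only [hr₀, hr₁, Multiset.count_add]
    by_cases hp : p ∈ r
    · rw [Multiset.count_filter, Multiset.count_filter]
      rcases (hr' p hp).eq_or_lt with h | h
      · simp [← h]
      · simp [h, h.ne']
    · rw [Multiset.count_eq_zero_of_notMem hp, Multiset.count_eq_zero_of_notMem (by simp [hp]),
        Multiset.count_eq_zero_of_notMem (by simp [hp])]
  have hf3 : HasDenominator (c₂ + r₀.map (fun p => p.degree • v') + r₁) f₂ := by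
    rw [hsplit', ← add_assoc] at hf₂
    refine hf₂.of_dvd ?_
    simp only [denominator_add]
    refine mul_dvd_mul (mul_dvd_mul dvd_rfl (denominator_dvd_map r₀ _ fun p hp => ?_)) dvd_rfl
    refine ⟨v'.degree, (smul_eq_smul_of_slopeDet_eq_zero ?_).symm⟩
    rw [slopeDet_swap, (Multiset.mem_filter.1 hp).2, neg_zero]
  obtain ⟨g₁, g₂, e₁, e₂, rfl, he₁, he₂, hg₁, hg₂⟩ := HasDenominator.exists_add hv' _ c₂ r₁ _ f₂ rfl
    (fun p hp q hq => by
      obtain ⟨t, ht, rfl⟩ := hc₂ p hp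
      obtain ⟨hq, hlt⟩ := Multiset.mem_filter.1 hq
      refine slopeDet_relation ?_ hlt ?_
      · rw [slopeDet_smul_left]; positivity
      · rw [slopeDet_smul_left]
        have := hvr q hq
        positivity)
    (fun p hp => by
      obtain ⟨q, hq, rfl⟩ := Multiset.mem_map.1 hp
      exact ⟨q.degree, hdeg (hr0 q (Multiset.mem_filter.1 hq).1), rfl⟩) hf3
  obtain ⟨Δ, hΔ, hpoly⟩ := hg₁.isEventuallyPolynomial_of_two_rays hdet hc₂ he₁
  have hΔ1 : (1 : ℤ) ≤ Δ := by exact_mod_cast hΔ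
  -- Only the middle term, with denominators on the two walls, contributes. The other two have
  -- denominators of slope at most that of `v`, respectively at least that of `v'`, so their
  -- supports avoid the deep interior of the cone.
  refine ⟨Δ, hΔ, IsEventuallyPolynomial.add ?_ (hpoly.add ?_)⟩
  · obtain ⟨C, hC⟩ := hf₁.exists_coeff_eq_zero (slopeDetLeft v) (by
      intro p hp
      rcases Multiset.mem_add.1 hp with hp | hp
      · exact ⟨ha0 p hp, (hapos p hp).le⟩
      · obtain ⟨t, ht, rfl⟩ := hc₁ p hp
        exact ⟨smul_ne_zero ht.ne' hv, by simp [slopeDet_smul_left, slopeDet_self]⟩)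
    -- The determinant of `Δ • u` against `v` is then at most `-(|C| + 1)`, which is less than `C`.
    refine .of_eventually_zero (|C| + 1) fun u _ h2 => hC _ ?_
    rw [slopeDetRight_apply] at h2
    rw [slopeDetLeft_apply, slopeDet_smul_left, slopeDet_swap]
    nlinarith [neg_abs_le C, abs_nonneg C]
  · obtain ⟨C, hC⟩ := hg₂.exists_coeff_eq_zero (slopeDetRight v') (by
      intro p hp
      rcases Multiset.mem_add.1 hp with hp | hp
      · obtain ⟨t, ht, rfl⟩ := he₂ p hp
        exact ⟨smul_ne_zero ht.ne' hv', by simp [slopeDet_smul_right, slopeDet_self]⟩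
      · obtain ⟨hp, hlt⟩ := Multiset.mem_filter.1 hp
        exact ⟨hr0 p hp, hlt.le⟩)
    refine .of_eventually_zero (|C| + 1) fun u h1 _ => hC _ ?_
    rw [slopeDetLeft_apply] at h1
    rw [slopeDetRight_apply, slopeDet_smul_right, slopeDet_swap]
    nlinarith [neg_abs_le C, abs_nonneg C]

end Chamber

/-! ### Krull dimension under integral extensions -/

section IntegralDimension

/-- Incomparability: a strict inclusion of primes of `S` contracts to a strict inclusion. -/
theorem ringKrullDim_le_of_isIntegral {R S : Type*} [CommRing R] [CommRing S] [Algebra R S]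
    [Algebra.IsIntegral R S] : ringKrullDim S ≤ ringKrullDim R := by
  refine Order.krullDim_le_of_strictMono (PrimeSpectrum.comap (algebraMap R S)) fun P Q h => ?_
  exact Ideal.IsIntegral.comap_lt_comap (PrimeSpectrum.asIdeal_lt_asIdeal _ _ |>.2 h)

/-- Going up, applied one prime at a time from the bottom of the chain. The lifted head is
prescribed so that the induction can attach to it. -/
theorem exists_ltSeries_lift {R S : Type*} [CommRing R] [CommRing S] [Algebra R S]
    [Algebra.IsIntegral R S] (p : LTSeries (PrimeSpectrum R)) :
    ∀ Q : PrimeSpectrum S, PrimeSpectrum.comap (algebraMap R S) Q = p.head →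
      ∃ q : LTSeries (PrimeSpectrum S), q.head = Q ∧ q.length = p.length := by
  induction p using RelSeries.inductionOn with
  | singleton x => exact fun Q _ => ⟨RelSeries.singleton _ Q, rfl, rfl⟩
  | cons p x hx ih =>
    intro Q hQ
    have hxp : x < p.head := hx
    rw [RelSeries.head_cons] at hQ
    have hle : Ideal.comap (algebraMap R S) Q.asIdeal ≤ p.head.asIdeal := by
      have : (PrimeSpectrum.comap (algebraMap R S) Q).asIdeal ≤ p.head.asIdeal := by
        rw [hQ]
        exact hxp.le
      exact this
    obtain ⟨Q', hQQ', hprime, hcomap⟩ := Ideal.exists_ideal_over_prime_of_isIntegral_of_isPrime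
      p.head.asIdeal Q.asIdeal hle
    obtain ⟨q, hq, hlen⟩ := ih ⟨Q', hprime⟩ (PrimeSpectrum.ext hcomap)
    have hlt : Q < q.head := by
      rw [hq]
      refine lt_of_le_of_ne hQQ' ?_
      intro hQeq
      have h2 : PrimeSpectrum.comap (algebraMap R S) Q = p.head := by
        rw [hQeq]
        exact PrimeSpectrum.ext hcomap
      exact absurd (hQ.symm.trans h2) hxp.ne
    exact ⟨q.cons Q hlt, RelSeries.head_cons _ _ _, by
      rw [RelSeries.cons_length, RelSeries.cons_length, hlen]⟩

theorem ringKrullDim_eq_of_isIntegral_of_injective {R S : Type*} [CommRing R] [CommRing S]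
    [Algebra R S] [Algebra.IsIntegral R S] (hinj : Function.Injective (algebraMap R S)) :
    ringKrullDim S = ringKrullDim R := by
  refine le_antisymm ringKrullDim_le_of_isIntegral ?_
  refine iSup_le fun p => ?_
  obtain ⟨Q, -, hprime, hcomap⟩ := Ideal.exists_ideal_over_prime_of_isIntegral
    p.head.asIdeal (⊥ : Ideal S) (by
      rw [← RingHom.ker_eq_comap_bot, (RingHom.injective_iff_ker_eq_bot _).1 hinj]
      exact bot_le)
  obtain ⟨q, -, hlen⟩ := exists_ltSeries_lift p ⟨Q, hprime⟩ (PrimeSpectrum.ext hcomap)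
  rw [← hlen]
  exact le_iSup (fun q : LTSeries (PrimeSpectrum S) => ((q.length : ℕ∞) : WithBot ℕ∞)) q

end IntegralDimension

/-! ### Generators and monomials in standard graded algebras -/

section Graded

variable {k A : Type*} [Field k] [CommRing A] [Algebra k A]

theorem mem_span_monomialValue_of_mem_adjoin {N : ℕ} (z : Fin N → A) {x : A}
    (hx : x ∈ Algebra.adjoin k (Set.range z)) :
    x ∈ Submodule.span k (Set.range (monomialValue z)) := by
  rw [Algebra.adjoin_range_eq_range_aeval] at hx
  obtain ⟨P, rfl⟩ := hx
  change MvPolynomial.aeval z P ∈ _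
  rw [MvPolynomial.aeval_def, MvPolynomial.eval₂_eq']
  refine sum_mem fun α _ => ?_
  rw [← Algebra.smul_def]
  exact Submodule.smul_mem _ _ (Submodule.subset_span ⟨α, rfl⟩)

variable (𝒜 : ℕ → Submodule k A) [GradedAlgebra 𝒜]

theorem monomialValue_mem {N : ℕ} {z : Fin N → A} {w : Fin N → ℕ} (hz : ∀ i, z i ∈ 𝒜 (w i))
    (α : Fin N → ℕ) : monomialValue z α ∈ 𝒜 (∑ i, α i * w i) := by
  rw [monomialValue]
  have := SetLike.prod_pow_mem_graded 𝒜 w z α (F := Finset.univ) fun i _ => hz i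
  simpa [smul_eq_mul] using this

/-- Projecting a linear combination onto degree `m` discards exactly the monomials of other degrees.
-/
theorem mem_span_monomialValue_of_mem_graded {N : ℕ} {z : Fin N → A} {w : Fin N → ℕ}
    (hz : ∀ i, z i ∈ 𝒜 (w i)) {T : Set (Fin N → ℕ)} {m : ℕ} {x : A} (hx : x ∈ 𝒜 m)
    (hxT : x ∈ Submodule.span k (monomialValue z '' T)) :
    x ∈ Submodule.span k (monomialValue z '' {α | α ∈ T ∧ ∑ i, α i * w i = m}) := by
  have h := Submodule.mem_map_of_mem (f := GradedAlgebra.proj 𝒜 m) hxT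
  rw [GradedAlgebra.proj_apply, DirectSum.decompose_of_mem_same 𝒜 hx, Submodule.map_span] at h
  refine Submodule.span_le.2 ?_ h
  rintro _ ⟨_, ⟨α, hα, rfl⟩, rfl⟩
  rw [GradedAlgebra.proj_apply]
  by_cases hm : ∑ i, α i * w i = m
  · have hmem := monomialValue_mem 𝒜 hz α
    rw [hm] at hmem
    rw [DirectSum.decompose_of_mem_same 𝒜 hmem]
    exact Submodule.subset_span ⟨α, ⟨hα, hm⟩, rfl⟩
  · rw [DirectSum.decompose_of_mem_ne 𝒜 (monomialValue_mem 𝒜 hz α) hm]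
    exact zero_mem _

variable {𝒜}

theorem IsStandardGraded.exists_generators (hA : IsStandardGraded 𝒜) :
    ∃ (N : ℕ) (z : Fin N → A), (∀ i, z i ∈ 𝒜 1) ∧ Algebra.adjoin k (Set.range z) = ⊤ := by
  have := hA.finite
  obtain ⟨N, s, hs⟩ := Module.Finite.exists_fin (R := k) (M := 𝒜 1)
  refine ⟨N, fun i => s i, fun i => (s i).2, ?_⟩
  rw [eq_top_iff, ← hA.generated]
  refine Algebra.adjoin_le fun x hx => ?_
  have h1 : (⟨x, hx⟩ : 𝒜 1) ∈ Submodule.span k (Set.range s) := by rw [hs]; trivial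
  have h2 := Submodule.mem_map_of_mem (f := (𝒜 1).subtype) h1
  rw [Submodule.map_span, ← Set.range_comp] at h2
  exact Algebra.span_le_adjoin k _ h2

theorem IsStandardGraded.graded_eq_span {N : ℕ} {z : Fin N → A}
    (hz : ∀ i, z i ∈ 𝒜 1) (hgen : Algebra.adjoin k (Set.range z) = ⊤) (m : ℕ) :
    𝒜 m = Submodule.span k (monomialValue z '' {α | ∑ i, α i = m}) := by
  apply le_antisymm
  · intro x hx
    have h1 : x ∈ Submodule.span k (monomialValue z '' Set.univ) := by
      rw [Set.image_univ]
      exact mem_span_monomialValue_of_mem_adjoin z (hgen ▸ Algebra.mem_top)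
    have h2 := mem_span_monomialValue_of_mem_graded 𝒜 (w := fun _ => 1) hz hx h1
    simpa using h2
  · rw [Submodule.span_le]
    rintro _ ⟨α, rfl, rfl⟩
    simpa using monomialValue_mem 𝒜 (w := fun _ => 1) hz α

theorem finite_sum_eq {N : ℕ} (m : ℕ) : {α : Fin N → ℕ | ∑ i, α i = m}.Finite := by
  refine (Set.finite_Iic (fun _ : Fin N => m)).subset ?_
  rintro α rfl i
  exact Finset.single_le_sum (fun j _ => Nat.zero_le _) (Finset.mem_univ i)

theorem IsStandardGraded.finite_graded (hA : IsStandardGraded 𝒜) (m : ℕ) :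
    Module.Finite k (𝒜 m) := by
  obtain ⟨N, z, hz, hgen⟩ := hA.exists_generators
  rw [graded_eq_span hz hgen m]
  exact Module.Finite.span_of_finite k ((finite_sum_eq m).image _)

theorem IsStandardGraded.exists_hilbertPoly (hA : IsStandardGraded 𝒜) :
    ∃ (q : Polynomial ℚ) (M : ℕ), ∀ m, M ≤ m →
      (Module.finrank k (𝒜 m) : ℚ) = q.eval (m : ℚ) := by
  obtain ⟨N, z, hz, hgen⟩ := hA.exists_generators
  obtain ⟨q, M, h⟩ := _root_.exists_hilbertPoly (k := k) z
  refine ⟨q, M, fun m hm => ?_⟩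
  rw [graded_eq_span hz hgen m, h m hm]

end Graded

/-! ### Growth of a standard graded algebra via Noether normalisation -/

section Growth

variable {k A : Type*} [Field k] [CommRing A] [Algebra k A]

/-- Bounding the degree in each variable separately makes the dimension an exact power. -/
theorem finrank_restrictDegree (s n : ℕ) :
    Module.finrank k (MvPolynomial.restrictDegree (Fin s) k n) = (n + 1) ^ s := by
  rw [MvPolynomial.restrictDegree,
    Module.finrank_eq_nat_card_basis (MvPolynomial.basisRestrictSupport k _)]
  let e : {f : Fin s →₀ ℕ | ∀ i, f i ≤ n} ≃ (Fin s → Fin (n + 1)) :=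
    { toFun := fun f i => ⟨f.1 i, Nat.lt_succ_of_le (f.2 i)⟩
      invFun := fun g => ⟨Finsupp.equivFunOnFinite.symm fun i => g i,
        fun i => Nat.le_of_lt_succ (g i).2⟩
      left_inv := fun f => by ext i; rfl
      right_inv := fun g => by ext i; rfl }
  rw [Nat.card_congr e]
  simp

theorem mul_mem_restrictDegree {s m n : ℕ} {p q : MvPolynomial (Fin s) k}
    (hp : p ∈ MvPolynomial.restrictDegree (Fin s) k m)
    (hq : q ∈ MvPolynomial.restrictDegree (Fin s) k n) :
    p * q ∈ MvPolynomial.restrictDegree (Fin s) k (m + n) := by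
  have key : ∀ (r : MvPolynomial (Fin s) k) (d : ℕ),
      r ∈ MvPolynomial.restrictDegree (Fin s) k d ↔ ∀ i, r.degreeOf i ≤ d := by
    intro r d
    rw [MvPolynomial.mem_restrictDegree]
    simp only [MvPolynomial.degreeOf_le_iff]
    exact ⟨fun h i m hm => h m hm i, fun h m hm i => h i m hm⟩
  rw [key] at hp hq ⊢
  exact fun i => (MvPolynomial.degreeOf_mul_le i p q).trans (add_le_add (hp i) (hq i))

theorem restrictDegree_mono {s m n : ℕ} (h : m ≤ n) :
    MvPolynomial.restrictDegree (Fin s) k m ≤ MvPolynomial.restrictDegree (Fin s) k n := by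
  intro p hp
  rw [MvPolynomial.mem_restrictDegree] at hp ⊢
  exact fun a ha i => (hp a ha i).trans h

theorem exists_mem_restrictDegree {s : ℕ} (p : MvPolynomial (Fin s) k) :
    ∃ n, p ∈ MvPolynomial.restrictDegree (Fin s) k n :=
  ⟨p.totalDegree, MvPolynomial.restrictTotalDegree_le_restrictDegree _ _ _
    ((MvPolynomial.mem_restrictTotalDegree _ _ _).2 le_rfl)⟩

/-- The elements `∑ φ(pₜ) t` where the `pₜ` have degree at most `n` in each variable. -/
noncomputable def boxSpan {s : ℕ} (φ : MvPolynomial (Fin s) k →ₐ[k] A) (T : Finset A) (n : ℕ) :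
    Submodule k A :=
  LinearMap.range (∑ t : T, (LinearMap.mulRight k (t : A)) ∘ₗ φ.toLinearMap ∘ₗ
    (MvPolynomial.restrictDegree (Fin s) k n).subtype ∘ₗ
      LinearMap.proj (R := k) (φ := fun _ : T => MvPolynomial.restrictDegree (Fin s) k n) t)

theorem mem_boxSpan {s : ℕ} {φ : MvPolynomial (Fin s) k →ₐ[k] A} {T : Finset A} {n : ℕ} {x : A} :
    x ∈ boxSpan φ T n ↔ ∃ p : T → MvPolynomial (Fin s) k,
      (∀ t, p t ∈ MvPolynomial.restrictDegree (Fin s) k n) ∧ ∑ t, φ (p t) * t = x := by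
  rw [boxSpan, LinearMap.mem_range]
  constructor
  · rintro ⟨p, rfl⟩
    exact ⟨fun t => p t, fun t => (p t).2, by simp⟩
  · rintro ⟨p, hp, rfl⟩
    exact ⟨fun t => ⟨p t, hp t⟩, by simp⟩

theorem finrank_boxSpan_le {s : ℕ} (φ : MvPolynomial (Fin s) k →ₐ[k] A) (T : Finset A) (n : ℕ) :
    Module.finrank k (boxSpan φ T n) ≤ T.card * (n + 1) ^ s := by
  refine (LinearMap.finrank_range_le _).trans ?_
  rw [Module.finrank_pi_fintype]
  simp [finrank_restrictDegree]

instance finite_boxSpan {s : ℕ} (φ : MvPolynomial (Fin s) k →ₐ[k] A) (T : Finset A) (n : ℕ) :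
    Module.Finite k (boxSpan φ T n) := by
  unfold boxSpan
  infer_instance

theorem boxSpan_mono {s : ℕ} (φ : MvPolynomial (Fin s) k →ₐ[k] A) (T : Finset A) :
    Monotone (boxSpan φ T) := by
  intro m n h x hx
  rw [mem_boxSpan] at hx ⊢
  obtain ⟨p, hp, rfl⟩ := hx
  exact ⟨p, fun t => restrictDegree_mono h (hp t), rfl⟩

theorem map_mul_mem_boxSpan {s : ℕ} {φ : MvPolynomial (Fin s) k →ₐ[k] A} {T : Finset A} {m n : ℕ}
    {p : MvPolynomial (Fin s) k} (hp : p ∈ MvPolynomial.restrictDegree (Fin s) k m) {x : A}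
    (hx : x ∈ boxSpan φ T n) : φ p * x ∈ boxSpan φ T (m + n) := by
  rw [mem_boxSpan] at hx ⊢
  obtain ⟨q, hq, rfl⟩ := hx
  refine ⟨fun t => p * q t, fun t => mul_mem_restrictDegree hp (hq t), ?_⟩
  rw [Finset.mul_sum]
  exact Finset.sum_congr rfl fun t _ => by rw [map_mul, mul_assoc]

theorem mul_mem_boxSpan {s : ℕ} {φ : MvPolynomial (Fin s) k →ₐ[k] A} {T : Finset A} {c n : ℕ}
    {x y : A} (hy : ∀ t ∈ T, y * t ∈ boxSpan φ T c) (hx : x ∈ boxSpan φ T n) :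
    y * x ∈ boxSpan φ T (n + c) := by
  obtain ⟨q, hq, rfl⟩ := mem_boxSpan.1 hx
  rw [Finset.mul_sum]
  refine sum_mem fun t _ => ?_
  rw [mul_left_comm]
  exact map_mul_mem_boxSpan (hq t) (hy t t.2)

theorem exists_mem_boxSpan {s : ℕ} {φ : MvPolynomial (Fin s) k →ₐ[k] A} {T : Finset A}
    (hT : ∀ x : A, ∃ p : T → MvPolynomial (Fin s) k, ∑ t, φ (p t) * t = x) (x : A) :
    ∃ n, x ∈ boxSpan φ T n := by
  obtain ⟨p, rfl⟩ := hT x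
  choose n hn using fun t => exists_mem_restrictDegree (p t)
  exact ⟨Finset.univ.sup n, mem_boxSpan.2 ⟨p, fun t =>
    restrictDegree_mono (Finset.le_sup (Finset.mem_univ t)) (hn t), rfl⟩⟩

/-- The span of the homogeneous elements of degree at most `m`. -/
def degreeLESpan (𝒜 : ℕ → Submodule k A) (m : ℕ) : Submodule k A :=
  Submodule.span k {x | ∃ i ≤ m, x ∈ 𝒜 i}

theorem degreeLESpan_mono {𝒜 : ℕ → Submodule k A} : Monotone (degreeLESpan 𝒜) := by
  intro m n h
  refine Submodule.span_mono ?_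
  rintro x ⟨i, hi, hx⟩
  exact ⟨i, hi.trans h, hx⟩

variable {𝒜 : ℕ → Submodule k A} [GradedAlgebra 𝒜]

/-- Let `c` be a box size containing 1 and all products of an algebra generator with an element of
`T`. Each multiplication by an algebra generator enlarges the box by `c`, so a monomial of degree
`m` lies in the box of size `c * (m + 1)`. -/
theorem IsStandardGraded.exists_le_boxSpan (hA : IsStandardGraded 𝒜) {s : ℕ}
    {φ : MvPolynomial (Fin s) k →ₐ[k] A} {T : Finset A}
    (hT : ∀ x : A, ∃ p : T → MvPolynomial (Fin s) k, ∑ t, φ (p t) * t = x) :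
    ∃ c, ∀ m, 𝒜 m ≤ boxSpan φ T (c * (m + 1)) := by
  classical
  obtain ⟨N, z, hz, hgen⟩ := hA.exists_generators
  choose n hn using exists_mem_boxSpan hT
  set c := max (n 1) (Finset.univ.sup fun i : Fin N => T.sup fun t => n (z i * t)) with hc
  have h1 : (1 : A) ∈ boxSpan φ T c := boxSpan_mono φ T (le_max_left _ _) (hn 1)
  have hzc : ∀ i, ∀ t ∈ T, z i * t ∈ boxSpan φ T c := by
    intro i t ht
    refine boxSpan_mono φ T (le_trans ?_ (le_max_right _ _)) (hn (z i * t))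
    exact (Finset.le_sup (f := fun t => n (z i * t)) ht).trans
      (Finset.le_sup (f := fun i : Fin N => T.sup fun t => n (z i * t)) (Finset.mem_univ i))
  refine ⟨c, fun m => ?_⟩
  rw [graded_eq_span hz hgen m, Submodule.span_le]
  rintro _ ⟨α, hα, rfl⟩
  induction m generalizing α with
  | zero =>
    have hα0 : ∀ i, α i = 0 := by simpa using hα
    simpa [monomialValue, hα0] using h1
  | succ m ih =>
    obtain ⟨i, hi⟩ : ∃ i, 0 < α i := by
      by_contra! h
      have hα' : ∑ i, α i = m + 1 := hα
      rw [Finset.sum_eq_zero fun i _ => Nat.le_zero.1 (h i)] at hα'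
      omega
    have hsum : α - Pi.single i 1 + Pi.single i 1 = α := by
      funext j
      by_cases hj : j = i
      · subst hj
        simp only [Pi.add_apply, Pi.sub_apply, Pi.single_eq_same]
        omega
      · simp [hj]
    have hα' : ∑ j, (α - Pi.single i 1 : Fin N → ℕ) j = m := by
      have h2 : ∑ j, α j = m + 1 := hα
      rw [← hsum] at h2
      simp only [Pi.add_apply, Finset.sum_add_distrib, Finset.sum_pi_single',
        Finset.mem_univ, if_true] at h2
      have h3 : ∑ j, (Pi.single i 1 : Fin N → ℕ) j = 1 := by simp
      omega
    have h4 := mul_mem_boxSpan (hzc i) (ih (α - Pi.single i 1) hα')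
    rw [← hsum, monomialValue_add, mul_comm (monomialValue z _)]
    have h5 : monomialValue z (Pi.single i 1) = z i := by
      rw [monomialValue, Finset.prod_eq_single i]
      · simp
      · intro j _ hj; simp [hj]
      · simp
    rw [h5]
    rwa [← Nat.mul_succ] at h4

theorem sum_finrank_graded_le (hfin : ∀ m, Module.Finite k (𝒜 m)) {U : Submodule k A}
    [Module.Finite k U] (n : ℕ) (hU : ∀ m < n, 𝒜 m ≤ U) :
    ∑ m ∈ Finset.range n, Module.finrank k (𝒜 m) ≤ Module.finrank k U := by
  rw [← Fin.sum_univ_eq_sum_range (fun m => Module.finrank k (𝒜 m)), ← Module.finrank_pi_fintype k]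
  let L : (∀ i : Fin n, 𝒜 i) →ₗ[k] U :=
    ∑ i : Fin n, Submodule.inclusion (hU i i.2) ∘ₗ LinearMap.proj i
  have hL : ∀ x, (L x : A) = ∑ i, (x i : A) := fun x => by simp [L]
  refine LinearMap.finrank_le_finrank_of_injective (f := L) ?_
  rw [← LinearMap.ker_eq_bot, LinearMap.ker_eq_bot']
  intro x hx
  have h0 : ∑ i, (x i : A) = 0 := by rw [← hL, hx]; rfl
  funext j
  have h1 := congr_arg (fun a => ((DirectSum.decompose 𝒜 a j : 𝒜 j) : A)) h0
  simp only [DirectSum.decompose_zero, DirectSum.zero_apply, ZeroMemClass.coe_zero,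
    DirectSum.decompose_sum] at h1
  rw [DFinsupp.finsetSum_apply, AddSubmonoidClass.coe_finsetSum, Finset.sum_eq_single j] at h1
  · rw [DirectSum.decompose_of_mem_same 𝒜 (x j).2] at h1
    exact Subtype.ext h1
  · intro i _ hij
    exact DirectSum.decompose_of_mem_ne 𝒜 (x i).2 (fun h => hij (Fin.ext h))
  · simp

theorem mul_mem_degreeLESpan {m n : ℕ} {x y : A} (hx : x ∈ degreeLESpan 𝒜 m)
    (hy : y ∈ degreeLESpan 𝒜 n) : x * y ∈ degreeLESpan 𝒜 (m + n) := by
  have h := Submodule.mul_mem_mul hx hy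
  rw [degreeLESpan, degreeLESpan, Submodule.span_mul_span] at h
  refine Submodule.span_mono ?_ h
  rintro _ ⟨a, ⟨i, hi, ha⟩, b, ⟨j, hj, hb⟩, rfl⟩
  exact ⟨i + j, add_le_add hi hj, SetLike.mul_mem_graded ha hb⟩

theorem one_mem_degreeLESpan : (1 : A) ∈ degreeLESpan 𝒜 0 :=
  Submodule.subset_span ⟨0, le_rfl, SetLike.one_mem_graded 𝒜⟩

theorem pow_mem_degreeLESpan {m : ℕ} {x : A} (hx : x ∈ degreeLESpan 𝒜 m) (n : ℕ) :
    x ^ n ∈ degreeLESpan 𝒜 (n * m) := by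
  induction n with
  | zero => simpa using one_mem_degreeLESpan
  | succ n ih =>
    rw [pow_succ, Nat.succ_mul]
    exact mul_mem_degreeLESpan ih hx

theorem exists_mem_degreeLESpan (x : A) : ∃ m, x ∈ degreeLESpan 𝒜 m := by
  classical
  refine ⟨(DirectSum.decompose 𝒜 x).support.sup id, ?_⟩
  have h : ∑ i ∈ (DirectSum.decompose 𝒜 x).support, (DirectSum.decompose 𝒜 x i : A) ∈
      degreeLESpan 𝒜 ((DirectSum.decompose 𝒜 x).support.sup id) := ?_
  · rwa [DirectSum.sum_support_decompose 𝒜 x] at h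
  refine sum_mem fun i hi => Submodule.subset_span ?_
  exact ⟨i, Finset.le_sup (f := id) hi, (DirectSum.decompose 𝒜 x i).2⟩

theorem proj_eq_zero_of_mem_degreeLESpan {m : ℕ} {x : A} (hx : x ∈ degreeLESpan 𝒜 m) {i : ℕ}
    (hi : m < i) : (DirectSum.decompose 𝒜 x i : A) = 0 := by
  have : degreeLESpan 𝒜 m ≤ LinearMap.ker (GradedAlgebra.proj 𝒜 i) := by
    rw [degreeLESpan, Submodule.span_le]
    rintro y ⟨j, hj, hy⟩
    rw [SetLike.mem_coe, LinearMap.mem_ker, GradedAlgebra.proj_apply]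
    exact DirectSum.decompose_of_mem_ne 𝒜 hy (by omega)
  exact this hx

theorem finrank_le_sum_finrank_graded (hfin : ∀ m, Module.Finite k (𝒜 m)) {V : Type*}
    [AddCommGroup V] [Module k V] (f : V →ₗ[k] A) (hf : Function.Injective f) (n : ℕ)
    (hV : ∀ v, f v ∈ degreeLESpan 𝒜 n) :
    Module.finrank k V ≤ ∑ m ∈ Finset.range (n + 1), Module.finrank k (𝒜 m) := by
  classical
  rw [← Fin.sum_univ_eq_sum_range (fun m => Module.finrank k (𝒜 m)), ← Module.finrank_pi_fintype k]
  let L : V →ₗ[k] (∀ i : Fin (n + 1), 𝒜 i) :=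
    LinearMap.pi fun i => (DirectSum.component k ℕ (fun i => 𝒜 i) i) ∘ₗ
      (DirectSum.decomposeLinearEquiv 𝒜).toLinearMap ∘ₗ f
  refine LinearMap.finrank_le_finrank_of_injective (f := L) ?_
  rw [← LinearMap.ker_eq_bot, LinearMap.ker_eq_bot']
  intro v hv
  apply hf
  rw [map_zero, ← DirectSum.sum_support_decompose 𝒜 (f v)]
  refine Finset.sum_eq_zero fun i _ => ?_
  rcases Nat.lt_or_ge n i with hi | hi
  · exact proj_eq_zero_of_mem_degreeLESpan (hV v) hi
  · have := congr_fun hv ⟨i, Nat.lt_succ_of_le hi⟩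
    exact congr_arg Subtype.val this

/-- Two-sided polynomial bounds of degree the Krull dimension for the cumulative Hilbert function
of a standard graded algebra. -/
theorem IsStandardGraded.exists_growth (hA : IsStandardGraded 𝒜) {D : ℕ}
    (hD : ringKrullDim A = D) :
    ∃ c : ℕ, ∀ n,
      ∑ m ∈ Finset.range (n + 1), Module.finrank k (𝒜 m) ≤ c * (c * (n + 1) + 1) ^ D ∧
      (n + 1) ^ D ≤ ∑ m ∈ Finset.range (c * n + 1), Module.finrank k (𝒜 m) := by
  classical
  have hfin := hA.finite_graded
  have hnt : Nontrivial A := by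
    by_contra h
    rw [not_nontrivial_iff_subsingleton] at h
    rw [ringKrullDim_eq_bot_of_subsingleton] at hD
    exact absurd hD (by simp)
  have hft : Algebra.FiniteType k A := by
    obtain ⟨N, z, -, hgen⟩ := hA.exists_generators
    exact ⟨⟨Finset.univ.image z, by simpa using hgen⟩⟩
  -- Noether normalisation. The number of variables is `D`, since finite injective extensions
  -- preserve dimension.
  obtain ⟨s, φ, hinj, hφ⟩ := exists_finite_inj_algHom_of_fg k A
  have hs : s = D := by
    let _ := φ.toRingHom.toAlgebra
    have : Module.Finite (MvPolynomial (Fin s) k) A := hφ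
    have h1 := ringKrullDim_eq_of_isIntegral_of_injective (R := MvPolynomial (Fin s) k) (S := A)
      hinj
    rw [hD, MvPolynomial.ringKrullDim_of_isNoetherianRing, ringKrullDim_eq_zero_of_field] at h1
    simp only [Nat.card_eq_fintype_card, Fintype.card_fin, zero_add] at h1
    exact_mod_cast h1.symm
  subst hs
  obtain ⟨T, hT⟩ : ∃ T : Finset A, ∀ x : A, ∃ p : T → MvPolynomial (Fin s) k,
      ∑ t, φ (p t) * t = x := by
    let _ := φ.toRingHom.toAlgebra
    have : Module.Finite (MvPolynomial (Fin s) k) A := hφ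
    obtain ⟨T, hT⟩ := (Module.Finite.fg_top : (⊤ : Submodule (MvPolynomial (Fin s) k) A).FG)
    refine ⟨T, fun x => ?_⟩
    have hx : x ∈ Submodule.span (MvPolynomial (Fin s) k) (Set.range ((↑) : T → A)) := by
      rw [Subtype.range_coe_subtype]
      have : x ∈ Submodule.span (MvPolynomial (Fin s) k) (T : Set A) := by rw [hT]; trivial
      simpa using this
    obtain ⟨p, hp⟩ := (Submodule.mem_span_range_iff_exists_fun _).1 hx
    exact ⟨p, by rw [← hp]; exact Finset.sum_congr rfl fun t _ => (Algebra.smul_def _ _).symm⟩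
  obtain ⟨c, hc⟩ := hA.exists_le_boxSpan hT
  choose e he using fun i => exists_mem_degreeLESpan (𝒜 := 𝒜) (φ (MvPolynomial.X i))
  set E := Finset.univ.sup e with hE
  have hX : ∀ i, φ (MvPolynomial.X i) ∈ degreeLESpan 𝒜 E := fun i =>
    degreeLESpan_mono (Finset.le_sup (Finset.mem_univ i)) (he i)
  have hmonom : ∀ (α : Fin s →₀ ℕ) (n : ℕ), (∀ i, α i ≤ n) →
      φ (MvPolynomial.monomial α 1) ∈ degreeLESpan 𝒜 (s * E * n) := by
    intro α n hα
    rw [MvPolynomial.monomial_eq, map_mul, MvPolynomial.C_1, map_one, one_mul, Finsupp.prod_fintype _ _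
      (fun i => pow_zero _), map_prod]
    have hprod : ∀ F : Finset (Fin s), ∏ i ∈ F, φ (MvPolynomial.X i ^ α i) ∈
        degreeLESpan 𝒜 (∑ i ∈ F, α i * E) := by
      intro F
      induction F using Finset.induction_on with
      | empty => simpa using one_mem_degreeLESpan
      | insert a F ha ih =>
        rw [Finset.prod_insert ha, Finset.sum_insert ha]
        refine mul_mem_degreeLESpan ?_ ih
        rw [map_pow]
        exact pow_mem_degreeLESpan (hX a) _
    refine degreeLESpan_mono ?_ (hprod Finset.univ)
    calc ∑ i, α i * E ≤ ∑ _i : Fin s, n * E :=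
          Finset.sum_le_sum fun i _ => Nat.mul_le_mul_right _ (hα i)
      _ = s * E * n := by simp; ring
  have hbox : ∀ n, ∀ p ∈ MvPolynomial.restrictDegree (Fin s) k n,
      φ p ∈ degreeLESpan 𝒜 (s * E * n) := by
    intro n p hp
    rw [MvPolynomial.as_sum p, map_sum]
    refine sum_mem fun α hα => ?_
    have hsmul : MvPolynomial.monomial α (MvPolynomial.coeff α p) =
        MvPolynomial.coeff α p • MvPolynomial.monomial α (1 : k) := by
      rw [MvPolynomial.smul_monomial, smul_eq_mul, mul_one]
    rw [hsmul, map_smul]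
    exact Submodule.smul_mem _ _ (hmonom α n ((MvPolynomial.mem_restrictDegree _ _ _).1 hp α hα))
  -- The upper bound uses the box size `c` and the number `T.card` of module generators. The lower
  -- bound uses that `φ` sends polynomials in the box of size `n` injectively into degrees at most
  -- `s * E * n`.
  refine ⟨max (max c T.card) (s * E), fun n => ⟨?_, ?_⟩⟩
  · have h1 := sum_finrank_graded_le hfin (U := boxSpan φ T (c * (n + 1))) (n + 1) fun m hm =>
      (hc m).trans (boxSpan_mono φ T (Nat.mul_le_mul_left _ (by omega)))
    refine h1.trans ((finrank_boxSpan_le _ _ _).trans ?_)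
    gcongr
    · exact (le_max_right _ _).trans (le_max_left _ _)
    · exact (le_max_left _ _).trans (le_max_left _ _)
  · rw [← finrank_restrictDegree (k := k) s n]
    refine finrank_le_sum_finrank_graded hfin
      (φ.toLinearMap ∘ₗ (MvPolynomial.restrictDegree (Fin s) k n).subtype)
      (hinj.comp Subtype.val_injective) _ fun p => ?_
    exact degreeLESpan_mono (Nat.mul_le_mul_right _ (le_max_right _ _)) (hbox n p p.2)

end Growth

/-! ### The exact order of the Hilbert function -/

section HilbertBounds

open Filter Topology

theorem Polynomial.tendsto_eval_div_pow (Q : Polynomial ℝ) (hQ : Q ≠ 0) :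
    Tendsto (fun x : ℝ => Q.eval x / x ^ Q.natDegree) atTop (𝓝 Q.leadingCoeff) := by
  have h := Polynomial.div_tendsto_atTop_leadingCoeff_div_of_degree_eq Q
    (Polynomial.X ^ Q.natDegree) (by
      rw [Polynomial.degree_X_pow, Polynomial.degree_eq_natDegree hQ])
  simpa using h

theorem Polynomial.eventually_le_eval (Q : Polynomial ℝ) (hQ : 0 < Q.leadingCoeff) :
    ∀ᶠ x : ℝ in atTop, Q.leadingCoeff / 2 * x ^ Q.natDegree ≤ Q.eval x ∧
      Q.eval x ≤ 2 * Q.leadingCoeff * x ^ Q.natDegree := by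
  have hQ0 : Q ≠ 0 := by rintro rfl; simp at hQ
  filter_upwards [(Q.tendsto_eval_div_pow hQ0).eventually
    (Ioo_mem_nhds (by linarith : Q.leadingCoeff / 2 < Q.leadingCoeff)
      (by linarith : Q.leadingCoeff < 2 * Q.leadingCoeff)), eventually_gt_atTop 0] with x hx hx0
  have hpow : 0 < x ^ Q.natDegree := pow_pos hx0 _
  exact ⟨((lt_div_iff₀ hpow).1 hx.1).le, ((div_lt_iff₀ hpow).1 hx.2).le⟩

theorem Polynomial.eventually_eval_le_eval_add_one (Q : Polynomial ℝ) (hQ : 0 < Q.leadingCoeff) :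
    ∀ᶠ x : ℝ in atTop, Q.eval x ≤ Q.eval (x + 1) := by
  rcases Nat.eq_zero_or_pos Q.natDegree with h0 | hpos
  · rw [Polynomial.eq_C_of_natDegree_eq_zero h0]
    simp
  · have hder : 0 < Q.derivative.leadingCoeff := by
      rw [Polynomial.leadingCoeff, Polynomial.natDegree_derivative, Polynomial.coeff_derivative,
        Nat.sub_add_cancel hpos]
      exact mul_pos hQ (by positivity)
    obtain ⟨B, hB⟩ := eventually_atTop.1 ((Q.derivative.eventually_le_eval hder).and
      (eventually_ge_atTop (0 : ℝ)))
    filter_upwards [eventually_ge_atTop B] with x hx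
    refine monotoneOn_of_deriv_nonneg (convex_Ici B) Q.continuous.continuousOn
      Q.differentiable.differentiableOn (fun y hy => ?_) (Set.mem_Ici.2 hx)
      (Set.mem_Ici.2 (by linarith)) (by linarith)
    rw [interior_Ici] at hy
    rw [Polynomial.deriv]
    have h1 := hB y (le_of_lt hy)
    have : 0 ≤ y ^ Q.derivative.natDegree := pow_nonneg h1.2 _
    exact (by positivity : (0:ℝ) ≤ _).trans h1.1.1

/-- An eventually polynomial function whose partial sums grow like `n ^ D` has degree `D - 1`. -/
theorem natDegree_eq_of_growth {h : ℕ → ℕ} {q : Polynomial ℝ} {M c D : ℕ} (hD : 1 ≤ D)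
    (hq : ∀ m, M ≤ m → (h m : ℝ) = q.eval (m : ℝ))
    (hc : ∀ n, ∑ m ∈ Finset.range (n + 1), h m ≤ c * (c * (n + 1) + 1) ^ D ∧
      (n + 1) ^ D ≤ ∑ m ∈ Finset.range (c * n + 1), h m) :
    q.natDegree = D - 1 ∧ 0 < q.leadingCoeff := by
  -- Otherwise the partial sums would be bounded, although they exceed `(n + 1) ^ D ≥ n + 1`.
  have hq0 : q ≠ 0 := by
    rintro rfl
    have hz : ∀ m, M ≤ m → h m = 0 := fun m hm => by
      have := hq m hm
      simpa using this
    have hbound : ∀ n, ∑ m ∈ Finset.range n, h m ≤ ∑ m ∈ Finset.range M, h m := by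
      intro n
      rcases le_total n M with hn | hn
      · exact Finset.sum_le_sum_of_subset (Finset.range_mono hn)
      · rw [← Finset.sum_range_add_sum_Ico _ hn]
        rw [Finset.sum_eq_zero (s := Finset.Ico M n) fun m hm => hz m (Finset.mem_Ico.1 hm).1]
        simp
    have h1 := (hc (∑ m ∈ Finset.range M, h m)).2.trans (hbound _)
    have h2 := Nat.le_self_pow (Nat.one_le_iff_ne_zero.1 hD) (∑ m ∈ Finset.range M, h m + 1)
    omega
  have hlead : 0 < q.leadingCoeff := by
    refine lt_of_le_of_ne ?_ (Ne.symm (Polynomial.leadingCoeff_ne_zero.2 hq0))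
    refine ge_of_tendsto ((q.tendsto_eval_div_pow hq0).comp tendsto_natCast_atTop_atTop) ?_
    filter_upwards [eventually_ge_atTop M] with m hm
    simp only [Function.comp_apply]
    rw [← hq m hm]
    positivity
  refine ⟨?_, hlead⟩
  obtain ⟨B, hB⟩ := eventually_atTop.1
    ((tendsto_natCast_atTop_atTop (R := ℝ)).eventually (q.eventually_le_eval hlead))
  set e := q.natDegree with he
  set a := q.leadingCoeff with ha
  set B' := max (max B M) 1 with hB'
  have hlow : ∀ m, B' ≤ m → a / 2 * (m : ℝ) ^ e ≤ h m := fun m hm => by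
    rw [hq m (by omega)]
    exact (hB m (by omega)).1
  have hup : ∀ m, B' ≤ m → (h m : ℝ) ≤ 2 * a * (m : ℝ) ^ e := fun m hm => by
    rw [hq m (by omega)]
    exact (hB m (by omega)).2
  by_contra hne
  -- If `e < D - 1`, the sums up to `c * n` are of order at most `n ^ (D - 1)`, too small for the
  -- lower bound. If `e ≥ D`, the terms with index in `[m, 2m)` alone contribute order `m ^ (D +
  -- 1)`, too much for the upper bound.
  rcases Nat.lt_or_ge e D with hlt | hge
  · have hlt' : e + 1 ≤ D - 1 := by omega
    set C : ℝ := 2 * a + ∑ m ∈ Finset.range B', (h m : ℝ) with hC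
    have hsum0 : (0 : ℝ) ≤ ∑ m ∈ Finset.range B', (h m : ℝ) := Finset.sum_nonneg fun _ _ => by
      positivity
    have hCpos : 0 < C := by linarith
    have hall : ∀ m n : ℕ, m ≤ n → (h m : ℝ) ≤ C * ((n : ℝ) + 1) ^ e := by
      intro m n hmn
      have h1 : (1 : ℝ) ≤ ((n : ℝ) + 1) ^ e := one_le_pow₀ (by linarith [n.cast_nonneg (α := ℝ)])
      rcases Nat.lt_or_ge m B' with hm | hm
      · have h2 : (h m : ℝ) ≤ ∑ m ∈ Finset.range B', (h m : ℝ) :=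
          Finset.single_le_sum (f := fun m => (h m : ℝ)) (fun _ _ => by positivity)
            (Finset.mem_range.2 hm)
        nlinarith
      · refine (hup m hm).trans ?_
        have h3 : (m : ℝ) ^ e ≤ ((n : ℝ) + 1) ^ e := by
          have : (m : ℝ) ≤ n := by exact_mod_cast hmn
          gcongr
          linarith
        have h4 : (0 : ℝ) ≤ (m : ℝ) ^ e := by positivity
        nlinarith
    have hkey : ∀ n : ℕ, ((n : ℝ) + 1) ≤ C * ((c : ℝ) + 1) ^ (D - 1) := by
      intro n
      have h1 : (((n + 1) ^ D : ℕ) : ℝ) ≤ ∑ m ∈ Finset.range (c * n + 1), (h m : ℝ) := by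
        exact_mod_cast (hc n).2
      have h2 : ∑ m ∈ Finset.range (c * n + 1), (h m : ℝ) ≤
          ∑ _m ∈ Finset.range (c * n + 1), C * (((c * n : ℕ) : ℝ) + 1) ^ e :=
        Finset.sum_le_sum fun m hm => hall m _ (by
          have := Finset.mem_range.1 hm
          omega)
      rw [Finset.sum_const, Finset.card_range, nsmul_eq_mul] at h2
      have h3 : ((c * n + 1 : ℕ) : ℝ) * (C * (((c * n : ℕ) : ℝ) + 1) ^ e) =
          C * ((c * n : ℝ) + 1) ^ (e + 1) := by
        push_cast
        ring
      have h4 : ((c * n : ℝ) + 1) ^ (e + 1) ≤ ((c * n : ℝ) + 1) ^ (D - 1) :=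
        pow_le_pow_right₀ (by
          have : (0 : ℝ) ≤ c * n := by positivity
          linarith) hlt'
      have h5 : ((c * n : ℝ) + 1) ^ (D - 1) ≤ (((c : ℝ) + 1) * ((n : ℝ) + 1)) ^ (D - 1) := by
        gcongr
        nlinarith [c.cast_nonneg (α := ℝ), n.cast_nonneg (α := ℝ)]
      rw [mul_pow] at h5
      have h6 : ((n : ℝ) + 1) * ((n : ℝ) + 1) ^ (D - 1) = (((n + 1) ^ D : ℕ) : ℝ) := by
        rw [← pow_succ', Nat.sub_add_cancel hD]
        push_cast
        rfl
      have h7 : (0 : ℝ) < ((n : ℝ) + 1) ^ (D - 1) := by positivity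
      refine le_of_mul_le_mul_right ?_ h7
      rw [h6]
      calc (((n + 1) ^ D : ℕ) : ℝ) ≤ C * ((c * n : ℝ) + 1) ^ (e + 1) := by
            rw [← h3]; exact h1.trans h2
        _ ≤ C * (((c : ℝ) + 1) ^ (D - 1) * ((n : ℝ) + 1) ^ (D - 1)) :=
            mul_le_mul_of_nonneg_left (h4.trans h5) hCpos.le
        _ = _ := by ring
    obtain ⟨n, hn⟩ := exists_nat_gt (C * ((c : ℝ) + 1) ^ (D - 1))
    linarith [hkey n]
  · have hkey : ∀ m : ℕ, B' ≤ m → a / 2 * (m : ℝ) ≤ c * (3 * (c : ℝ) + 1) ^ D := by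
      intro m hm
      have hm1 : (1 : ℝ) ≤ m := by
        have : 1 ≤ m := by omega
        exact_mod_cast this
      have h1 : (∑ i ∈ Finset.range (2 * m + 1), (h i : ℝ)) ≤
          c * ((c : ℝ) * (2 * m + 1) + 1) ^ D := by
        exact_mod_cast (hc (2 * m)).1
      have h2 : ∑ i ∈ Finset.Ico m (2 * m), (a / 2 * (m : ℝ) ^ D) ≤
          ∑ i ∈ Finset.range (2 * m + 1), (h i : ℝ) := by
        refine (Finset.sum_le_sum fun i hi => ?_).trans
          (Finset.sum_le_sum_of_subset_of_nonneg (s := Finset.Ico m (2 * m)) (fun i hi => ?_)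
            fun _ _ _ => by positivity)
        · obtain ⟨hi1, hi2⟩ := Finset.mem_Ico.1 hi
          refine le_trans ?_ (hlow i (hm.trans hi1))
          have hi1' : (m : ℝ) ≤ i := by exact_mod_cast hi1
          have : (m : ℝ) ^ D ≤ (i : ℝ) ^ e :=
            (pow_le_pow_right₀ hm1 hge).trans (by gcongr)
          gcongr
        · rw [Finset.mem_Ico] at hi
          rw [Finset.mem_range]
          omega
      rw [Finset.sum_const, Nat.card_Ico, nsmul_eq_mul] at h2
      have h3 : ((2 * m - m : ℕ) : ℝ) = m := by
        congr 1
        omega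
      rw [h3] at h2
      have h4 : ((c : ℝ) * (2 * m + 1) + 1) ^ D ≤ ((3 * (c : ℝ) + 1) * m) ^ D := by
        gcongr
        nlinarith [c.cast_nonneg (α := ℝ)]
      rw [mul_pow] at h4
      have h5 : (0 : ℝ) < (m : ℝ) ^ D := by positivity
      refine le_of_mul_le_mul_right ?_ h5
      calc a / 2 * (m : ℝ) * (m : ℝ) ^ D = m * (a / 2 * (m : ℝ) ^ D) := by ring
        _ ≤ c * ((c : ℝ) * (2 * m + 1) + 1) ^ D := h2.trans h1
        _ ≤ c * ((3 * (c : ℝ) + 1) ^ D * (m : ℝ) ^ D) := by gcongr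
        _ = _ := by ring
    obtain ⟨n, hn⟩ := exists_nat_gt (c * (3 * (c : ℝ) + 1) ^ D / (a / 2))
    have h1 := hkey (max n B') (le_max_right _ _)
    rw [div_lt_iff₀ (by positivity)] at hn
    have h2 : (n : ℝ) ≤ (max n B' : ℕ) := by exact_mod_cast le_max_left _ _
    have h3 : n * (a / 2) ≤ (max n B' : ℕ) * (a / 2) := by gcongr
    linarith

variable {k A : Type*} [Field k] [CommRing A] [Algebra k A]
  {𝒜 : ℕ → Submodule k A} [GradedAlgebra 𝒜]

/-- The Hilbert function of a standard graded algebra of dimension `D ≥ 1` is of order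
`m ^ (D - 1)`, and eventually monotone. -/
theorem IsStandardGraded.exists_hilbert_bounds (hA : IsStandardGraded 𝒜) {D : ℕ}
    (hD : ringKrullDim A = D) (hD1 : 1 ≤ D) :
    ∃ (c C : ℝ) (M : ℕ), 0 < c ∧ 0 < C ∧
      (∀ m, (Module.finrank k (𝒜 m) : ℝ) ≤ C * ((m : ℝ) + 1) ^ (D - 1)) ∧
      (∀ m, M ≤ m → c * (m : ℝ) ^ (D - 1) ≤ Module.finrank k (𝒜 m)) ∧
      (∀ m, M ≤ m → Module.finrank k (𝒜 m) ≤ Module.finrank k (𝒜 (m + 1))) := by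
  obtain ⟨q, M, hq⟩ := hA.exists_hilbertPoly
  obtain ⟨c, hc⟩ := hA.exists_growth hD
  set Q := q.map (algebraMap ℚ ℝ) with hQ
  have hqQ : ∀ m, M ≤ m → (Module.finrank k (𝒜 m) : ℝ) = Q.eval (m : ℝ) := by
    intro m hm
    rw [hQ, Polynomial.eval_natCast_map, ← hq m hm, map_natCast]
  obtain ⟨hdeg, hlead⟩ := natDegree_eq_of_growth hD1 hqQ hc
  obtain ⟨B, hB⟩ := eventually_atTop.1
    ((tendsto_natCast_atTop_atTop (R := ℝ)).eventually ((Q.eventually_le_eval hlead).and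
      (Q.eventually_eval_le_eval_add_one hlead)))
  rw [hdeg] at hB
  have hsum0 : (0 : ℝ) ≤ ∑ m ∈ Finset.range (max B M), (Module.finrank k (𝒜 m) : ℝ) :=
    Finset.sum_nonneg fun _ _ => by positivity
  refine ⟨Q.leadingCoeff / 2, 2 * Q.leadingCoeff +
    ∑ m ∈ Finset.range (max B M), (Module.finrank k (𝒜 m) : ℝ), max B M, by positivity,
    by positivity, fun m => ?_, fun m hm => ?_, fun m hm => ?_⟩
  · have h1 : (1 : ℝ) ≤ ((m : ℝ) + 1) ^ (D - 1) :=
      one_le_pow₀ (by linarith [m.cast_nonneg (α := ℝ)])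
    rcases Nat.lt_or_ge m (max B M) with hm | hm
    · have h2 : (Module.finrank k (𝒜 m) : ℝ) ≤
          ∑ m ∈ Finset.range (max B M), (Module.finrank k (𝒜 m) : ℝ) :=
        Finset.single_le_sum (f := fun m => (Module.finrank k (𝒜 m) : ℝ))
          (fun _ _ => by positivity) (Finset.mem_range.2 hm)
      nlinarith
    · rw [hqQ m (by omega)]
      refine (hB m (by omega)).1.2.trans ?_
      have h3 : (m : ℝ) ^ (D - 1) ≤ ((m : ℝ) + 1) ^ (D - 1) := by
        gcongr
        linarith
      have h4 : (0 : ℝ) ≤ (m : ℝ) ^ (D - 1) := by positivity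
      nlinarith
  · rw [hqQ m (by omega)]
    exact (hB m (by omega)).1.1
  · have h := (hB m (by omega)).2
    have h1 := hqQ m (by omega)
    have h2 := hqQ (m + 1) (by omega)
    push_cast at h2
    rw [← h1, ← h2] at h
    exact_mod_cast h

end HilbertBounds

/-! ### Bigraded pieces of the Rees algebra and monotonicity of their lengths -/

section ReesGenerators

variable {k A : Type*} [Field k] [CommRing A] [Algebra k A]

namespace IdealFiltration

theorem len_eq_finrank (F : IdealFiltration A) {𝒜 : ℕ → Submodule k A} {n m : ℕ} (h : F.ideal n = ⊤) :
    F.len 𝒜 n m = Module.finrank k (𝒜 m) := by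
  have htop : (⊤ : Ideal A).restrictScalars k ⊓ 𝒜 m = 𝒜 m := by
    ext x
    simp
  rw [len, h, htop]

/-- Testing the nonzerodivisor of the Rees algebra against constants shows that its coefficient is a
nonzerodivisor of `A`, which is all that the later estimates need. -/
theorem exists_nonZeroDivisor {𝒜 : ℕ → Submodule k A} {F : IdealFiltration A} {p q : ℕ}
    (h : ∃ h : F.rees, F.HasBidegree 𝒜 h p q ∧ h ∈ nonZeroDivisors F.rees) :
    ∃ a, a ∈ 𝒜 p ∧ a ∈ F.ideal q ∧ ∀ x, a * x = 0 → x = 0 := by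
  obtain ⟨h, ⟨a, hap, haq, heq⟩, hreg⟩ := h
  refine ⟨a, hap, haq, fun x hx => ?_⟩
  have h1 : h * algebraMap A F.rees x = 0 := by
    apply Subtype.ext
    change (h : Polynomial A) * Polynomial.C x = 0
    rw [heq, Polynomial.monomial_mul_C, hx, Polynomial.monomial_zero_right]
  have h2 := hreg.2 _ (by rwa [mul_comm])
  have h3 : (Polynomial.C x : Polynomial A) = 0 := congr_arg Subtype.val h2
  exact Polynomial.C_eq_zero.1 h3

end IdealFiltration

variable {𝒜 : ℕ → Submodule k A} [GradedAlgebra 𝒜]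

/-- The bidegree `(m, n)`. -/
noncomputable def bidegree (m n : ℕ) : Fin 2 →₀ ℕ := Finsupp.equivFunOnFinite.symm ![m, n]

@[simp] theorem bidegree_zero (m n : ℕ) : bidegree m n 0 = m := rfl

@[simp] theorem bidegree_one (m n : ℕ) : bidegree m n 1 = n := rfl

theorem bidegree_eta (u : Fin 2 →₀ ℕ) : bidegree (u 0) (u 1) = u := by
  ext i
  fin_cases i <;> rfl

theorem multidegree_eq_bidegree_iff {N : ℕ} {b : Fin N → Fin 2 →₀ ℕ} {α : Fin N → ℕ} {m n : ℕ} :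
    multidegree b α = bidegree m n ↔ ∑ i, α i * b i 1 = n ∧ ∑ i, α i * b i 0 = m := by
  have h0 : multidegree b α 0 = ∑ i, α i * b i 0 := by simp [multidegree]
  have h1 : multidegree b α 1 = ∑ i, α i * b i 1 := by simp [multidegree]
  rw [← h0, ← h1]
  constructor
  · intro h
    rw [h]
    simp
  · rintro ⟨rfl, rfl⟩
    exact (bidegree_eta _).symm

namespace IdealFiltration

variable (F : IdealFiltration A)

theorem pow_mem {a : A} {q : ℕ} (ha : a ∈ F.ideal q) (n : ℕ) : a ^ n ∈ F.ideal (n * q) := by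
  induction n with
  | zero => simp [F.zero_eq]
  | succ n ih =>
    rw [pow_succ, Nat.succ_mul]
    exact F.mul_le _ _ (Ideal.mul_mem_mul ih ha)

theorem monomialValue_mem_ideal {N : ℕ} {z : Fin N → A} {w : Fin N → ℕ}
    (hz : ∀ i, z i ∈ F.ideal (w i)) (α : Fin N → ℕ) :
    monomialValue z α ∈ F.ideal (∑ i, α i * w i) := by
  classical
  rw [monomialValue]
  induction (Finset.univ : Finset (Fin N)) using Finset.induction_on with
  | empty => simp [F.zero_eq]
  | insert i s hi ih =>
    rw [Finset.prod_insert hi, Finset.sum_insert hi]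
    exact F.mul_le _ _ (Ideal.mul_mem_mul (F.pow_mem (hz i) _) ih)

theorem monomialSpan_le {N : ℕ} {z : Fin N → A} {b : Fin N → Fin 2 →₀ ℕ}
    (hz : ∀ i, z i ∈ 𝒜 (b i 0)) (hz' : ∀ i, z i ∈ F.ideal (b i 1)) (m n : ℕ) :
    monomialSpan k z b (bidegree m n) ≤ (F.ideal n).restrictScalars k ⊓ 𝒜 m := by
  rw [monomialSpan, Submodule.span_le]
  rintro _ ⟨α, hα, rfl⟩
  obtain ⟨rfl, rfl⟩ := multidegree_eq_bidegree_iff.1 hα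
  exact ⟨F.monomialValue_mem_ideal hz' α, monomialValue_mem 𝒜 hz α⟩

/-- Taking the coefficient of `t ^ n` and then the component of degree `m` removes all monomials of
other bidegrees. -/
theorem mem_monomialSpan_of_mem_adjoin {N : ℕ} {z : Fin N → A} {b : Fin N → Fin 2 →₀ ℕ}
    (hz : ∀ i, z i ∈ 𝒜 (b i 0)) {a : A} {m n : ℕ} (ha : a ∈ 𝒜 m)
    (hadj : (Polynomial.monomial n a : Polynomial A) ∈
      Algebra.adjoin k (Set.range fun i => Polynomial.monomial (b i 1) (z i))) :
    a ∈ monomialSpan k z b (bidegree m n) := by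
  have h1 := mem_span_monomialValue_of_mem_adjoin _ hadj
  have hmon : ∀ α : Fin N → ℕ, monomialValue (fun i => Polynomial.monomial (b i 1) (z i)) α =
      Polynomial.monomial (∑ i, α i * b i 1) (monomialValue z α) := by
    intro α
    simp only [monomialValue, Polynomial.monomial_pow]
    induction (Finset.univ : Finset (Fin N)) using Finset.induction_on with
    | empty => simp
    | insert i s hi ih =>
      rw [Finset.prod_insert hi, Finset.prod_insert hi, Finset.sum_insert hi, ih,
        Polynomial.monomial_mul_monomial, mul_comm (b i 1)]
  have h2 := Submodule.mem_map_of_mem (f := (Polynomial.lcoeff A n).restrictScalars k) h1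
  rw [Submodule.map_span, LinearMap.restrictScalars_apply, Polynomial.lcoeff_apply,
    Polynomial.coeff_monomial_same] at h2
  have h3 : a ∈ Submodule.span k (monomialValue z '' {α | ∑ i, α i * b i 1 = n}) := by
    refine Submodule.span_le.2 ?_ h2
    rintro _ ⟨_, ⟨α, rfl⟩, rfl⟩
    rw [LinearMap.restrictScalars_apply, Polynomial.lcoeff_apply, hmon, Polynomial.coeff_monomial]
    split_ifs with h
    · exact Submodule.subset_span ⟨α, h, rfl⟩
    · exact zero_mem _
  have h4 := mem_span_monomialValue_of_mem_graded 𝒜 hz ha h3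
  have hset : {α : Fin N → ℕ | multidegree b α = bidegree m n} =
      {α | α ∈ {α : Fin N → ℕ | ∑ i, α i * b i 1 = n} ∧ ∑ i, α i * b i 0 = m} := by
    ext α
    exact multidegree_eq_bidegree_iff
  rw [monomialSpan, hset]
  exact h4

/-- The bigraded pieces of the Rees algebra are spanned by the monomials in finitely many
bihomogeneous generators. -/
theorem exists_generators_of_adjoin_eq_top {F : IdealFiltration A} (hA : IsStandardGraded 𝒜)
    {G : Finset F.rees} {p q : F.rees → ℕ} (hadj : Algebra.adjoin A (G : Set F.rees) = ⊤)
    (hbi : ∀ g ∈ G, F.HasBidegree 𝒜 g (p g) (q g)) :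
    ∃ (N : ℕ) (z : Fin N → A) (b : Fin N → Fin 2 →₀ ℕ),
      (∀ i, b i = bidegree 1 0 ∨ ∃ g ∈ G, b i = bidegree (p g) (q g)) ∧
      ∀ m n, (F.ideal n).restrictScalars k ⊓ 𝒜 m = monomialSpan k z b (bidegree m n) := by
  classical
  obtain ⟨N, x, hx, hxgen⟩ := hA.exists_generators
  choose! y hy1 hy2 hy3 using hbi
  let ε : Fin (Fintype.card (Fin N ⊕ G)) ≃ Fin N ⊕ G := (Fintype.equivFin _).symm
  let z' : Fin N ⊕ G → A := Sum.elim x fun g => y g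
  let b' : Fin N ⊕ G → Fin 2 →₀ ℕ := Sum.elim (fun _ => bidegree 1 0) fun g => bidegree (p g) (q g)
  have hz : ∀ i, z' i ∈ 𝒜 (b' i 0) := by
    rintro (i | g)
    · exact hx i
    · exact hy1 g g.2
  have hz' : ∀ i, z' i ∈ F.ideal (b' i 1) := by
    rintro (i | g)
    · change x i ∈ F.ideal 0
      rw [F.zero_eq]; trivial
    · exact hy2 g g.2
  have hb : ∀ i, b' i = bidegree 1 0 ∨ ∃ g ∈ G, b' i = bidegree (p g) (q g) := by
    rintro (i | g)
    · exact Or.inl rfl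
    · exact Or.inr ⟨g, g.2, rfl⟩
  refine ⟨_, z' ∘ ε, b' ∘ ε, fun i => hb _, fun m n => ?_⟩
  refine le_antisymm ?_ (F.monomialSpan_le (fun i => hz _) (fun i => hz' _) m n)
  rintro a ⟨haI, ham⟩
  refine mem_monomialSpan_of_mem_adjoin (fun i => hz _) ham ?_
  -- This `k`-algebra contains the constants, because `x` generates `A`, and the generators of the
  -- Rees algebra, hence the whole Rees algebra.
  set B := Algebra.adjoin k
    (Set.range fun i => Polynomial.monomial ((b' ∘ ε) i 1) ((z' ∘ ε) i)) with hB
  have hmemB : ∀ i, Polynomial.monomial (b' i 1) (z' i) ∈ B := fun i =>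
    Algebra.subset_adjoin ⟨ε.symm i, by simp⟩
  have hCB : ∀ c : A, Polynomial.C c ∈ B := by
    intro c
    have hc : c ∈ Algebra.adjoin k (Set.range x) := by rw [hxgen]; trivial
    induction hc using Algebra.adjoin_induction with
    | mem c hc =>
      obtain ⟨i, rfl⟩ := hc
      exact hmemB (Sum.inl i)
    | algebraMap r =>
      have : Polynomial.C (algebraMap k A r) = algebraMap k (Polynomial A) r := rfl
      rw [this]
      exact B.algebraMap_mem r
    | add c c' _ _ h h' => rw [Polynomial.C_add]; exact add_mem h h'
    | mul c c' _ _ h h' => rw [Polynomial.C_mul]; exact mul_mem h h'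
  have hall : ∀ f : F.rees, (f : Polynomial A) ∈ B := by
    intro f
    have hf : f ∈ Algebra.adjoin A (G : Set F.rees) := by rw [hadj]; trivial
    induction hf using Algebra.adjoin_induction with
    | mem g hg =>
      rw [hy3 g hg]
      exact hmemB (Sum.inr ⟨g, hg⟩)
    | algebraMap r => exact hCB r
    | add c c' _ _ h h' => exact add_mem h h'
    | mul c c' _ _ h h' => exact mul_mem h h'
  refine hall ⟨Polynomial.monomial n a, fun j => ?_⟩
  rw [Polynomial.coeff_monomial]
  split_ifs with h
  · exact h ▸ haI
  · exact zero_mem _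

theorem exists_generators {F : IdealFiltration A} (hA : IsStandardGraded 𝒜) {l : ℕ} {d e : ℕ → ℕ}
    (hgen : F.IsGeneratedInBidegrees 𝒜 l d e) :
    ∃ (N : ℕ) (z : Fin N → A) (b : Fin N → Fin 2 →₀ ℕ),
      (∀ i, b i = bidegree 1 0 ∨
        ∃ j, 1 ≤ j ∧ j ≤ l ∧ 0 < b i 1 ∧ (b i 0 : ℚ) / b i 1 = (d j : ℚ) / e j) ∧
      ∀ m n, (F.ideal n).restrictScalars k ⊓ 𝒜 m = monomialSpan k z b (bidegree m n) := by
  obtain ⟨-, -, G, p, q, hadj, hbi, hratio, -⟩ := hgen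
  obtain ⟨N, z, b, hb, hspan⟩ :=
    exists_generators_of_adjoin_eq_top hA hadj fun g hg => (hbi g hg).2
  refine ⟨N, z, b, fun i => (hb i).imp_right ?_, hspan⟩
  rintro ⟨g, hg, h⟩
  obtain ⟨j, h1, h2, h3⟩ := hratio g hg
  rw [h]
  exact ⟨j, h1, h2, (hbi g hg).1, h3⟩

section Length

variable (𝒜)

theorem finite_inf (hA : IsStandardGraded 𝒜) (n m : ℕ) :
    Module.Finite k ↥((F.ideal n).restrictScalars k ⊓ 𝒜 m) :=
  have := hA.finite_graded m
  Submodule.finiteDimensional_of_le inf_le_right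

variable {𝒜}

theorem len_succ_le (hA : IsStandardGraded 𝒜) (n m : ℕ) : F.len 𝒜 (n + 1) m ≤ F.len 𝒜 n m :=
  have := F.finite_inf 𝒜 hA n m
  Submodule.finrank_mono (inf_le_inf_right _ fun _ hx => F.succ_le n hx)

theorem len_le_finrank (hA : IsStandardGraded 𝒜) (n m : ℕ) :
    F.len 𝒜 n m ≤ Module.finrank k (𝒜 m) :=
  have := hA.finite_graded m
  Submodule.finrank_mono inf_le_right

theorem len_le_len_add (hA : IsStandardGraded 𝒜) {a : A} {p q : ℕ} (hap : a ∈ 𝒜 p)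
    (haq : a ∈ F.ideal q) (ha : ∀ x, a * x = 0 → x = 0) (n m : ℕ) :
    F.len 𝒜 n m ≤ F.len 𝒜 (n + q) (m + p) := by
  have := F.finite_inf 𝒜 hA (n + q) (m + p)
  have hmem : ∀ x ∈ (F.ideal n).restrictScalars k ⊓ 𝒜 m, LinearMap.mulLeft k a x ∈
      (F.ideal (n + q)).restrictScalars k ⊓ 𝒜 (m + p) := by
    rintro x ⟨hxn, hxm⟩
    rw [LinearMap.mulLeft_apply, mul_comm]
    exact ⟨F.mul_le _ _ (Ideal.mul_mem_mul hxn haq), SetLike.mul_mem_graded hxm hap⟩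
  refine LinearMap.finrank_le_finrank_of_injective (f := (LinearMap.mulLeft k a).restrict hmem) ?_
  rw [← LinearMap.ker_eq_bot, LinearMap.ker_eq_bot']
  intro x hx
  exact Subtype.ext (ha x (congr_arg Subtype.val hx))

theorem len_le_len_add_mul (hA : IsStandardGraded 𝒜) {a : A} {p q : ℕ} (hap : a ∈ 𝒜 p)
    (haq : a ∈ F.ideal q) (ha : ∀ x, a * x = 0 → x = 0) (s n m : ℕ) :
    F.len 𝒜 n m ≤ F.len 𝒜 (n + s * q) (m + s * p) := by
  induction s with
  | zero => simp
  | succ s ih =>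
    refine ih.trans ((F.len_le_len_add hA hap haq ha _ _).trans (le_of_eq ?_))
    congr 1 <;> ring

/-- Multiplication by a polynomial whose coefficients span `A₁` is injective if some element of
positive degree is a nonzerodivisor, so `(Iₙ)ₘ` cannot have larger dimension than `(Iₙ)ₘ₊₁`. -/
theorem len_le_len_succ (hA : IsStandardGraded 𝒜) {a : A} {p : ℕ} (hp : 0 < p) (hap : a ∈ 𝒜 p)
    (ha : ∀ x, a * x = 0 → x = 0) (n m : ℕ) : F.len 𝒜 n m ≤ F.len 𝒜 n (m + 1) := by
  classical
  obtain ⟨N, z, hz, hgen⟩ := hA.exists_generators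
  -- A generic linear form. Over a finite field `A₁` itself may contain no nonzerodivisor, so the
  -- coefficients are taken to be powers of an auxiliary variable.
  set f : Polynomial A := ∑ i : Fin N, Polynomial.monomial (i : ℕ) (z i) with hf
  have hcoeff : ∀ i : Fin N, f.coeff i = z i := by
    intro i
    rw [hf, Polynomial.finsetSum_coeff, Finset.sum_eq_single i]
    · simp
    · intro j _ hj
      rw [Polynomial.coeff_monomial, if_neg fun h => hj (Fin.ext h)]
    · simp
  have hcoeff' : ∀ i, N ≤ i → f.coeff i = 0 := by
    intro i hi
    rw [hf, Polynomial.finsetSum_coeff]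
    refine Finset.sum_eq_zero fun j _ => ?_
    rw [Polynomial.coeff_monomial, if_neg]
    have := j.2
    omega
  -- McCoy's theorem: it suffices that no nonzero `c` kills all coefficients of `f`. Such a `c`
  -- kills every `z i`, hence all of the component of degree `p > 0`, which contains `a`.
  have hfreg : f ∈ nonZeroDivisors (Polynomial A) := by
    rw [Polynomial.mem_nonZeroDivisors_iff]
    intro c hc
    have hcz : ∀ i, c * z i = 0 := fun i => by
      have := congr_arg (fun g => Polynomial.coeff g i) hc
      simpa [hcoeff] using this
    apply ha
    rw [mul_comm]
    rw [IsStandardGraded.graded_eq_span hz hgen p] at hap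
    have hle : Submodule.span k (monomialValue z '' {α | ∑ i, α i = p}) ≤
        LinearMap.ker (LinearMap.mulLeft k c) := by
      rw [Submodule.span_le]
      rintro _ ⟨α, hα, rfl⟩
      obtain ⟨i, hi⟩ : ∃ i, α i ≠ 0 := by
        by_contra! h
        have hα' : ∑ i, α i = p := hα
        simp [h] at hα'
        omega
      rw [SetLike.mem_coe, LinearMap.mem_ker, LinearMap.mulLeft_apply]
      obtain ⟨y, hy⟩ : z i ∣ monomialValue z α :=
        (dvd_pow_self _ hi).trans (Finset.dvd_prod_of_mem _ (Finset.mem_univ i))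
      rw [hy, ← mul_assoc, hcz, zero_mul]
    exact hle hap
  have hfinW := F.finite_inf 𝒜 hA n (m + 1)
  have hfinV := F.finite_inf 𝒜 hA n m
  set V := (F.ideal n).restrictScalars k ⊓ 𝒜 m with hV
  set W := (F.ideal n).restrictScalars k ⊓ 𝒜 (m + 1) with hW
  have hzV : ∀ i, ∀ v ∈ V, f.coeff i * v ∈ W := by
    rintro i v ⟨hvn, hvm⟩
    rcases Nat.lt_or_ge i N with hi | hi
    · rw [hcoeff ⟨i, hi⟩, hW, add_comm]
      exact ⟨Ideal.mul_mem_left _ _ hvn, SetLike.mul_mem_graded (hz _) hvm⟩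
    · rw [hcoeff' i hi, zero_mul]
      exact zero_mem _
  -- Multiplication by `f` maps polynomials with `s` coefficients in `V` injectively to polynomials
  -- with `s + N` coefficients in `W`.
  have key : ∀ s : ℕ, s * Module.finrank k V ≤ (s + N) * Module.finrank k W := by
    intro s
    let P : (Fin s → V) →ₗ[k] Polynomial A :=
      ∑ j : Fin s, (Polynomial.monomial (R := A) (j : ℕ)).restrictScalars k ∘ₗ V.subtype ∘ₗ
        LinearMap.proj (R := k) (φ := fun _ : Fin s => V) j
    have hP : ∀ v (j : Fin s), (P v).coeff j = v j := by
      intro v j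
      simp only [P, LinearMap.sum_apply, LinearMap.comp_apply, LinearMap.restrictScalars_apply,
        Polynomial.finsetSum_coeff, Polynomial.coeff_monomial]
      rw [Finset.sum_eq_single j]
      · simp
      · intro i _ hi
        rw [if_neg fun h => hi (Fin.ext h)]
      · simp
    have hP' : ∀ v j, s ≤ j → (P v).coeff j = 0 := by
      intro v j hj
      simp only [P, LinearMap.sum_apply, LinearMap.comp_apply, LinearMap.restrictScalars_apply,
        Polynomial.finsetSum_coeff, Polynomial.coeff_monomial]
      refine Finset.sum_eq_zero fun i _ => if_neg ?_
      have := i.2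
      omega
    have hPV : ∀ v j, (P v).coeff j ∈ V := by
      intro v j
      rcases Nat.lt_or_ge j s with hj | hj
      · rw [hP v ⟨j, hj⟩]
        exact (v ⟨j, hj⟩).2
      · rw [hP' v j hj]
        exact zero_mem _
    let L : (Fin s → V) →ₗ[k] (Fin (s + N) → W) := LinearMap.pi fun t =>
      LinearMap.codRestrict W
        ((Polynomial.lcoeff A (t : ℕ)).restrictScalars k ∘ₗ LinearMap.mulLeft k f ∘ₗ P) (by
          intro v
          change (f * P v).coeff t ∈ W
          rw [Polynomial.coeff_mul]
          exact sum_mem fun x _ => hzV _ _ (hPV v _))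
    have hL : ∀ v t, (L v t : A) = (f * P v).coeff t := fun v t => rfl
    have hinj : Function.Injective L := by
      rw [← LinearMap.ker_eq_bot, LinearMap.ker_eq_bot']
      intro v hv
      have h0 : f * P v = 0 := by
        ext t
        rw [Polynomial.coeff_zero]
        rcases Nat.lt_or_ge t (s + N) with ht | ht
        · have := hL v ⟨t, ht⟩
          rw [hv] at this
          exact this.symm
        · rw [Polynomial.coeff_mul]
          refine Finset.sum_eq_zero fun x hx => ?_
          have hx' := Finset.HasAntidiagonal.mem_antidiagonal.1 hx
          rcases Nat.lt_or_ge x.1 N with h | h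
          · rw [hP' v x.2 (by omega), mul_zero]
          · rw [hcoeff' x.1 h, zero_mul]
      have h1 : P v = 0 := hfreg.1 _ h0
      funext j
      apply Subtype.ext
      rw [← hP, h1]
      rfl
    have := LinearMap.finrank_le_finrank_of_injective hinj
    simpa [Module.finrank_pi_fintype] using this
  change Module.finrank k V ≤ Module.finrank k W
  by_contra! hlt
  -- For this `s`, the inequality `s (dim W + 1) ≤ (s + N) dim W` would give `s ≤ N dim W`.
  have h1 := key (N * Module.finrank k W + 1)
  have h2 := Nat.mul_le_mul_left (N * Module.finrank k W + 1) (Nat.succ_le_of_lt hlt)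
  rw [Nat.succ_eq_add_one] at h2
  nlinarith

/-- Every ideal of the filtration contains a power of `a`, which annihilates only 0; so `H0` is
zero. -/
theorem dim_eq {F : IdealFiltration A} {D : ℕ} (hD : ringKrullDim A = D) {a : A} {q : ℕ}
    (hq : 0 < q) (haq : a ∈ F.ideal q) (ha : ∀ x, a * x = 0 → x = 0) : F.dim = D := by
  have hpow : ∀ (n : ℕ) (x : A), a ^ n * x = 0 → x = 0 := by
    intro n
    induction n with
    | zero => intro x hx; simpa using hx
    | succ n ih => intro x hx; exact ha x (ih _ (by rwa [pow_succ, mul_assoc] at hx))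
  have h0 : F.H0 = ⊥ := by
    rw [eq_bot_iff]
    rintro x ⟨n, hn⟩
    exact hpow n x (hn _ (F.antitone (Nat.le_mul_of_pos_right n hq) (F.pow_mem haq n)))
  rw [dim, h0, ringKrullDim_eq_of_ringEquiv (RingEquiv.quotientBot A), hD]
  rfl

/-- If `p = 0`, then `a` is a scalar and all the ideals are `A`; there the Hilbert function is only
known to be monotone eventually, whence the bound `M`. If `p > 0`, monotonicity holds from degree 0
on. -/
theorem exists_len_mono (hA : IsStandardGraded 𝒜) {D : ℕ} (hD : ringKrullDim A = D) (hD1 : 1 ≤ D)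
    {a : A} {p q : ℕ} (hq : 0 < q) (hap : a ∈ 𝒜 p) (haq : a ∈ F.ideal q)
    (ha : ∀ x, a * x = 0 → x = 0) :
    ∃ M, ∀ m, M ≤ m → ∀ n, F.len 𝒜 n m ≤ F.len 𝒜 n (m + 1) := by
  rcases Nat.eq_zero_or_pos p with rfl | hp
  · have htop : ∀ n, F.ideal n = ⊤ := by
      intro n
      rw [hA.degree_zero] at hap
      obtain ⟨c, rfl⟩ := hap
      by_cases hc : c = 0
      · have h1 : (1 : A) = 0 := ha 1 (by simp [hc])
        rw [Ideal.eq_top_iff_one, h1]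
        exact zero_mem _
      · have hu : IsUnit (Algebra.linearMap k A c) := (IsUnit.mk0 c hc).map (algebraMap k A)
        exact Ideal.eq_top_of_isUnit_mem _
          (F.antitone (Nat.le_mul_of_pos_right n hq) (F.pow_mem haq n)) (hu.pow n)
    obtain ⟨-, -, M, -, -, -, -, hM⟩ := hA.exists_hilbert_bounds hD hD1
    refine ⟨M, fun m hm n => ?_⟩
    rw [F.len_eq_finrank (htop n), F.len_eq_finrank (htop n)]
    exact hM m hm
  · exact ⟨0, fun m _ n => F.len_le_len_succ hA hp hap ha n m⟩

end Length

end IdealFiltration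

end ReesGenerators

/-! ### From polynomials in (m, n) to polynomials in the slope -/

section ChamberLimit

open Filter Topology

theorem tendsto_div_of_abs_sub_le {u v w : ℕ → ℝ} {B x : ℝ} (hw : Tendsto w atTop atTop)
    (h : ∀ n, |u n - v n| ≤ B) (hv : Tendsto (fun n => v n / w n) atTop (𝓝 x)) :
    Tendsto (fun n => u n / w n) atTop (𝓝 x) := by
  have h0 : Tendsto (fun n => (u n - v n) / w n) atTop (𝓝 0) := by
    refine squeeze_zero_norm' ?_ ((tendsto_const_nhds (x := B)).div_atTop hw)
    filter_upwards [hw.eventually_gt_atTop 0] with n hn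
    rw [Real.norm_eq_abs, abs_div, abs_of_pos hn]
    gcongr
    exact h n
  have := h0.add hv
  rw [zero_add] at this
  refine this.congr fun n => ?_
  rw [← add_div, sub_add_cancel]

/-- The leading term of `∑ b ^ t * q_t (a / b)`. -/
theorem tendsto_sum_pow_mul_aeval_div {q : ℕ → Polynomial ℚ} {T : ℕ} {a b : ℕ → ℝ} {x : ℝ}
    (hb : Tendsto b atTop atTop) (hab : Tendsto (fun n => a n / b n) atTop (𝓝 x)) :
    Tendsto (fun n => (∑ t ∈ Finset.range (T + 1), b n ^ t * Polynomial.aeval (a n / b n) (q t)) /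
      b n ^ T) atTop (𝓝 (Polynomial.aeval x (q T))) := by
  have hterm : ∀ t ∈ Finset.range (T + 1),
      Tendsto (fun n => b n ^ t / b n ^ T * Polynomial.aeval (a n / b n) (q t)) atTop
        (𝓝 ((if t = T then 1 else 0) * Polynomial.aeval x (q t))) := by
    intro t ht
    refine Tendsto.mul ?_ (((q t).continuous_aeval.tendsto x).comp hab)
    split_ifs with h
    · subst h
      refine tendsto_const_nhds.congr' ?_
      filter_upwards [hb.eventually_gt_atTop 0] with n hn
      rw [div_self (pow_pos hn _).ne']
    · have hlt : t < T := by
        have := Finset.mem_range.1 ht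
        omega
      exact (tendsto_pow_div_pow_atTop_zero hlt).comp hb
  have h := tendsto_finsetSum _ hterm
  simp only [ite_mul, one_mul, zero_mul] at h
  rw [Finset.sum_ite_eq' _ T (fun t => Polynomial.aeval x (q t)),
    if_pos (Finset.self_mem_range_succ T)] at h
  refine h.congr fun n => ?_
  rw [Finset.sum_div]
  exact Finset.sum_congr rfl fun t _ => by ring

/-- Here `q t` is the homogeneous part of degree `t`, dehomogenised with respect to the second
variable. -/
theorem MvPolynomial.exists_eval_eq_sum_pow_mul_eval_div (P : MvPolynomial (Fin 2) ℚ) :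
    ∃ q : ℕ → Polynomial ℚ, (∀ t, (q t).natDegree ≤ t) ∧ ∀ T, P.totalDegree ≤ T →
      ∀ a b : ℚ, b ≠ 0 → MvPolynomial.eval ![a, b] P =
        ∑ t ∈ Finset.range (T + 1), b ^ t * (q t).eval (a / b) := by
  refine ⟨fun t => ∑ m ∈ P.support with m.degree = t,
    Polynomial.C (P.coeff m) * Polynomial.X ^ m 0, fun t => ?_, fun T hT a b hb => ?_⟩
  · refine Polynomial.natDegree_sum_le_of_forall_le _ _ fun m hm => ?_
    refine (Polynomial.natDegree_C_mul_X_pow_le _ _).trans ?_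
    rw [← (Finset.mem_filter.1 hm).2]
    exact Finsupp.le_degree 0 m
  · rw [MvPolynomial.eval_eq']
    rw [← Finset.sum_fiberwise_of_maps_to (s := P.support) (t := Finset.range (T + 1))
      (g := fun m => m.degree) fun m hm => Finset.mem_range.2 (Nat.lt_succ_of_le
        ((MvPolynomial.le_totalDegree hm).trans hT))]
    refine Finset.sum_congr rfl fun t _ => ?_
    rw [Polynomial.eval_finsetSum, Finset.mul_sum]
    refine Finset.sum_congr rfl fun m hm => ?_
    have hdeg : m 0 + m 1 = t := by
      rw [← (Finset.mem_filter.1 hm).2, Finsupp.degree_eq_sum, Fin.sum_univ_two]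
    rw [Fin.prod_univ_two, ← hdeg]
    simp only [Matrix.cons_val_zero, Matrix.cons_val_one, Polynomial.eval_mul, Polynomial.eval_C,
      Polynomial.eval_pow, Polynomial.eval_X, div_pow]
    field_simp
    rw [pow_add]
    ring

theorem tendsto_floor_mul_div {x : ℝ} (hx : 0 ≤ x) :
    Tendsto (fun n : ℕ => (⌊x * n⌋₊ : ℝ) / (n : ℝ)) atTop (𝓝 x) :=
  (tendsto_nat_floor_mul_div_atTop hx).comp tendsto_natCast_atTop_atTop

/-- A function on `ℕ²` that is polynomial deep inside a cone and has order at most `E` has a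
polynomial leading term. -/
theorem exists_leading_polynomial {G : ℕ → ℕ → ℝ} {E : ℕ} {C : ℝ}
    (hG : ∀ n m, 0 ≤ G n m ∧ G n m ≤ C * ((m : ℝ) + 1) ^ E) {P : MvPolynomial (Fin 2) ℚ} {K : ℤ}
    {v v' : Fin 2 →₀ ℕ} (hdet : 0 < slopeDet v v')
    (hP : ∀ u : Fin 2 →₀ ℕ, K ≤ slopeDet u v' → K ≤ slopeDet v u →
      G (u 1) (u 0) = (MvPolynomial.eval (fun i => (u i : ℚ)) P : ℚ)) :
    ∃ q : Polynomial ℚ, q.natDegree ≤ E ∧ ∀ (a b : ℕ → ℕ) (x : ℝ),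
      Tendsto b atTop atTop → Tendsto (fun n => (a n : ℝ) / b n) atTop (𝓝 x) →
      (v 0 : ℝ) < v 1 * x → v' 1 * x < (v' 0 : ℝ) →
      Tendsto (fun n => G (b n) (a n) / (b n : ℝ) ^ E) atTop (𝓝 (Polynomial.aeval x q)) := by
  obtain ⟨q, hdeg, hq⟩ := P.exists_eval_eq_sum_pow_mul_eval_div
  have hdeep : ∀ (a b : ℕ → ℕ) (x : ℝ), Tendsto b atTop atTop →
      Tendsto (fun n => (a n : ℝ) / b n) atTop (𝓝 x) → (v 0 : ℝ) < v 1 * x →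
      v' 1 * x < (v' 0 : ℝ) →
      ∀ᶠ n in atTop, 0 < b n ∧ K ≤ slopeDet (bidegree (a n) (b n)) v' ∧
        K ≤ slopeDet v (bidegree (a n) (b n)) := by
    intro a b x hb hab h1 h2
    have hbR : Tendsto (fun n => (b n : ℝ)) atTop atTop := tendsto_natCast_atTop_atTop.comp hb
    have t1 : Tendsto (fun n => ((v' 0 : ℝ) - v' 1 * ((a n : ℝ) / b n)) * b n) atTop atTop :=
      Tendsto.pos_mul_atTop (C := (v' 0 : ℝ) - v' 1 * x) (by linarith)
        (tendsto_const_nhds.sub (tendsto_const_nhds.mul hab)) hbR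
    have t2 : Tendsto (fun n => ((v 1 : ℝ) * ((a n : ℝ) / b n) - v 0) * b n) atTop atTop :=
      Tendsto.pos_mul_atTop (C := (v 1 : ℝ) * x - v 0) (by linarith)
        ((tendsto_const_nhds.mul hab).sub tendsto_const_nhds) hbR
    filter_upwards [hb.eventually_gt_atTop 0, t1.eventually_ge_atTop (K : ℝ),
      t2.eventually_ge_atTop (K : ℝ)] with n hn e1 e2
    have hbn : (b n : ℝ) ≠ 0 := by exact_mod_cast hn.ne'
    refine ⟨hn, ?_, ?_⟩
    · have : ((v' 0 : ℝ) - v' 1 * ((a n : ℝ) / b n)) * b n =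
          ((slopeDet (bidegree (a n) (b n)) v' : ℤ) : ℝ) := by
        simp only [slopeDet, bidegree_zero, bidegree_one]
        push_cast
        field_simp
      rw [this] at e1
      exact_mod_cast e1
    · have : ((v 1 : ℝ) * ((a n : ℝ) / b n) - v 0) * b n =
          ((slopeDet v (bidegree (a n) (b n)) : ℤ) : ℝ) := by
        simp only [slopeDet, bidegree_zero, bidegree_one]
        push_cast
        field_simp
      rw [this] at e2
      exact_mod_cast e2
  have hrep : ∀ T, P.totalDegree ≤ T → ∀ a b : ℕ, 0 < b → K ≤ slopeDet (bidegree a b) v' →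
      K ≤ slopeDet v (bidegree a b) → G b a = ∑ t ∈ Finset.range (T + 1),
        (b : ℝ) ^ t * Polynomial.aeval ((a : ℝ) / b) (q t) := by
    intro T hT a b hb h1 h2
    have h := hP (bidegree a b) h1 h2
    rw [bidegree_zero, bidegree_one] at h
    have hfun : (fun i => ((bidegree a b) i : ℚ)) = ![(a : ℚ), (b : ℚ)] := by
      funext i
      fin_cases i <;> rfl
    rw [h, hfun, hq T hT _ _ (by exact_mod_cast hb.ne')]
    push_cast
    refine Finset.sum_congr rfl fun t _ => ?_
    congr 1
    rw [← Polynomial.coe_aeval_eq_eval]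
    have := Polynomial.aeval_algebraMap_apply ℝ ((a : ℚ) / b) (q t)
    simpa using this.symm
  -- Descending induction removes the forms of degree above `E`. If `E + k + 1` is the top degree,
  -- dividing by `b ^ (E + k + 1)` has limit `q (E + k + 1)` at the slope, while the bound on `G`
  -- makes the limit 0. This polynomial vanishes on an interval of slopes, so it is 0.
  have hvanish : ∀ k : ℕ, (∀ a b : ℕ, 0 < b → K ≤ slopeDet (bidegree a b) v' →
      K ≤ slopeDet v (bidegree a b) → G b a = ∑ t ∈ Finset.range (E + k + 1),
        (b : ℝ) ^ t * Polynomial.aeval ((a : ℝ) / b) (q t)) →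
      ∀ a b : ℕ, 0 < b → K ≤ slopeDet (bidegree a b) v' →
      K ≤ slopeDet v (bidegree a b) → G b a = ∑ t ∈ Finset.range (E + 1),
        (b : ℝ) ^ t * Polynomial.aeval ((a : ℝ) / b) (q t) := by
    intro k
    induction k with
    | zero => exact fun h => h
    | succ k ih =>
      intro h
      rw [← add_assoc E k 1] at h
      have hroot : ∀ x : ℝ, (v 0 : ℝ) < v 1 * x → v' 1 * x < (v' 0 : ℝ) →
          Polynomial.aeval x (q (E + k + 1)) = 0 := by
        intro x h1 h2
        have hx : 0 ≤ x := by
          by_contra! hneg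
          have : (v 1 : ℝ) * x ≤ 0 := mul_nonpos_of_nonneg_of_nonpos (Nat.cast_nonneg _) hneg.le
          linarith [(v 0).cast_nonneg (α := ℝ)]
        have hlim := tendsto_floor_mul_div hx
        have hev := hdeep (fun n => ⌊x * n⌋₊) (fun n => n) x tendsto_id hlim h1 h2
        have hT := tendsto_sum_pow_mul_aeval_div (q := q) (T := E + k + 1)
          (tendsto_natCast_atTop_atTop (R := ℝ)) hlim
        refine tendsto_nhds_unique hT ?_
        have hC : Tendsto (fun n : ℕ => C * ((⌊x * n⌋₊ : ℝ) / n + 1 / n) ^ E *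
            (1 / (n : ℝ) ^ (k + 1))) atTop (𝓝 (C * (x + 0) ^ E * 0)) := by
          refine (tendsto_const_nhds.mul ((hlim.add ?_).pow E)).mul ?_
          · exact tendsto_one_div_atTop_nhds_zero_nat
          · have := (tendsto_pow_div_pow_atTop_zero (𝕜 := ℝ) (Nat.succ_pos k)).comp
              (tendsto_natCast_atTop_atTop (R := ℝ))
            simpa [Function.comp_def] using this
        rw [mul_zero] at hC
        refine squeeze_zero' ?_ ?_ hC
        · filter_upwards [hev] with n hn
          rw [← h _ _ hn.1 hn.2.1 hn.2.2]
          exact div_nonneg (hG _ _).1 (by positivity)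
        · filter_upwards [hev] with n hn
          rw [← h _ _ hn.1 hn.2.1 hn.2.2]
          have hn0 : (0 : ℝ) < n := by exact_mod_cast hn.1
          refine (div_le_div_of_nonneg_right (hG _ _).2 (by positivity)).trans (le_of_eq ?_)
          rw [← add_div, div_pow, add_assoc, pow_add _ E (k + 1)]
          field_simp
      have hzero : q (E + k + 1) = 0 := by
        by_contra hne
        have hmap : (q (E + k + 1)).map (algebraMap ℚ ℝ) ≠ 0 :=
          (Polynomial.map_ne_zero_iff (algebraMap ℚ ℝ).injective).2 hne
        obtain ⟨x₀, y₀, hxy, hsub⟩ : ∃ x₀ y₀ : ℝ, x₀ < y₀ ∧ ∀ x ∈ Set.Ioo x₀ y₀,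
            (v 0 : ℝ) < v 1 * x ∧ v' 1 * x < (v' 0 : ℝ) := by
          have hdet' : (v 0 : ℝ) * v' 1 < v 1 * v' 0 := by
            have : (v 0 : ℤ) * v' 1 < v 1 * v' 0 := by
              rw [slopeDet] at hdet
              linarith
            exact_mod_cast this
          have hv1 : (0 : ℝ) < v 1 := by
            rcases (v 1).eq_zero_or_pos with h0 | h0
            · rw [h0] at hdet'
              have : (0 : ℝ) ≤ (v 0 : ℝ) * v' 1 := by positivity
              simp at hdet'
              linarith
            · exact_mod_cast h0
          -- When `v' 1 = 0` the right wall has infinite slope, and any interval to the right of `v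
          -- 0 / v 1` will do.
          rcases (v' 1).eq_zero_or_pos with h0 | h0
          · have hv'0 : (0 : ℝ) < v' 0 := by
              rw [h0] at hdet'
              simp only [Nat.cast_zero, mul_zero] at hdet'
              exact pos_of_mul_pos_right hdet' hv1.le
            refine ⟨v 0 / v 1, v 0 / v 1 + 1, by linarith, fun x hx => ⟨?_, ?_⟩⟩
            · have := (div_lt_iff₀ hv1).1 hx.1
              linarith
            · rw [h0]
              simpa using hv'0
          · have h0' : (0 : ℝ) < v' 1 := by exact_mod_cast h0
            refine ⟨v 0 / v 1, v' 0 / v' 1, ?_, fun x hx => ⟨?_, ?_⟩⟩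
            · rw [div_lt_div_iff₀ hv1 h0']
              linarith
            · have := (div_lt_iff₀ hv1).1 hx.1
              linarith
            · have := (lt_div_iff₀ h0').1 hx.2
              linarith
        refine hmap (Polynomial.eq_zero_of_infinite_isRoot _
          ((Set.Ioo_infinite hxy).mono fun x hx => ?_))
        have := hroot x (hsub x hx).1 (hsub x hx).2
        rwa [← Polynomial.eval_map_algebraMap] at this
      refine ih fun a b hb h1 h2 => ?_
      rw [h a b hb h1 h2, Finset.sum_range_succ, hzero]
      simp
  refine ⟨q E, hdeg E, fun a b x hb hab h1 h2 => ?_⟩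
  have hfinal := hvanish P.totalDegree (hrep (E + P.totalDegree) (Nat.le_add_left _ _))
  refine (tendsto_sum_pow_mul_aeval_div (q := q) (T := E)
    (tendsto_natCast_atTop_atTop.comp hb) hab).congr' ?_
  filter_upwards [hdeep a b x hb hab h1 h2] with n hn
  rw [hfinal _ _ hn.1 hn.2.1 hn.2.2]
  rfl

end ChamberLimit

/-! ### Leading terms along rays: dilation, walls and gluing -/

section LeadingTerm

open Filter Topology

/-- `g` is the leading term, of order `E`, of `H` along all sequences of slope in `U`. -/
def HasLeadingTerm (H : ℕ → ℕ → ℝ) (E : ℕ) (g : ℝ → ℝ) (U : Set ℝ) : Prop :=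
  ∀ x ∈ U, ∀ a b : ℕ → ℕ, Tendsto b atTop atTop →
    Tendsto (fun n => (a n : ℝ) / b n) atTop (𝓝 x) →
    Tendsto (fun n => H (b n) (a n) / (b n : ℝ) ^ E) atTop (𝓝 (g x))

theorem HasLeadingTerm.tendsto_floor {H : ℕ → ℕ → ℝ} {E : ℕ} {g : ℝ → ℝ} {U : Set ℝ}
    (h : HasLeadingTerm H E g U) {x : ℝ} (hx : x ∈ U) (hx0 : 0 ≤ x) :
    Tendsto (fun n : ℕ => H n ⌊x * n⌋₊ / (n : ℝ) ^ E) atTop (𝓝 (g x)) :=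
  h x hx (fun n => ⌊x * n⌋₊) (fun n => n) tendsto_id (tendsto_floor_mul_div hx0)

theorem tendsto_atTop_of_tendsto_div {a b : ℕ → ℕ} {x : ℝ} (hx : 0 < x) (hb : Tendsto b atTop atTop)
    (hab : Tendsto (fun n => (a n : ℝ) / b n) atTop (𝓝 x)) : Tendsto a atTop atTop := by
  have hbR : Tendsto (fun n => (b n : ℝ)) atTop atTop := tendsto_natCast_atTop_atTop.comp hb
  rw [← tendsto_natCast_atTop_iff (R := ℝ)]
  refine (hab.pos_mul_atTop hx hbR).congr' ?_
  filter_upwards [hb.eventually_gt_atTop 0] with n hn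
  have : (b n : ℝ) ≠ 0 := by exact_mod_cast hn.ne'
  field_simp

theorem le_of_antitone_of_monotone {H : ℕ → ℕ → ℝ} (h1 : ∀ n m, H (n + 1) m ≤ H n m) {M₀ : ℕ}
    (h2 : ∀ m, M₀ ≤ m → ∀ n, H n m ≤ H n (m + 1)) {n n' m m' : ℕ} (hn : n' ≤ n) (hm : m ≤ m')
    (hm0 : M₀ ≤ m) : H n m ≤ H n' m' :=
  (antitone_nat_of_succ_le (f := fun n => H n m) (fun n => h1 n m) hn).trans
    (Nat.le_induction (P := fun m' _ => H n' m ≤ H n' m') le_rfl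
      (fun k hk ih => ih.trans (h2 k (hm0.trans hk) n')) m' hm)

/-- The leading term of `H` is determined by that of a dilation of `H`. -/
theorem hasLeadingTerm_of_dilation {H : ℕ → ℕ → ℝ} (h1 : ∀ n m, H (n + 1) m ≤ H n m) {M₀ : ℕ}
    (h2 : ∀ m, M₀ ≤ m → ∀ n, H n m ≤ H n (m + 1)) {E Δ : ℕ} (hΔ : 0 < Δ) {g : ℝ → ℝ} {U : Set ℝ}
    (hU : ∀ x ∈ U, 0 < x) (hg : HasLeadingTerm (fun n m => H (Δ * n) (Δ * m)) E g U) :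
    HasLeadingTerm H E (fun x => g x / (Δ : ℝ) ^ E) U := by
  intro x hx a b hb hab
  have hΔR : (0 : ℝ) < Δ := by exact_mod_cast hΔ
  have hbR : Tendsto (fun n => (b n : ℝ)) atTop atTop := tendsto_natCast_atTop_atTop.comp hb
  have hb0 : ∀ᶠ n in atTop, (b n : ℝ) ≠ 0 := hbR.eventually_ne_atTop 0
  have key : ∀ a' b' : ℕ → ℕ, (∀ n, |(Δ : ℝ) * a' n - a n| ≤ Δ) →
      (∀ n, |(Δ : ℝ) * b' n - b n| ≤ Δ) →
      Tendsto (fun n => H (Δ * b' n) (Δ * a' n) / (b n : ℝ) ^ E) atTop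
        (𝓝 (g x / (Δ : ℝ) ^ E)) := by
    intro a' b' ha' hb'
    have ta : Tendsto (fun n => (a' n : ℝ) / b n) atTop (𝓝 (x / Δ)) := by
      refine ((tendsto_div_of_abs_sub_le hbR ha' hab).div_const (Δ : ℝ)).congr fun n => ?_
      field_simp
    have tb : Tendsto (fun n => (b' n : ℝ) / b n) atTop (𝓝 (1 / Δ)) := by
      refine ((tendsto_div_of_abs_sub_le hbR hb' (x := 1) ?_).div_const (Δ : ℝ)).congr
        fun n => ?_
      · refine tendsto_const_nhds.congr' ?_
        filter_upwards [hb0] with n hn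
        rw [div_self hn]
      · field_simp
    have tb' : Tendsto b' atTop atTop := tendsto_atTop_of_tendsto_div (by positivity) hb tb
    have tab : Tendsto (fun n => (a' n : ℝ) / b' n) atTop (𝓝 x) := by
      have := ta.div tb (by positivity)
      have hxx : x / Δ / (1 / Δ) = x := by field_simp
      rw [hxx] at this
      refine this.congr' ?_
      filter_upwards [hb0] with n hn
      rw [Pi.div_apply, div_div_div_cancel_right₀ hn]
    have := (hg x hx a' b' tb' tab).mul (tb.pow E)
    rw [div_pow, one_pow, mul_one_div] at this
    refine this.congr' ?_
    filter_upwards [hb0, tb'.eventually_gt_atTop 0] with n hn hn'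
    have : (b' n : ℝ) ≠ 0 := by exact_mod_cast hn'.ne'
    rw [div_pow]
    field_simp
  have hdm : ∀ t : ℕ, (Δ : ℝ) * (t / Δ : ℕ) ≤ t ∧ (t : ℝ) ≤ Δ * (t / Δ : ℕ) + Δ := by
    intro t
    constructor
    · exact_mod_cast Nat.mul_div_le t Δ
    · exact_mod_cast (Nat.lt_mul_div_succ t hΔ).le
  have hlow : ∀ t : ℕ, |(Δ : ℝ) * (t / Δ : ℕ) - t| ≤ Δ := fun t => by
    rw [abs_le]
    constructor <;> linarith [(hdm t).1, (hdm t).2]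
  have hupp : ∀ t : ℕ, |(Δ : ℝ) * (t / Δ + 1 : ℕ) - t| ≤ Δ := fun t => by
    push_cast
    rw [abs_le]
    constructor <;> linarith [(hdm t).1, (hdm t).2]
  have ha : Tendsto a atTop atTop := tendsto_atTop_of_tendsto_div (hU x hx) hb hab
  -- `H` decreases in `n` and increases in `m`. Rounding `m` down and `n` up to multiples of `Δ`
  -- bounds it below, the opposite rounding bounds it above, and neither changes the limiting slope.
  -- The lower bound needs `M₀ + Δ` so that the rounded `m` is still at least `M₀`.
  refine tendsto_of_tendsto_of_tendsto_of_le_of_le'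
    (key (fun n => a n / Δ) (fun n => b n / Δ + 1) (fun n => hlow _) fun n => hupp _)
    (key (fun n => a n / Δ + 1) (fun n => b n / Δ) (fun n => hupp _) fun n => hlow _) ?_ ?_
  · filter_upwards [ha.eventually_ge_atTop (M₀ + Δ)] with n hn
    refine div_le_div_of_nonneg_right ?_ (by positivity)
    refine le_of_antitone_of_monotone h1 h2 (Nat.lt_mul_div_succ _ hΔ).le (Nat.mul_div_le _ _) ?_
    have := Nat.lt_mul_div_succ (a n) hΔ
    rw [mul_add, mul_one] at this
    omega
  · filter_upwards [ha.eventually_ge_atTop M₀] with n hn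
    refine div_le_div_of_nonneg_right ?_ (by positivity)
    exact le_of_antitone_of_monotone h1 h2 (Nat.mul_div_le _ _) (Nat.lt_mul_div_succ _ hΔ).le hn

theorem HasLeadingTerm.le_of_lt {H : ℕ → ℕ → ℝ} {M₀ : ℕ}
    (h1 : ∀ n m, H (n + 1) m ≤ H n m)
    (h2 : ∀ m, M₀ ≤ m → ∀ n, H n m ≤ H n (m + 1)) {E : ℕ} {f f' : ℝ → ℝ} {U U' : Set ℝ}
    (hf : HasLeadingTerm H E f U) (hf' : HasLeadingTerm H E f' U') {x y : ℝ} (hx : x ∈ U)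
    (hy : y ∈ U') (hx0 : 0 < x) (hxy : x ≤ y) : f x ≤ f' y := by
  refine le_of_tendsto_of_tendsto (hf.tendsto_floor hx hx0.le)
    (hf'.tendsto_floor hy (hx0.le.trans hxy)) ?_
  have := tendsto_atTop_of_tendsto_div hx0 tendsto_id (tendsto_floor_mul_div hx0.le)
  filter_upwards [this.eventually_ge_atTop M₀] with n hn
  refine div_le_div_of_nonneg_right ?_ (by positivity)
  exact le_of_antitone_of_monotone h1 h2 le_rfl (Nat.floor_mono (by gcongr)) hn

/-- With about `σ n / q` shifts, the point `(n, x n)` moves to `((1 + σ) n, (x + σ p / q) n)`. Its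
slope is pulled towards `p / q`, and the change in the first coordinate costs the factor `(1 + σ) ^
E`. -/
theorem HasLeadingTerm.le_mul_of_shift {H : ℕ → ℕ → ℝ} {p q : ℕ} (hq : 0 < q)
    (h3 : ∀ s n m, H n m ≤ H (n + s * q) (m + s * p)) {E : ℕ} {f f' : ℝ → ℝ} {U U' : Set ℝ}
    (hf : HasLeadingTerm H E f U) (hf' : HasLeadingTerm H E f' U') {x σ : ℝ} (hx : x ∈ U')
    (hx0 : 0 ≤ x) (hσ : 0 ≤ σ) (hy : (x + σ * (p / q)) / (1 + σ) ∈ U) :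
    f' x ≤ f ((x + σ * (p / q)) / (1 + σ)) * (1 + σ) ^ E := by
  have hqR : (0 : ℝ) < q := by exact_mod_cast hq
  set s : ℕ → ℕ := fun n => ⌊σ / q * n⌋₊ with hs
  have ts : Tendsto (fun n : ℕ => (s n : ℝ) / n) atTop (𝓝 (σ / q)) :=
    tendsto_floor_mul_div (by positivity)
  have hn0 : ∀ᶠ n : ℕ in atTop, (n : ℝ) ≠ 0 := tendsto_natCast_atTop_atTop.eventually_ne_atTop 0
  have tN : Tendsto (fun n : ℕ => ((n + s n * q : ℕ) : ℝ) / n) atTop (𝓝 (1 + σ)) := by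
    have := (tendsto_const_nhds (x := (1 : ℝ))).add (ts.mul_const (q : ℝ))
    rw [div_mul_cancel₀ _ hqR.ne'] at this
    refine this.congr' ?_
    filter_upwards [hn0] with n hn
    push_cast
    field_simp
  have tm : Tendsto (fun n : ℕ => ((⌊x * n⌋₊ + s n * p : ℕ) : ℝ) / n) atTop
      (𝓝 (x + σ * (p / q))) := by
    have := (tendsto_floor_mul_div hx0).add (ts.mul_const (p : ℝ))
    rw [div_mul_eq_mul_div, mul_div_assoc] at this
    refine this.congr fun n => ?_
    push_cast
    ring
  have tN' : Tendsto (fun n => n + s n * q) atTop atTop :=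
    tendsto_atTop_mono (fun n => Nat.le_add_right _ _) tendsto_id
  have tmN : Tendsto (fun n : ℕ => ((⌊x * n⌋₊ + s n * p : ℕ) : ℝ) / (n + s n * q : ℕ)) atTop
      (𝓝 ((x + σ * (p / q)) / (1 + σ))) := by
    refine (tm.div tN (by positivity)).congr' ?_
    filter_upwards [hn0] with n hn
    rw [Pi.div_apply, div_div_div_cancel_right₀ hn]
  refine le_of_tendsto_of_tendsto (hf'.tendsto_floor hx hx0)
    ((hf _ hy _ _ tN' tmN).mul (tN.pow E)) ?_
  filter_upwards [hn0] with n hn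
  have hN : ((n + s n * q : ℕ) : ℝ) ≠ 0 := by
    have : n ≠ 0 := by exact_mod_cast hn
    exact_mod_cast (by omega : n + s n * q ≠ 0)
  rw [div_pow, div_mul_div_cancel₀ (pow_ne_zero _ hN)]
  exact div_le_div_of_nonneg_right (h3 _ _ _) (by positivity)

/-- Monotonicity in `m` compares slopes left and right of `β` and gives `≤`. For `≥`, shifts carry
slopes slightly above `β` to slopes slightly below, which is possible because `β > p / q`. -/
theorem HasLeadingTerm.eq_at_wall {H : ℕ → ℕ → ℝ} {M₀ p q : ℕ} (hq : 0 < q)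
    (h1 : ∀ n m, H (n + 1) m ≤ H n m)
    (h2 : ∀ m, M₀ ≤ m → ∀ n, H n m ≤ H n (m + 1))
    (h3 : ∀ s n m, H n m ≤ H (n + s * q) (m + s * p)) {E : ℕ} {f f' : ℝ → ℝ} {U U' : Set ℝ}
    (hf : HasLeadingTerm H E f U) (hf' : HasLeadingTerm H E f' U') (hfc : Continuous f)
    (hfc' : Continuous f') {β : ℝ} (hβ : (p : ℝ) / q < β) (hU : U ∈ 𝓝[<] β) (hU' : U' ∈ 𝓝[>] β) :
    f β = f' β := by
  have hβ0 : 0 < β := lt_of_le_of_lt (by positivity) hβ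
  apply le_antisymm
  · have t1 : Tendsto (fun ε : ℝ => β - ε) (𝓝[>] (0 : ℝ)) (𝓝[<] β) := by
      refine tendsto_nhdsWithin_iff.2 ⟨?_, ?_⟩
      · refine Tendsto.mono_left ?_ nhdsWithin_le_nhds
        exact (by fun_prop : Continuous fun ε : ℝ => β - ε).tendsto' _ _ (by simp)
      · filter_upwards [self_mem_nhdsWithin] with ε hε
        exact sub_lt_self _ (Set.mem_Ioi.1 hε)
    have t2 : Tendsto (fun ε : ℝ => β + ε) (𝓝[>] (0 : ℝ)) (𝓝[>] β) := by
      refine tendsto_nhdsWithin_iff.2 ⟨?_, ?_⟩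
      · refine Tendsto.mono_left ?_ nhdsWithin_le_nhds
        exact (by fun_prop : Continuous fun ε : ℝ => β + ε).tendsto' _ _ (by simp)
      · filter_upwards [self_mem_nhdsWithin] with ε hε
        exact lt_add_of_pos_right _ (Set.mem_Ioi.1 hε)
    have ht1 := t1.mono_right (nhdsWithin_le_nhds (s := Set.Iio β))
    refine le_of_tendsto_of_tendsto ((hfc.tendsto β).comp ht1)
      ((hfc'.tendsto β).comp (t2.mono_right nhdsWithin_le_nhds)) ?_
    filter_upwards [t1.eventually hU, t2.eventually hU', self_mem_nhdsWithin,
      ht1.eventually_const_lt hβ0] with ε e1 e2 e3 e4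
    have : (0 : ℝ) < ε := e3
    exact hf.le_of_lt h1 h2 hf' e1 e2 e4 (by linarith)
  -- The starting slope `β + σ γ / 2` is chosen so that the shift with parameter `σ` overshoots the
  -- wall, landing at `β - σ γ / 2 / (1 + σ)`. As `σ` tends to 0, both slopes tend to `β` and the
  -- factor tends to 1.
  · set γ := β - p / q with hγ
    have hγ0 : 0 < γ := sub_pos.2 hβ
    have e : ∀ σ : ℝ, 0 < σ → (β + σ * γ / 2 + σ * (p / q)) / (1 + σ) =
        β - σ * γ / 2 / (1 + σ) := by
      intro σ hσ
      have h1σ : (1 + σ) ≠ 0 := by positivity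
      rw [hγ]
      field_simp
      ring
    have t1 : Tendsto (fun σ : ℝ => β - σ * γ / 2 / (1 + σ)) (𝓝[>] (0 : ℝ)) (𝓝[<] β) := by
      refine tendsto_nhdsWithin_iff.2 ⟨?_, ?_⟩
      · refine Tendsto.mono_left ?_ nhdsWithin_le_nhds
        have : ContinuousAt (fun σ : ℝ => β - σ * γ / 2 / (1 + σ)) (0 : ℝ) := by
          refine continuousAt_const.sub (ContinuousAt.div ?_ ?_ (by norm_num))
          · fun_prop
          · fun_prop
        simpa [ContinuousAt] using this
      · filter_upwards [self_mem_nhdsWithin] with σ hσ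
        rw [Set.mem_Ioi] at hσ
        rw [Set.mem_Iio]
        exact sub_lt_self _ (by positivity)
    have t2 : Tendsto (fun σ : ℝ => β + σ * γ / 2) (𝓝[>] (0 : ℝ)) (𝓝[>] β) := by
      refine tendsto_nhdsWithin_iff.2 ⟨?_, ?_⟩
      · refine Tendsto.mono_left ?_ nhdsWithin_le_nhds
        exact (by fun_prop : Continuous fun σ : ℝ => β + σ * γ / 2).tendsto' _ _ (by simp)
      · filter_upwards [self_mem_nhdsWithin] with σ hσ
        rw [Set.mem_Ioi] at hσ ⊢
        exact lt_add_of_pos_right _ (by positivity)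
    have t3 : Tendsto (fun σ : ℝ => (1 + σ) ^ E) (𝓝[>] (0 : ℝ)) (𝓝 1) := by
      refine Tendsto.mono_left ?_ nhdsWithin_le_nhds
      exact (by fun_prop : Continuous fun σ : ℝ => (1 + σ) ^ E).tendsto' _ _ (by simp)
    have := ((hfc.tendsto β).comp (t1.mono_right nhdsWithin_le_nhds)).mul t3
    rw [mul_one] at this
    refine le_of_tendsto_of_tendsto
      ((hfc'.tendsto β).comp (t2.mono_right nhdsWithin_le_nhds)) this ?_
    filter_upwards [t1.eventually hU, t2.eventually hU', self_mem_nhdsWithin] with σ e1 e2 e3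
    have hσ : (0 : ℝ) < σ := e3
    have := hf.le_mul_of_shift hq h3 hf' e2 (by positivity) hσ.le (by rw [e σ hσ]; exact e1)
    rwa [e σ hσ] at this

/-- A sequence of slopes tending to `β` may cross the wall infinitely often. It is eventually
trapped between rays of slopes slightly below and above `β`, and continuity lets these approach `β`.
-/
theorem HasLeadingTerm.singleton_wall {H : ℕ → ℕ → ℝ} {M₀ : ℕ}
    (h1 : ∀ n m, H (n + 1) m ≤ H n m)
    (h2 : ∀ m, M₀ ≤ m → ∀ n, H n m ≤ H n (m + 1)) {E : ℕ} {f f' : ℝ → ℝ} {U U' : Set ℝ}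
    (hf : HasLeadingTerm H E f U) (hf' : HasLeadingTerm H E f' U') (hfc : Continuous f)
    (hfc' : Continuous f') {β : ℝ} (hβ : 0 < β) (hU : U ∈ 𝓝[<] β) (hU' : U' ∈ 𝓝[>] β)
    (heq : f β = f' β) : HasLeadingTerm H E f {β} := by
  rintro x rfl a b hb hab
  have hbR : Tendsto (fun n => (b n : ℝ)) atTop atTop := tendsto_natCast_atTop_atTop.comp hb
  have hfl : ∀ y : ℝ, 0 ≤ y → Tendsto (fun n => (⌊y * b n⌋₊ : ℝ) / b n) atTop (𝓝 y) :=
    fun y hy => (tendsto_floor_mul_div hy).comp hb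
  refine tendsto_order.2 ⟨fun r hr => ?_, fun r hr => ?_⟩
  · have e1 : ∀ᶠ y in 𝓝[<] x, y ∈ U := hU
    have e2 : ∀ᶠ y in 𝓝[<] x, r < f y :=
      nhdsWithin_le_nhds ((hfc.tendsto x).eventually_const_lt hr)
    have e3 : ∀ᶠ y in 𝓝[<] x, y < x := self_mem_nhdsWithin
    have e4 : ∀ᶠ y in 𝓝[<] x, 0 < y := nhdsWithin_le_nhds (Ioi_mem_nhds hβ)
    obtain ⟨y, hyU, hyr, hyx, hy0⟩ := (e1.and (e2.and (e3.and e4))).exists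
    have t := hf y hyU _ b hb (hfl y hy0.le)
    filter_upwards [t.eventually_const_lt hyr, hab.eventually_const_lt hyx,
      (tendsto_atTop_of_tendsto_div hy0 hb (hfl y hy0.le)).eventually_ge_atTop M₀,
      hbR.eventually_gt_atTop 0] with n e1 e2 e3 e4
    refine e1.trans_le (div_le_div_of_nonneg_right ?_ (by positivity))
    refine le_of_antitone_of_monotone h1 h2 le_rfl ?_ e3
    exact Nat.floor_le_of_le ((lt_div_iff₀ e4).1 e2).le
  · rw [heq] at hr
    have e1 : ∀ᶠ y in 𝓝[>] x, y ∈ U' := hU'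
    have e2 : ∀ᶠ y in 𝓝[>] x, f' y < r :=
      nhdsWithin_le_nhds ((hfc'.tendsto x).eventually_lt_const hr)
    have e3 : ∀ᶠ y in 𝓝[>] x, x < y := self_mem_nhdsWithin
    obtain ⟨y, hyU, hyr, hyx⟩ := (e1.and (e2.and e3)).exists
    have hy0 : 0 < y := hβ.trans hyx
    have t := hf' y hyU _ b hb (hfl y hy0.le)
    filter_upwards [t.eventually_lt_const hyr, hab.eventually_lt_const hyx,
      (tendsto_atTop_of_tendsto_div hβ hb hab).eventually_ge_atTop M₀,
      hbR.eventually_gt_atTop 0] with n e1 e2 e3 e4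
    refine lt_of_le_of_lt (div_le_div_of_nonneg_right ?_ (by positivity)) e1
    refine le_of_antitone_of_monotone h1 h2 le_rfl ?_ e3
    exact Nat.le_floor ((div_lt_iff₀ e4).1 e2).le

/-- Leading terms on consecutive open intervals glue to a continuous leading term. -/
theorem exists_glued_leadingTerm {H : ℕ → ℕ → ℝ} {M₀ p q : ℕ} (hq : 0 < q)
    (h1 : ∀ n m, H (n + 1) m ≤ H n m)
    (h2 : ∀ m, M₀ ≤ m → ∀ n, H n m ≤ H n (m + 1))
    (h3 : ∀ s n m, H n m ≤ H (n + s * q) (m + s * p)) {E l : ℕ} (hl : 1 ≤ l) {β : ℕ → ℝ}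
    (hβ1 : β 1 = p / q) (hβ : ∀ i j, 1 ≤ i → i < j → j ≤ l → β i < β j) {f : ℕ → ℝ → ℝ}
    (hfc : ∀ j, 1 ≤ j → j ≤ l → Continuous (f j))
    (hf : ∀ j, 1 ≤ j → j ≤ l → HasLeadingTerm H E (f j) {x | β j < x ∧ (j < l → x < β (j + 1))}) :
    ∃ g : ℝ → ℝ, Continuous g ∧ HasLeadingTerm H E g (Set.Ioi (β 1)) ∧
      ∀ j, 1 ≤ j → j ≤ l → ∀ x, β j ≤ x → (j < l → x ≤ β (j + 1)) → g x = f j x := by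
  suffices hind : ∀ j, 1 ≤ j → j ≤ l → ∃ g : ℝ → ℝ, Continuous g ∧
      HasLeadingTerm H E g {x | β 1 < x ∧ (j < l → x < β (j + 1))} ∧
      ∀ i, 1 ≤ i → i ≤ j → ∀ x, β i ≤ x → (i < l → x ≤ β (i + 1)) → g x = f i x by
    obtain ⟨g, hg1, hg2, hg3⟩ := hind l hl le_rfl
    exact ⟨g, hg1, fun x hx => hg2 x ⟨hx, fun h => absurd h (lt_irrefl _)⟩, hg3⟩
  have hpos : (0 : ℝ) ≤ p / q := by positivity
  refine Nat.le_induction ?_ ?_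
  · intro _
    refine ⟨f 1, hfc 1 le_rfl hl, hf 1 le_rfl hl, fun i hi1 hi2 x _ _ => ?_⟩
    rw [le_antisymm hi2 hi1]
  · intro j hj ih hjl
    obtain ⟨g, hgc, hg, hgf⟩ := ih (by omega)
    have hw : (p : ℝ) / q < β (j + 1) := hβ1 ▸ hβ 1 (j + 1) le_rfl (by omega) hjl
    have hU : {x | β 1 < x ∧ (j < l → x < β (j + 1))} ∈ 𝓝[<] β (j + 1) := by
      filter_upwards [Ioo_mem_nhdsLT hw] with x hx
      exact ⟨hβ1 ▸ hx.1, fun _ => hx.2⟩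
    have hU' : {x | β (j + 1) < x ∧ (j + 1 < l → x < β (j + 1 + 1))} ∈ 𝓝[>] β (j + 1) := by
      by_cases hlt : j + 1 < l
      · filter_upwards [Ioo_mem_nhdsGT (hβ (j + 1) (j + 1 + 1) (by omega) (by omega) hlt)] with x hx
        exact ⟨hx.1, fun _ => hx.2⟩
      · filter_upwards [self_mem_nhdsWithin] with x hx
        exact ⟨hx, fun h => absurd h hlt⟩
    have hf' := hf (j + 1) (by omega) hjl
    have hfc' := hfc (j + 1) (by omega) hjl
    have heq := hg.eq_at_wall hq h1 h2 h3 hf' hgc hfc' hw hU hU'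
    have hwall := hg.singleton_wall h1 h2 hf' hgc hfc' (hpos.trans_lt hw) hU hU' heq
    refine ⟨fun x => if x ≤ β (j + 1) then g x else f (j + 1) x,
      Continuous.if_le hgc hfc' continuous_id continuous_const fun x hx => ?_, ?_, ?_⟩
    · rw [hx, heq]
    · rintro x ⟨hx1, hx2⟩ a b hb hab
      rcases lt_trichotomy x (β (j + 1)) with h | h | h
      · simp only [if_pos h.le]
        exact hg x ⟨hx1, fun _ => h⟩ a b hb hab
      · simp only [if_pos h.le]
        exact hwall x h a b hb hab
      · simp only [if_neg h.not_ge]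
        exact hf' x ⟨h, hx2⟩ a b hb hab
    · intro i hi1 hi2 x hx1 hx2
      rcases Nat.lt_or_ge i (j + 1) with h | h
      · have hxj : x ≤ β (j + 1) := by
          refine (hx2 (by omega)).trans ?_
          rcases (Nat.lt_or_ge i j) with h' | h'
          · exact (hβ (i + 1) (j + 1) (by omega) (by omega) hjl).le
          · rw [le_antisymm (Nat.le_of_lt_succ h) h']
        simp only [if_pos hxj]
        exact hgf i hi1 (by omega) x hx1 hx2
      · obtain rfl : i = j + 1 := by omega
        rcases hx1.eq_or_lt with h' | h'
        · simp only [← h', le_refl, if_true]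
          exact heq
        · simp only [if_neg h'.not_ge]

/-- A lower bound for the leading term in terms of the growth of `H 0`. -/
theorem HasLeadingTerm.le_of_growth {H : ℕ → ℕ → ℝ} {M p q : ℕ} (hq : 0 < q)
    (h1 : ∀ n m, H (n + 1) m ≤ H n m)
    (h3 : ∀ s n m, H n m ≤ H (n + s * q) (m + s * p)) {E : ℕ} {c : ℝ}
    (h5 : ∀ m, M ≤ m → c * (m : ℝ) ^ E ≤ H 0 m) {f : ℝ → ℝ} {U : Set ℝ}
    (hf : HasLeadingTerm H E f U) {x : ℝ} (hx : x ∈ U) (hpx : (p : ℝ) / q < x) :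
    c * (x - p / q) ^ E ≤ f x := by
  have hqR : (0 : ℝ) < q := by exact_mod_cast hq
  have hx0 : 0 ≤ x := le_trans (by positivity) hpx.le
  have tm := tendsto_floor_mul_div hx0
  have tN : Tendsto (fun n : ℕ => (n : ℝ)) atTop atTop := tendsto_natCast_atTop_atTop
  have hn0 : ∀ᶠ n : ℕ in atTop, (n : ℝ) ≠ 0 := tN.eventually_ne_atTop 0
  have ts : Tendsto (fun n : ℕ => ((n / q + 1 : ℕ) : ℝ) / n) atTop (𝓝 (1 / q)) := by
    refine (tendsto_div_of_abs_sub_le tN (u := fun n => (n / q + 1 : ℕ)) (B := 1)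
      (v := fun n => n / q) (fun n => ?_) ?_)
    · have e1 : (q : ℝ) * (n / q : ℕ) ≤ n := by exact_mod_cast Nat.mul_div_le n q
      have e2 : (n : ℝ) ≤ q * ((n / q : ℕ) + 1) := by
        exact_mod_cast (Nat.lt_mul_div_succ n hq).le
      have e3 : (((n / q : ℕ) : ℝ)) ≤ n / q := by
        rw [le_div_iff₀ hqR]
        linarith
      have e4 : (n : ℝ) / q ≤ (n / q : ℕ) + 1 := by
        rw [div_le_iff₀ hqR]
        linarith
      push_cast
      rw [abs_le]
      constructor <;> linarith
    · refine tendsto_const_nhds.congr' ?_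
      filter_upwards [hn0] with n hn
      field_simp
  have td : Tendsto (fun n : ℕ => (⌊x * n⌋₊ : ℝ) / n - ((n / q + 1 : ℕ) : ℝ) / n * p) atTop
      (𝓝 (x - p / q)) := by
    have := tm.sub (ts.mul_const (p : ℝ))
    rwa [one_div_mul_eq_div] at this
  have hbig : Tendsto (fun n : ℕ => ((⌊x * n⌋₊ : ℝ) - ((n / q + 1 : ℕ) : ℝ) * p)) atTop atTop := by
    refine (td.pos_mul_atTop (sub_pos.2 hpx) tN).congr' ?_
    filter_upwards [hn0] with n hn
    field_simp
  refine le_of_tendsto_of_tendsto ((td.pow E).const_mul c) (hf.tendsto_floor hx hx0) ?_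
  filter_upwards [hbig.eventually_ge_atTop (M : ℝ), hn0] with n e1 hn
  -- This choice gives `s * q ≥ n`, so `s` shifts carry `H 0 (m - s * p)` below `H (s * q) m`, hence
  -- below `H n m`.
  set s := n / q + 1 with hs
  have hle : M + s * p ≤ ⌊x * n⌋₊ := by
    have : (M : ℝ) + s * p ≤ ⌊x * n⌋₊ := by linarith
    exact_mod_cast this
  have hsp : s * p ≤ ⌊x * n⌋₊ := le_trans (Nat.le_add_left _ _) hle
  have hH : H 0 (⌊x * n⌋₊ - s * p) ≤ H n ⌊x * n⌋₊ := by
    refine (h3 s _ _).trans ?_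
    rw [Nat.sub_add_cancel hsp, zero_add]
    exact antitone_nat_of_succ_le (f := fun n' => H n' ⌊x * n⌋₊) (fun n' => h1 n' _)
      (by rw [mul_comm]; exact (Nat.lt_mul_div_succ n hq).le)
  refine le_trans (le_of_eq ?_) (div_le_div_of_nonneg_right ((h5 _ (by omega)).trans hH)
    (by positivity))
  rw [Nat.cast_sub hsp, Nat.cast_mul, mul_div_assoc, ← div_pow, sub_div, mul_div_right_comm]

/-- In smaller degree the quotient by `(x - β) ^ E` would tend to 0 instead of staying above `c`.
Together with the upper bound on degrees, this fixes the degree of the last polynomial. -/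
theorem Polynomial.le_natDegree_of_mul_pow_le {P : Polynomial ℚ} {E : ℕ} {c β y : ℝ} (hc : 0 < c)
    (h : ∀ x, y < x → c * (x - β) ^ E ≤ Polynomial.aeval x P) : E ≤ P.natDegree := by
  by_contra! hlt
  set Q : Polynomial ℝ := (Polynomial.X - Polynomial.C β) ^ E with hQ
  have hQd : Q.degree = E := by
    rw [hQ, Polynomial.degree_pow, Polynomial.degree_X_sub_C, nsmul_one]
  have hPd : (P.map (algebraMap ℚ ℝ)).degree < Q.degree := by
    rw [hQd]
    refine lt_of_le_of_lt (Polynomial.degree_map_le.trans Polynomial.degree_le_natDegree) ?_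
    exact_mod_cast hlt
  have t := Polynomial.div_tendsto_atTop_zero_of_degree_lt _ _ hPd
  have hle : c ≤ 0 := by
    refine ge_of_tendsto t ?_
    filter_upwards [eventually_gt_atTop y, eventually_gt_atTop β] with x hx hxβ
    have hpos : (0 : ℝ) < (x - β) ^ E := pow_pos (sub_pos.2 hxβ) _
    rw [hQ, Polynomial.eval_pow, Polynomial.eval_sub, Polynomial.eval_X, Polynomial.eval_C,
      le_div_iff₀ hpos, Polynomial.eval_map_algebraMap]
    exact h x hx
  linarith

end LeadingTerm

/-! ### The leading term of ℓ((Iₙ)ₘ) for a filtration -/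

section FiltrationDensity

open Filter Topology

theorem hasDenominator_monomialHilbertSeries {k A κ : Type*} [Field k] [CommRing A] [Algebra k A]
    {N : ℕ} (z : Fin N → A) {b : Fin N → κ →₀ ℕ} (hb : ∀ i, b i ≠ 0) :
    HasDenominator (Finset.univ.val.map b) (monomialHilbertSeries k z b) := by
  obtain ⟨Q, hQ⟩ := exists_hilbertSeries_mul_prod_eq (k := k) z hb
  refine ⟨Q, hQ ▸ ?_⟩
  congr 1
  rw [denominator, Multiset.map_map]
  change ((∏ i, (1 - MvPolynomial.monomial (b i) 1) : MvPolynomial κ ℚ) : MvPowerSeries κ ℚ) = _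
  rw [← MvPolynomial.coeToMvPowerSeries.ringHom_apply, map_prod]
  exact Finset.prod_congr rfl fun i _ => coe_one_sub_monomial _

namespace IdealFiltration

variable {k A : Type*} [Field k] [CommRing A] [Algebra k A] {𝒜 : ℕ → Submodule k A}
  {F : IdealFiltration A}

/-- Below the smallest slope of a generator the components of the filtration vanish. -/
theorem len_eq_zero_of_lt {N : ℕ} {z : Fin N → A} {b : Fin N → Fin 2 →₀ ℕ}
    (hspan : ∀ m n, (F.ideal n).restrictScalars k ⊓ 𝒜 m = monomialSpan k z b (bidegree m n))
    {p q : ℕ} (hb : ∀ i, p * b i 1 ≤ q * b i 0) {n m : ℕ} (h : q * m < p * n) :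
    F.len 𝒜 n m = 0 := by
  have hempty : {α : Fin N → ℕ | multidegree b α = bidegree m n} = ∅ := by
    rw [Set.eq_empty_iff_forall_notMem]
    intro α hα
    obtain ⟨h1, h2⟩ := multidegree_eq_bidegree_iff.1 hα
    rw [← h1, ← h2, Finset.mul_sum, Finset.mul_sum] at h
    refine h.not_ge (Finset.sum_le_sum fun i _ => ?_)
    calc p * (α i * b i 1) = α i * (p * b i 1) := by ring
      _ ≤ α i * (q * b i 0) := Nat.mul_le_mul_left _ (hb i)
      _ = q * (α i * b i 0) := by ring
  rw [len, hspan, monomialSpan, hempty, Set.image_empty, Submodule.span_empty, finrank_bot]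

theorem IsGeneratedInBidegrees.pos {l : ℕ} {d e : ℕ → ℕ}
    (hgen : F.IsGeneratedInBidegrees 𝒜 l d e) {j : ℕ} (hj : 1 ≤ j) (hjl : j ≤ l) : 0 < e j := by
  obtain ⟨-, -, G, m, n, -, hG, -, hGj⟩ := hgen
  obtain ⟨g, hg, -, hn⟩ := hGj j hj hjl
  rw [← hn]
  exact (hG g hg).1

variable [GradedAlgebra 𝒜]

/-- The chamber between consecutive slopes carries a leading polynomial. -/
theorem exists_hasLeadingTerm_chamber (hA : IsStandardGraded 𝒜) {N : ℕ} {z : Fin N → A}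
    {b : Fin N → Fin 2 →₀ ℕ}
    (hspan : ∀ m n, (F.ideal n).restrictScalars k ⊓ 𝒜 m = monomialSpan k z b (bidegree m n))
    (hb : ∀ i, b i ≠ 0) {v v' : Fin 2 →₀ ℕ} (hdet : 0 < slopeDet v v')
    (hS : ∀ i, 0 ≤ slopeDet (b i) v ∨ 0 ≤ slopeDet v' (b i)) {E M₀ : ℕ} {C : ℝ}
    (hC : ∀ n m, (F.len 𝒜 n m : ℝ) ≤ C * ((m : ℝ) + 1) ^ E)
    (hmono : ∀ m, M₀ ≤ m → ∀ n, (F.len 𝒜 n m : ℝ) ≤ F.len 𝒜 n (m + 1)) :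
    ∃ p : Polynomial ℚ, p.natDegree ≤ E ∧ HasLeadingTerm (fun n m => (F.len 𝒜 n m : ℝ)) E
      (fun x => Polynomial.aeval x p) {x | (v 0 : ℝ) < v 1 * x ∧ v' 1 * x < (v' 0 : ℝ)} := by
  have hden := hasDenominator_monomialHilbertSeries (k := k) z hb
  obtain ⟨Δ, hΔ, P, K, hP⟩ := hden.exists_isEventuallyPolynomial hdet
    (fun p hp => by obtain ⟨i, -, rfl⟩ := Multiset.mem_map.1 hp; exact hb i)
    (fun p hp => by obtain ⟨i, -, rfl⟩ := Multiset.mem_map.1 hp; exact hS i)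
  have hC0 : 0 ≤ C := by
    have h := (Nat.cast_nonneg _).trans (hC 0 0)
    simpa using h
  have hΔ1 : (1 : ℝ) ≤ Δ := by exact_mod_cast hΔ
  -- Polynomiality is known only at multiples of `Δ`, so the dilated function is treated first; the
  -- new constant comes from `Δ m + 1 ≤ Δ (m + 1)`.
  obtain ⟨q, hq, hlim⟩ := exists_leading_polynomial
    (G := fun n m => (F.len 𝒜 (Δ * n) (Δ * m) : ℝ)) (E := E) (C := C * (Δ : ℝ) ^ E)
    (fun n m => ⟨Nat.cast_nonneg _, (hC _ _).trans (by
      rw [mul_assoc, ← mul_pow]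
      push_cast
      gcongr
      linarith)⟩) (P := P) (K := K) hdet (fun u h1 h2 => by
      rw [← hP u h1 h2, coeff_monomialHilbertSeries, len, hspan]
      have : bidegree (Δ * u 0) (Δ * u 1) = Δ • u := by
        conv_rhs => rw [← bidegree_eta (Δ • u)]
        simp
      rw [this]
      simp)
  refine ⟨q * Polynomial.C (1 / (Δ : ℚ) ^ E), ?_, ?_⟩
  · exact (Polynomial.natDegree_mul_C_le _ _).trans hq
  · have hU : ∀ x ∈ {x : ℝ | (v 0 : ℝ) < v 1 * x ∧ v' 1 * x < (v' 0 : ℝ)}, 0 < x := by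
      rintro x ⟨hx, -⟩
      by_contra! hneg
      have : (v 1 : ℝ) * x ≤ 0 := mul_nonpos_of_nonneg_of_nonpos (Nat.cast_nonneg _) hneg
      linarith [(v 0).cast_nonneg (α := ℝ)]
    have := hasLeadingTerm_of_dilation (H := fun n m => (F.len 𝒜 n m : ℝ)) (M₀ := M₀)
      (fun n m => by exact_mod_cast F.len_succ_le hA n m) hmono (E := E) hΔ
      (g := fun x => Polynomial.aeval x q) hU
      (fun x hx a b hb hab => hlim a b x hb hab hx.1 hx.2)
    refine fun x hx a b hb hab => ?_
    have h := this x hx a b hb hab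
    have e : Polynomial.aeval x (q * Polynomial.C (1 / (Δ : ℚ) ^ E)) =
        Polynomial.aeval x q / (Δ : ℝ) ^ E := by
      simp [div_eq_mul_inv]
    simp only [e]
    exact h

/-- The leading term of `ℓ((Iₙ)ₘ)` is continuous and piecewise polynomial in the slope `m / n`. -/
theorem exists_piecewise_polynomial (hA : IsStandardGraded 𝒜) {D : ℕ} (hD : ringKrullDim A = D)
    (hD1 : 1 ≤ D) {l : ℕ} {d e : ℕ → ℕ} (hgen : F.IsGeneratedInBidegrees 𝒜 l d e) {a : A}
    (had : a ∈ 𝒜 (d 1)) (hae : a ∈ F.ideal (e 1)) (ha : ∀ x, a * x = 0 → x = 0) :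
    ∃ (g : ℝ → ℝ) (p : ℕ → Polynomial ℚ), Continuous g ∧
      HasLeadingTerm (fun n m => (F.len 𝒜 n m : ℝ)) (D - 1) g (Set.Ioi ((d 1 : ℝ) / e 1)) ∧
      (∀ n m, e 1 * m < d 1 * n → F.len 𝒜 n m = 0) ∧
      (∀ j, 1 ≤ j → j ≤ l → p j ≠ 0 ∧ (p j).natDegree ≤ D - 1) ∧
      (p l).natDegree = D - 1 ∧
      (∀ j, 1 ≤ j → j ≤ l → ∀ x : ℝ, (d j : ℝ) / e j ≤ x →
        (j < l → x ≤ (d (j + 1) : ℝ) / e (j + 1)) → g x = Polynomial.aeval x (p j)) := by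
  have he : ∀ j, 1 ≤ j → j ≤ l → 0 < e j := fun j => hgen.pos
  have hl : 1 ≤ l := hgen.1
  have hlt := hgen.2.1
  obtain ⟨N, z, b, hb, hspan⟩ := exists_generators hA hgen
  obtain ⟨c, C, M, hc, hC, hle, hge, -⟩ := hA.exists_hilbert_bounds hD hD1
  obtain ⟨M₀, hmono⟩ := F.exists_len_mono hA hD hD1 (he 1 le_rfl hl) had hae ha
  set H : ℕ → ℕ → ℝ := fun n m => (F.len 𝒜 n m : ℝ) with hH
  have h1 : ∀ n m, H (n + 1) m ≤ H n m := fun n m => Nat.cast_le.2 (F.len_succ_le hA n m)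
  have h2 : ∀ m, M₀ ≤ m → ∀ n, H n m ≤ H n (m + 1) := fun m hm n =>
    Nat.cast_le.2 (hmono m hm n)
  have h3 : ∀ s n m, H n m ≤ H (n + s * e 1) (m + s * d 1) := fun s n m =>
    Nat.cast_le.2 (F.len_le_len_add_mul hA had hae ha s n m)
  have h4 : ∀ n m, H n m ≤ C * ((m : ℝ) + 1) ^ (D - 1) := fun n m =>
    (Nat.cast_le.2 (F.len_le_finrank hA n m)).trans (hle m)
  have h5 : ∀ m, M ≤ m → c * (m : ℝ) ^ (D - 1) ≤ H 0 m := fun m hm => by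
    refine (hge m hm).trans_eq ?_
    rw [← F.len_eq_finrank F.zero_eq]
  have hb0 : ∀ i, b i ≠ 0 := by
    intro i h0
    rcases hb i with h | ⟨j, -, -, h, -⟩
    · have := DFunLike.congr_fun h 0
      rw [h0] at this
      simp at this
    · rw [h0] at h
      simp at h
  have hcross : ∀ {p q p' q' : ℕ}, 0 < q → 0 < q' → (p : ℚ) / q ≤ (p' : ℚ) / q' →
      (p : ℤ) * q' ≤ p' * q := by
    intro p q p' q' hq hq' h
    rw [div_le_div_iff₀ (by exact_mod_cast hq) (by exact_mod_cast hq')] at h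
    exact_mod_cast h
  have hmon : ∀ i j, 1 ≤ i → i ≤ j → j ≤ l → (d i : ℚ) / e i ≤ (d j : ℚ) / e j := by
    intro i j hi hij hj
    rcases hij.eq_or_lt with rfl | h
    · exact le_rfl
    · exact (hlt i j hi h hj).le
  -- The ratios exhaust the slopes of the generators, so none lies strictly between two consecutive
  -- ones.
  have hchamber : ∀ j, 1 ≤ j → j ≤ l → ∃ p : Polynomial ℚ, p.natDegree ≤ D - 1 ∧
      HasLeadingTerm H (D - 1) (fun x => Polynomial.aeval x p)
        {x | (d j : ℝ) / e j < x ∧ (j < l → x < (d (j + 1) : ℝ) / e (j + 1))} := by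
    intro j hj hjl
    have hej : (0 : ℝ) < e j := by exact_mod_cast he j hj hjl
    by_cases hjlt : j < l
    · have hej' : (0 : ℝ) < e (j + 1) := by exact_mod_cast he (j + 1) (by omega) hjlt
      have hdet : 0 < slopeDet (bidegree (d j) (e j)) (bidegree (d (j + 1)) (e (j + 1))) := by
        have := hlt j (j + 1) hj (by omega) hjlt
        rw [div_lt_div_iff₀ (by exact_mod_cast hej) (by exact_mod_cast hej')] at this
        have : (d j : ℤ) * e (j + 1) < d (j + 1) * e j := by exact_mod_cast this
        simp only [slopeDet, bidegree_zero, bidegree_one]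
        linarith
      obtain ⟨p, hp, hlim⟩ := exists_hasLeadingTerm_chamber hA hspan hb0 hdet (fun i => by
        rcases hb i with h | ⟨i', hi1, hi2, hi3, hi4⟩
        · right
          simp [h, slopeDet]
        · rcases Nat.lt_or_ge j i' with hji | hji
          · right
            have := hcross (he (j + 1) (by omega) hjlt) hi3
              ((hmon (j + 1) i' (by omega) hji hi2).trans_eq hi4.symm)
            simp only [slopeDet, bidegree_zero, bidegree_one]
            linarith
          · left
            have := hcross hi3 (he j hj hjl) (hi4.trans_le (hmon i' j hi1 hji hjl))
            simp only [slopeDet, bidegree_zero, bidegree_one]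
            linarith) h4 h2
      refine ⟨p, hp, fun x hx => hlim x ⟨?_, ?_⟩⟩
      · have := (div_lt_iff₀ hej).1 hx.1
        simp only [bidegree_zero, bidegree_one]
        linarith
      · have := (lt_div_iff₀ hej').1 (hx.2 hjlt)
        simp only [bidegree_zero, bidegree_one]
        linarith
    -- The last chamber is bounded on the right by the ray of `(1, 0)`, the bidegree of `A₁` and of
    -- infinite slope.
    · obtain rfl : j = l := le_antisymm hjl (not_lt.1 hjlt)
      have hdet : 0 < slopeDet (bidegree (d j) (e j)) (bidegree 1 0) := by
        simpa [slopeDet] using he j hj hjl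
      obtain ⟨p, hp, hlim⟩ := exists_hasLeadingTerm_chamber hA hspan hb0 hdet (fun i => by
        rcases hb i with h | ⟨i', hi1, hi2, hi3, hi4⟩
        · right
          simp [h, slopeDet]
        · left
          have := hcross hi3 (he j hj hjl) (hi4.trans_le (hmon i' j hi1 hi2 hjl))
          simp only [slopeDet, bidegree_zero, bidegree_one]
          linarith) h4 h2
      refine ⟨p, hp, fun x hx => hlim x ⟨?_, by simp⟩⟩
      have := (div_lt_iff₀ hej).1 hx.1
      simp only [bidegree_zero, bidegree_one]
      linarith
  choose! p hp hlim using hchamber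
  have hβ : ∀ i j, 1 ≤ i → i < j → j ≤ l → (d i : ℝ) / e i < (d j : ℝ) / e j := by
    intro i j hi hij hj
    have := (Rat.cast_lt (K := ℝ)).2 (hlt i j hi hij hj)
    push_cast at this
    exact this
  obtain ⟨g, hgc, hg, hgp⟩ := exists_glued_leadingTerm (he 1 le_rfl hl) h1 h2 h3 (E := D - 1) hl
    (β := fun j => (d j : ℝ) / e j) rfl hβ (f := fun j x => Polynomial.aeval x (p j))
    (fun j _ _ => (p j).continuous_aeval) hlim
  -- This lower bound shows that no `p j` is zero and, on the unbounded chamber, that `p l` has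
  -- degree at least `D - 1`.
  have hlow : ∀ j, 1 ≤ j → j ≤ l → ∀ x : ℝ, (d j : ℝ) / e j < x →
      (j < l → x < (d (j + 1) : ℝ) / e (j + 1)) →
      (d 1 : ℝ) / e 1 < x ∧ c * (x - d 1 / e 1) ^ (D - 1) ≤ Polynomial.aeval x (p j) := by
    intro j hj hjl x hx1 hx2
    have hx : (d 1 : ℝ) / e 1 < x := by
      refine lt_of_le_of_lt ?_ hx1
      have := (Rat.cast_le (K := ℝ)).2 (hmon 1 j le_rfl hj hjl)
      push_cast at this
      exact this
    exact ⟨hx, (hlim j hj hjl).le_of_growth (he 1 le_rfl hl) h1 h3 h5 ⟨hx1, hx2⟩ hx⟩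
  refine ⟨g, p, hgc, hg, fun n m hnm => ?_, fun j hj hjl => ⟨?_, hp j hj hjl⟩, ?_, hgp⟩
  · refine len_eq_zero_of_lt hspan (fun i => ?_) hnm
    rcases hb i with h | ⟨i', hi1, hi2, hi3, hi4⟩
    · simp [h]
    · have := hcross (he 1 le_rfl hl) hi3 ((hmon 1 i' le_rfl hi1 hi2).trans_eq hi4.symm)
      zify
      linarith
  · intro h0
    obtain ⟨x, hx1, hx2⟩ : ∃ x : ℝ, (d j : ℝ) / e j < x ∧
        (j < l → x < (d (j + 1) : ℝ) / e (j + 1)) := by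
      by_cases hjlt : j < l
      · obtain ⟨x, hx1, hx2⟩ := exists_between (hβ j (j + 1) hj (by omega) hjlt)
        exact ⟨x, hx1, fun _ => hx2⟩
      · exact ⟨(d j : ℝ) / e j + 1, by linarith, fun h => absurd h hjlt⟩
    obtain ⟨hx, hle⟩ := hlow j hj hjl x hx1 hx2
    have : 0 < c * (x - d 1 / e 1) ^ (D - 1) := mul_pos hc (pow_pos (sub_pos.2 hx) _)
    rw [h0, map_zero] at hle
    linarith
  · exact le_antisymm (hp l hl le_rfl) (Polynomial.le_natDegree_of_mul_pow_le hc
      fun x hx => (hlow l hl le_rfl x hx fun h => absurd h (lt_irrefl _)).2)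

end IdealFiltration

end FiltrationDensity

/-! ### The density function of a filtration -/

section Density

open Filter Topology

namespace IdealFiltration

variable {k A : Type*} [Field k] [CommRing A] [Algebra k A] {𝒜 : ℕ → Submodule k A}
  {F : IdealFiltration A}

theorem tendsto_density {D : ℕ} (hdim : F.dim = D) {x L : ℝ}
    (h : Tendsto (fun n : ℕ => (F.len 𝒜 n ⌊x * n⌋₊ : ℝ) / (n : ℝ) ^ (D - 1)) atTop (𝓝 L)) :
    F.density 𝒜 x = D.factorial * L ∧
      Tendsto (fun n : ℕ => (F.len 𝒜 n ⌊x * n⌋₊ : ℝ) /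
        ((n : ℝ) ^ (D - 1) / (D.factorial : ℝ))) atTop (𝓝 (F.density 𝒜 x)) := by
  have h' : Tendsto (fun n : ℕ => (F.len 𝒜 n ⌊x * n⌋₊ : ℝ) /
      ((n : ℝ) ^ (D - 1) / (D.factorial : ℝ))) atTop (𝓝 (D.factorial * L)) := by
    refine (h.const_mul (D.factorial : ℝ)).congr fun n => ?_
    rw [div_div_eq_mul_div]
    ring
  have e : F.density 𝒜 x = D.factorial * L := by
    rw [density, hdim]
    exact h'.limsup_eq
  exact ⟨e, e ▸ h'⟩

/-- The density function of a filtration whose Rees algebra is finitely generated and has a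
nonzerodivisor of the smallest slope. -/
theorem density_piecewise_polynomial [GradedAlgebra 𝒜] (hA : IsStandardGraded 𝒜) {D : ℕ}
    (hD : ringKrullDim A = D) (hD1 : 1 ≤ D) (hdim : F.dim = D) {l : ℕ} {d e : ℕ → ℕ}
    (hgen : F.IsGeneratedInBidegrees 𝒜 l d e) {a : A} (had : a ∈ 𝒜 (d 1))
    (hae : a ∈ F.ideal (e 1)) (ha : ∀ x, a * x = 0 → x = 0) :
    (∀ x : ℝ, 0 ≤ x → x ≠ (d 1 : ℝ) / e 1 →
      Tendsto (fun n : ℕ => (F.len 𝒜 n ⌊x * n⌋₊ : ℝ) /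
        ((n : ℝ) ^ (D - 1) / (D.factorial : ℝ))) atTop (𝓝 (F.density 𝒜 x))) ∧
    ContinuousOn (F.density 𝒜) (Set.Ioi ((d 1 : ℝ) / e 1)) ∧
    (∀ x : ℝ, 0 ≤ x → x < (d 1 : ℝ) / e 1 → F.density 𝒜 x = 0) ∧
    ∃ p : ℕ → Polynomial ℚ,
      (∀ j, 1 ≤ j → j ≤ l → p j ≠ 0 ∧ (p j).natDegree ≤ D - 1) ∧
      (p l).natDegree = D - 1 ∧
      (∀ j, 1 ≤ j → j ≤ l → ∀ x : ℝ, (d 1 : ℝ) / e 1 < x → (d j : ℝ) / e j ≤ x →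
        (j < l → x ≤ (d (j + 1) : ℝ) / e (j + 1)) →
        F.density 𝒜 x = Polynomial.aeval x (p j)) := by
  have he : (0 : ℝ) < e 1 := by exact_mod_cast hgen.pos le_rfl hgen.1
  obtain ⟨g, p, hgc, hg, hzero, hp, hpl, hgp⟩ :=
    exists_piecewise_polynomial hA hD hD1 hgen had hae ha
  have habove : ∀ x : ℝ, (d 1 : ℝ) / e 1 < x → Tendsto (fun n : ℕ =>
      (F.len 𝒜 n ⌊x * n⌋₊ : ℝ) / (n : ℝ) ^ (D - 1)) atTop (𝓝 (g x)) := fun x hx =>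
    hg.tendsto_floor hx ((by positivity : (0 : ℝ) ≤ d 1 / e 1).trans hx.le)
  have hbelow : ∀ x : ℝ, 0 ≤ x → x < (d 1 : ℝ) / e 1 → Tendsto (fun n : ℕ =>
      (F.len 𝒜 n ⌊x * n⌋₊ : ℝ) / (n : ℝ) ^ (D - 1)) atTop (𝓝 0) := by
    intro x hx0 hx
    refine tendsto_const_nhds.congr' ?_
    filter_upwards [eventually_gt_atTop 0] with n hn
    rw [hzero n _ ?_, Nat.cast_zero, zero_div]
    have hnR : (0 : ℝ) < n := by exact_mod_cast hn
    have h1 : (⌊x * n⌋₊ : ℝ) ≤ x * n := Nat.floor_le (by positivity)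
    have h2 : e 1 * x < d 1 := by
      have := (lt_div_iff₀ he).1 hx
      linarith
    have h3 : (e 1 : ℝ) * ⌊x * n⌋₊ < d 1 * n := by
      calc (e 1 : ℝ) * ⌊x * n⌋₊ ≤ e 1 * (x * n) := by gcongr
        _ = (e 1 * x) * n := by ring
        _ < d 1 * n := by gcongr
    exact_mod_cast h3
  have hfac : (D.factorial : ℚ) ≠ 0 := by exact_mod_cast D.factorial_ne_zero
  refine ⟨fun x hx0 hx => ?_, ?_, fun x hx0 hx => ?_,
    fun j => Polynomial.C (D.factorial : ℚ) * p j, fun j hj hjl => ⟨?_, ?_⟩, ?_,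
    fun j hj hjl x hx hx1 hx2 => ?_⟩
  · rcases hx.lt_or_gt with h | h
    · exact (tendsto_density hdim (hbelow x hx0 h)).2
    · exact (tendsto_density hdim (habove x h)).2
  · exact (hgc.const_mul (D.factorial : ℝ)).continuousOn.congr fun x hx =>
      (tendsto_density hdim (habove x hx)).1
  · rw [(tendsto_density hdim (hbelow x hx0 hx)).1, mul_zero]
  · exact mul_ne_zero (Polynomial.C_ne_zero.2 hfac) (hp j hj hjl).1
  · rw [Polynomial.natDegree_C_mul hfac]
    exact (hp j hj hjl).2
  · rw [Polynomial.natDegree_C_mul hfac, hpl]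
  · rw [(tendsto_density hdim (habove x hx)).1, hgp j hj hjl x hx1 hx2, map_mul,
      Polynomial.aeval_C]
    simp

end IdealFiltration

end Density

/-! ### Limits of polynomials and of Riemann sums -/

section Powers

open Filter Topology

/-- A polynomial bounded by `n ^ E` on the natural numbers has a leading term of order `E`. -/
theorem Polynomial.exists_tendsto_eval_div_pow (Q : Polynomial ℝ) {E : ℕ} {B : ℝ}
    (h : ∀ᶠ n : ℕ in atTop, 0 ≤ Q.eval (n : ℝ) ∧ Q.eval (n : ℝ) ≤ B * (n : ℝ) ^ E) :
    ∃ L, Tendsto (fun n : ℕ => Q.eval (n : ℝ) / (n : ℝ) ^ E) atTop (𝓝 L) := by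
  have hN : Tendsto (fun n : ℕ => (n : ℝ)) atTop atTop := tendsto_natCast_atTop_atTop
  rcases eq_or_ne Q 0 with rfl | hQ
  · exact ⟨0, by simp⟩
  rcases lt_trichotomy Q.natDegree E with hlt | heq | hgt
  · refine ⟨0, ?_⟩
    have hdeg : Q.degree < (Polynomial.X ^ E : Polynomial ℝ).degree := by
      rw [Polynomial.degree_X_pow]
      exact (Polynomial.natDegree_lt_iff_degree_lt hQ).1 hlt
    have := (Polynomial.div_tendsto_atTop_zero_of_degree_lt _ _ hdeg).comp hN
    simpa [Function.comp_def] using this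
  · subst heq
    exact ⟨_, (Q.tendsto_eval_div_pow hQ).comp hN⟩
  · exfalso
    have h1 := (Q.tendsto_eval_div_pow hQ).comp hN
    have h2 : Tendsto (fun n : ℕ => B * ((n : ℝ) ^ E / (n : ℝ) ^ Q.natDegree)) atTop
        (𝓝 (B * 0)) := ((tendsto_pow_div_pow_atTop_zero hgt).comp hN).const_mul B
    rw [mul_zero] at h2
    have h3 : Tendsto ((fun x : ℝ => Q.eval x / x ^ Q.natDegree) ∘ fun n : ℕ => (n : ℝ)) atTop
        (𝓝 0) := by
      refine squeeze_zero' ?_ ?_ h2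
      · filter_upwards [h] with n hn
        exact div_nonneg hn.1 (by positivity)
      · filter_upwards [h] with n hn
        rw [← mul_div_assoc]
        exact div_le_div_of_nonneg_right hn.2 (by positivity)
    exact hQ (Polynomial.leadingCoeff_eq_zero.1 (tendsto_nhds_unique h1 h3))

theorem integral_floor_eq_sum (h : ℕ → ℝ) (N : ℕ) :
    ∫ x in (0 : ℝ)..N, h ⌊x⌋₊ = ∑ m ∈ Finset.range N, h m := by
  have hunit : ∀ m : ℕ, Set.EqOn (fun _ => h m) (fun x : ℝ => h ⌊x⌋₊)
      (Set.Ioo (m : ℝ) ((m + 1 : ℕ) : ℝ)) := by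
    intro m x hx
    have : ⌊x⌋₊ = m := by
      rw [Nat.floor_eq_iff ((Nat.cast_nonneg m).trans hx.1.le)]
      exact ⟨hx.1.le, by simpa using hx.2⟩
    simp only [this]
  have hle : ∀ m : ℕ, (m : ℝ) ≤ ((m + 1 : ℕ) : ℝ) := fun m => by simp
  have hint : ∀ m : ℕ, IntervalIntegrable (fun x : ℝ => h ⌊x⌋₊) MeasureTheory.volume (m : ℝ)
      ((m + 1 : ℕ) : ℝ) := by
    intro m
    rw [intervalIntegrable_iff_integrableOn_Ioo_of_le (hle m)]
    refine MeasureTheory.IntegrableOn.congr_fun ?_ (hunit m) measurableSet_Ioo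
    exact MeasureTheory.integrableOn_const (by simp)
  have hval : ∀ m : ℕ, ∫ x in (m : ℝ)..((m + 1 : ℕ) : ℝ), h ⌊x⌋₊ = h m := by
    intro m
    rw [intervalIntegral.integral_of_le (hle m), MeasureTheory.integral_Ioc_eq_integral_Ioo,
      ← MeasureTheory.setIntegral_congr_fun measurableSet_Ioo (hunit m)]
    simp
  have := intervalIntegral.sum_integral_adjacent_intervals (f := fun x : ℝ => h ⌊x⌋₊)
    (μ := MeasureTheory.volume) (a := fun m : ℕ => (m : ℝ)) (n := N) fun m _ => hint m
  rw [← Nat.cast_zero, ← this]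
  exact Finset.sum_congr rfl fun m _ => hval m

theorem integral_floor_mul_eq_sum (h : ℕ → ℝ) (c : ℕ) {n : ℕ} (hn : 0 < n) :
    ∫ x in (0 : ℝ)..c, h ⌊x * n⌋₊ = (∑ m ∈ Finset.range (c * n), h m) / n := by
  have hn' : (n : ℝ) ≠ 0 := by exact_mod_cast hn.ne'
  have := intervalIntegral.integral_comp_mul_right (a := 0) (b := (c : ℝ))
    (fun x : ℝ => h ⌊x⌋₊) hn'
  rw [this, zero_mul, ← Nat.cast_mul, integral_floor_eq_sum, smul_eq_mul, inv_mul_eq_div]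

/-- Riemann sums of a bounded family of step functions converge to the integral of the limit. -/
theorem tendsto_sum_div_integral {H : ℕ → ℕ → ℝ} {D : ℕ} (hD : 1 ≤ D) {C r : ℝ} (hr : 0 < r)
    (hH : ∀ n m, 0 ≤ H n m ∧ H n m ≤ C * ((m : ℝ) + 1) ^ (D - 1)) {f : ℝ → ℝ}
    (hf : ∀ x : ℝ, 0 ≤ x →
      Tendsto (fun n : ℕ => H n ⌊x * n⌋₊ / ((n : ℝ) ^ (D - 1) / r)) atTop (𝓝 (f x))) (c : ℕ) :
    Tendsto (fun n : ℕ => (∑ m ∈ Finset.range (c * n + 1), H n m) / ((n : ℝ) ^ D / r)) atTop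
      (𝓝 (∫ x in (0 : ℝ)..c, f x)) := by
  have hC : 0 ≤ C := by
    have := (hH 0 0).1.trans (hH 0 0).2
    simpa using this
  have hc0 : (0 : ℝ) ≤ c := Nat.cast_nonneg c
  have hmain : Tendsto (fun n : ℕ => ∫ x in (0 : ℝ)..c, H n ⌊x * n⌋₊ / ((n : ℝ) ^ (D - 1) / r))
      atTop (𝓝 (∫ x in (0 : ℝ)..c, f x)) := by
    refine intervalIntegral.tendsto_integral_filter_of_dominated_convergence
      (fun _ => C * ((c : ℝ) + 1) ^ (D - 1) * r) ?_ ?_ ?_ ?_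
    · refine Eventually.of_forall fun n => Measurable.aestronglyMeasurable ?_
      refine Measurable.div_const ?_ _
      exact (measurable_from_nat (f := H n)).comp
        (Nat.measurable_floor.comp (measurable_id.mul_const _))
    · filter_upwards [eventually_gt_atTop 0] with n hn
      refine Eventually.of_forall fun x hx => ?_
      rw [Set.uIoc_of_le hc0] at hx
      have hnR : (1 : ℝ) ≤ n := by exact_mod_cast hn
      have hn0 : (0 : ℝ) < n := by linarith
      rw [Real.norm_eq_abs, abs_of_nonneg (div_nonneg (hH _ _).1 (by positivity)),
        div_le_iff₀ (by positivity)]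
      have h1 : (⌊x * n⌋₊ : ℝ) ≤ x * n := Nat.floor_le (mul_nonneg hx.1.le hn0.le)
      have h2 : x * n ≤ c * n := by
        have := hx.2
        gcongr
      calc H n ⌊x * n⌋₊ ≤ C * ((⌊x * n⌋₊ : ℝ) + 1) ^ (D - 1) := (hH _ _).2
        _ ≤ C * (((c : ℝ) + 1) * n) ^ (D - 1) := by
          gcongr
          linarith
        _ = C * ((c : ℝ) + 1) ^ (D - 1) * r * ((n : ℝ) ^ (D - 1) / r) := by
          rw [mul_pow]
          field_simp
    · exact intervalIntegrable_const
    · refine Eventually.of_forall fun x hx => ?_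
      rw [Set.uIoc_of_le hc0] at hx
      exact hf x hx.1.le
  -- The integral of the step function accounts for `m < c * n` only; the term `m = c * n` is
  -- negligible after division by `n`.
  have hlast : Tendsto (fun n : ℕ => H n ⌊(c : ℝ) * n⌋₊ / ((n : ℝ) ^ (D - 1) / r) / n) atTop
      (𝓝 0) := (hf c hc0).div_atTop tendsto_natCast_atTop_atTop
  have := hmain.add hlast
  rw [add_zero] at this
  refine this.congr' ?_
  filter_upwards [eventually_gt_atTop 0] with n hn
  have hn0 : (n : ℝ) ≠ 0 := by exact_mod_cast hn.ne'
  have hfl : ⌊(c : ℝ) * n⌋₊ = c * n := by rw [← Nat.cast_mul, Nat.floor_natCast]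
  have hpow : (n : ℝ) ^ D = (n : ℝ) ^ (D - 1) * n := by
    rw [← pow_succ, Nat.sub_add_cancel hD]
  rw [intervalIntegral.integral_div, integral_floor_mul_eq_sum (H n) c hn, hfl,
    Finset.sum_range_succ, hpow]
  field_simp

end Powers

/-! ### Rees algebras of powers and the ray of smallest slope -/

section PowersOfIdeal

open Filter Topology

namespace IdealFiltration

variable {k A : Type*} [Field k] [CommRing A] [Algebra k A] {𝒜 : ℕ → Submodule k A}

theorem monomial_mem_rees {F : IdealFiltration A} {n : ℕ} {a : A} (ha : a ∈ F.ideal n) :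
    (Polynomial.monomial n a : Polynomial A) ∈ F.rees := by
  intro m
  rw [Polynomial.coeff_monomial]
  split_ifs with h
  · exact h ▸ ha
  · exact zero_mem _

/-- The Rees algebra of the powers of an ideal generated by homogeneous elements of degrees
`d 1, …, d l`. -/
theorem exists_powers_generators {I : Ideal A} {S : Finset A} (hS : Ideal.span (S : Set A) = I)
    {δ : A → ℕ} (hδ : ∀ s ∈ S, s ∈ 𝒜 (δ s)) :
    ∃ (G : Finset (powers I).rees) (p : (powers I).rees → ℕ),
      Algebra.adjoin A (G : Set (powers I).rees) = ⊤ ∧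
      (∀ g ∈ G, (powers I).HasBidegree 𝒜 g (p g) 1) ∧
      (∀ g ∈ G, ∃ s ∈ S, p g = δ s) ∧ (∀ s ∈ S, ∃ g ∈ G, p g = δ s) := by
  classical
  have hSI : ∀ s ∈ S, s ∈ (powers I).ideal 1 := by
    intro s hs
    change s ∈ I ^ 1
    rw [pow_one, ← hS]
    exact Ideal.subset_span hs
  let φ : S → (powers I).rees := fun s =>
    ⟨Polynomial.monomial 1 (s : A), monomial_mem_rees (hSI s s.2)⟩
  have hφ : ∀ s, δ (((φ s : (powers I).rees) : Polynomial A).coeff 1) = δ s := fun s =>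
    congr_arg δ (Polynomial.coeff_monomial_same 1 (s : A))
  refine ⟨Finset.univ.image φ, fun g => δ ((g : Polynomial A).coeff 1), ?_, ?_, ?_, ?_⟩
  · apply Subalgebra.map_injective (f := (powers I).rees.val) Subtype.val_injective
    rw [AlgHom.map_adjoin, Algebra.map_top, Subalgebra.range_val]
    have himage : (powers I).rees.val '' ((Finset.univ.image φ : Finset _) : Set (powers I).rees) =
        (Polynomial.monomial 1 : A →ₗ[A] Polynomial A) '' (S : Set A) := by
      ext f
      constructor
      · rintro ⟨g, hg, rfl⟩
        obtain ⟨s, -, rfl⟩ := Finset.mem_image.1 (Finset.mem_coe.1 hg)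
        exact ⟨s, s.2, rfl⟩
      · rintro ⟨s, hs, rfl⟩
        exact ⟨φ ⟨s, hs⟩, Finset.mem_coe.2 (Finset.mem_image_of_mem _ (Finset.mem_univ _)), rfl⟩
    have hrees : (powers I).rees = reesAlgebra I := rfl
    rw [himage, hrees, ← adjoin_monomial_eq_reesAlgebra, ← hS, Ideal.span, Submodule.map_span,
      Algebra.adjoin_span]
  · intro g hg
    obtain ⟨s, -, rfl⟩ := Finset.mem_image.1 hg
    refine ⟨s, ?_, hSI s s.2, rfl⟩
    change (s : A) ∈ 𝒜 (δ (((φ s : (powers I).rees) : Polynomial A).coeff 1))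
    rw [hφ]
    exact hδ s s.2
  · intro g hg
    obtain ⟨s, -, rfl⟩ := Finset.mem_image.1 hg
    exact ⟨s, s.2, hφ s⟩
  · intro s hs
    exact ⟨φ ⟨s, hs⟩, Finset.mem_image_of_mem _ (Finset.mem_univ _), hφ ⟨s, hs⟩⟩

variable [GradedAlgebra 𝒜] {F : IdealFiltration A}

/-- Along the ray of smallest slope, `ℓ((Iₙ)ₘ)` is eventually a polynomial. -/
theorem exists_len_eq_eval_of_adjoin_eq_top (hA : IsStandardGraded 𝒜) {G : Finset F.rees}
    {p : F.rees → ℕ} (hadj : Algebra.adjoin A (G : Set F.rees) = ⊤)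
    (hG : ∀ g ∈ G, F.HasBidegree 𝒜 g (p g) 1) {c : ℕ} (hc : ∀ g ∈ G, c ≤ p g) :
    ∃ (q : Polynomial ℚ) (M : ℕ), ∀ n, M ≤ n → (F.len 𝒜 n (c * n) : ℚ) = q.eval (n : ℚ) := by
  classical
  obtain ⟨N, z, b, hb, hspan⟩ := exists_generators_of_adjoin_eq_top hA hadj hG
  -- All bidegrees have slope at least `c`, so a monomial of bidegree `(c n, n)` involves only
  -- generators of bidegree `(c, 1)`. Replacing the others by 0 leaves the degree `n` piece of an
  -- algebra generated in degree one.
  set z' : Fin N → A := fun i => if b i = bidegree c 1 then z i else 0 with hz'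
  obtain ⟨q, M, hq⟩ := exists_hilbertPoly (k := k) z'
  refine ⟨q, M, fun n hn => ?_⟩
  rw [← hq n hn, len, hspan, monomialSpan]
  have hval : ∀ α : Fin N → ℕ, (∀ i, b i ≠ bidegree c 1 → α i = 0) →
      monomialValue z' α = monomialValue z α := by
    intro α hα
    refine Finset.prod_congr rfl fun i _ => ?_
    by_cases h : b i = bidegree c 1
    · rw [hz']
      simp only [if_pos h]
    · rw [hα i h, pow_zero, pow_zero]
  have hb1 : ∀ i, c * b i 1 ≤ b i 0 := by
    intro i
    rcases hb i with h | ⟨g, hg, h⟩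
    · simp [h]
    · rw [h]
      simpa using hc g hg
  have hb2 : ∀ i, c * b i 1 = b i 0 → b i = bidegree c 1 := by
    intro i hi
    rcases hb i with h | ⟨g, hg, h⟩
    · rw [h] at hi
      simp at hi
    · rw [h] at hi ⊢
      simp only [bidegree_zero, bidegree_one, mul_one] at hi
      rw [hi]
  have hsum : ∀ α : Fin N → ℕ, (∀ i, b i ≠ bidegree c 1 → α i = 0) →
      multidegree b α = bidegree (c * ∑ i, α i) (∑ i, α i) := by
    intro α hα
    rw [multidegree_eq_bidegree_iff, Finset.mul_sum]
    constructor
    · refine Finset.sum_congr rfl fun i _ => ?_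
      by_cases h : b i = bidegree c 1
      · simp [h]
      · simp [hα i h]
    · refine Finset.sum_congr rfl fun i _ => ?_
      by_cases h : b i = bidegree c 1
      · rw [h, bidegree_zero, mul_comm]
      · simp [hα i h]
  have hspan' : Submodule.span k (monomialValue z '' {α | multidegree b α = bidegree (c * n) n}) =
      Submodule.span k (monomialValue z' '' {α | ∑ i, α i = n}) := by
    apply le_antisymm
    · refine Submodule.span_mono ?_
      rintro _ ⟨α, hα, rfl⟩
      obtain ⟨h1, h2⟩ := multidegree_eq_bidegree_iff.1 hα
      have hzero : ∀ i, b i ≠ bidegree c 1 → α i = 0 := by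
        intro i hi
        have heq : ∑ i, α i * (c * b i 1) = ∑ i, α i * b i 0 := by
          rw [h2, ← h1, Finset.mul_sum]
          exact Finset.sum_congr rfl fun i _ => by ring
        -- The sums agree and the terms are comparable, so the terms agree.
        have := (Finset.sum_eq_sum_iff_of_le fun i _ =>
          Nat.mul_le_mul_left (α i) (hb1 i)).1 heq i (Finset.mem_univ i)
        by_contra hne
        exact hi (hb2 i (Nat.eq_of_mul_eq_mul_left (Nat.pos_of_ne_zero hne) this))
      refine ⟨α, ?_, hval α hzero⟩
      have hd := hsum α hzero
      rw [hα] at hd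
      have := DFunLike.congr_fun hd 1
      simpa using this.symm
    · rw [Submodule.span_le]
      rintro _ ⟨α, hα, rfl⟩
      by_cases hzero : ∀ i, b i ≠ bidegree c 1 → α i = 0
      · rw [hval α hzero]
        refine Submodule.subset_span ⟨α, ?_, rfl⟩
        rw [Set.mem_ofPred_eq] at hα
        rw [Set.mem_ofPred_eq, hsum α hzero, hα]
      · push Not at hzero
        obtain ⟨i, hi, hαi⟩ := hzero
        have : monomialValue z' α = 0 := by
          refine Finset.prod_eq_zero (Finset.mem_univ i) ?_
          rw [hz']
          simp only [if_neg hi]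
          exact zero_pow hαi
        rw [this]
        exact zero_mem _
  rw [hspan']

/-- The limit defining the density function exists along the ray of smallest slope. -/
theorem exists_tendsto_len_mul (hA : IsStandardGraded 𝒜) {D : ℕ} (hD : ringKrullDim A = D)
    (hD1 : 1 ≤ D) {G : Finset F.rees}
    {p : F.rees → ℕ} (hadj : Algebra.adjoin A (G : Set F.rees) = ⊤)
    (hG : ∀ g ∈ G, F.HasBidegree 𝒜 g (p g) 1) {c : ℕ} (hc : ∀ g ∈ G, c ≤ p g) :
    ∃ L, Tendsto (fun n : ℕ => (F.len 𝒜 n ⌊(c : ℝ) * n⌋₊ : ℝ) / (n : ℝ) ^ (D - 1)) atTop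
      (𝓝 L) := by
  obtain ⟨q, M, hq⟩ := exists_len_eq_eval_of_adjoin_eq_top hA hadj hG hc
  obtain ⟨-, C, -, -, hC, hle, -, -⟩ := hA.exists_hilbert_bounds hD hD1
  have hq' : ∀ n, M ≤ n →
      (F.len 𝒜 n ⌊(c : ℝ) * n⌋₊ : ℝ) = (q.map (algebraMap ℚ ℝ)).eval (n : ℝ) := by
    intro n hn
    have hfl : ⌊(c : ℝ) * n⌋₊ = c * n := by rw [← Nat.cast_mul, Nat.floor_natCast]
    rw [hfl, Polynomial.eval_natCast_map, ← hq n hn, map_natCast]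
  obtain ⟨L, hL⟩ := (q.map (algebraMap ℚ ℝ)).exists_tendsto_eval_div_pow (E := D - 1)
    (B := C * ((c : ℝ) + 1) ^ (D - 1)) (by
      filter_upwards [eventually_ge_atTop M, eventually_ge_atTop 1] with n hn hn1
      rw [← hq' n hn]
      refine ⟨Nat.cast_nonneg _, (Nat.cast_le.2 (F.len_le_finrank hA n _)).trans
        ((hle _).trans ?_)⟩
      have hn1' : (1 : ℝ) ≤ n := by exact_mod_cast hn1
      have : (⌊(c : ℝ) * n⌋₊ : ℝ) ≤ c * n := Nat.floor_le (by positivity)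
      rw [mul_assoc, ← mul_pow]
      gcongr
      linarith)
  refine ⟨L, hL.congr' ?_⟩
  filter_upwards [eventually_ge_atTop M] with n hn
  rw [hq' n hn]

end IdealFiltration

end PowersOfIdeal

/-! ### Generators of an ideal in a domain, and the theorem -/

section Main

open Filter Topology

variable {k A : Type*} [Field k] [CommRing A] [Algebra k A] {𝒜 : ℕ → Submodule k A}
  [GradedAlgebra 𝒜]

theorem IsStandardGraded.isUnit_of_mem_degree_zero (hA : IsStandardGraded 𝒜) {s : A}
    (hs : s ∈ 𝒜 0) (hs0 : s ≠ 0) : IsUnit s := by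
  rw [hA.degree_zero] at hs
  obtain ⟨c, rfl⟩ := hs
  have hc : c ≠ 0 := by
    rintro rfl
    exact hs0 (map_zero _)
  exact (IsUnit.mk0 c hc).map (algebraMap k A)

/-- Generators of a nonzero proper homogeneous ideal `I` of a domain: the Rees algebra is generated
by elements of `I`, and the generator of smallest degree has positive degree. -/
theorem IsMinimallyGeneratedInDegrees.exists_rees_generators [IsDomain A]
    (hA : IsStandardGraded 𝒜) {I : Ideal A} (hI0 : I ≠ ⊥) (hI1 : I ≠ ⊤) {l : ℕ} {d : ℕ → ℕ}
    (h : IsMinimallyGeneratedInDegrees 𝒜 I l d) :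
    (IdealFiltration.powers I).IsGeneratedInBidegrees 𝒜 l d (fun _ => 1) ∧ 0 < d 1 ∧
      (∃ s ∈ 𝒜 (d 1), s ∈ I ∧ s ≠ 0) ∧
      ∃ (G : Finset (IdealFiltration.powers I).rees) (p : (IdealFiltration.powers I).rees → ℕ),
        Algebra.adjoin A (G : Set (IdealFiltration.powers I).rees) = ⊤ ∧
        (∀ g ∈ G, (IdealFiltration.powers I).HasBidegree 𝒜 g (p g) 1) ∧ ∀ g ∈ G, d 1 ≤ p g := by
  obtain ⟨hd, S, hS, hmin, hdeg, hdeg'⟩ := h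
  have hS0 : ∀ s ∈ S, s ≠ 0 := by
    rintro s hs rfl
    exact hmin 0 hs (zero_mem _)
  have hl : 1 ≤ l := by
    by_contra! hl
    apply hI0
    rw [← hS, Ideal.span_eq_bot]
    intro s hs
    obtain ⟨j, h1, h2, -⟩ := hdeg s hs
    omega
  choose! ι hι using hdeg
  have hδ : ∀ s ∈ S, s ∈ 𝒜 (d (ι s)) := fun s hs => (hι s hs).2.2
  have hd1 : ∀ j, 1 ≤ j → j ≤ l → d 1 ≤ d j := by
    intro j hj hjl
    rcases hj.eq_or_lt with rfl | h
    · exact le_rfl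
    · exact (hd 1 j le_rfl h hjl).le
  obtain ⟨G, p, hadj, hG, hGS, hSG⟩ := IdealFiltration.exists_powers_generators hS hδ
  obtain ⟨s, hs, hsd⟩ := hdeg' 1 le_rfl hl
  have hsI : s ∈ I := hS ▸ Ideal.subset_span hs
  refine ⟨⟨hl, fun i j hi hij hj => ?_, G, p, fun _ => 1, hadj,
    fun g hg => ⟨one_pos, hG g hg⟩, fun g hg => ?_, fun j hj hjl => ?_⟩, ?_,
    ⟨s, hsd, hsI, hS0 s hs⟩, G, p, hadj, hG, fun g hg => ?_⟩
  · simpa using hd i j hi hij hj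
  · obtain ⟨t, ht, hpt⟩ := hGS g hg
    exact ⟨ι t, (hι t ht).1, (hι t ht).2.1, by rw [hpt]⟩
  · obtain ⟨t, ht, htd⟩ := hdeg' j hj hjl
    obtain ⟨g, hg, hpg⟩ := hSG t ht
    exact ⟨g, hg, hpg.trans (DirectSum.degree_eq_of_mem_mem 𝒜 (hδ t ht) htd (hS0 t ht)), rfl⟩
  -- A nonzero generator of degree 0 would be a unit, against `I ≠ ⊤`.
  · by_contra! h0
    rw [Nat.le_zero.1 h0] at hsd
    exact hI1 (Ideal.eq_top_of_isUnit_mem _ hsI (hA.isUnit_of_mem_degree_zero hsd (hS0 s hs)))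
  · obtain ⟨t, ht, hpt⟩ := hGS g hg
    rw [hpt]
    exact hd1 _ (hι t ht).1 (hι t ht).2.1

end Main

theorem theorem3 {k A : Type*} [Field k] [CommRing A] [Algebra k A]
    (𝒜 : ℕ → Submodule k A) [GradedAlgebra 𝒜] (hA : IsStandardGraded 𝒜)
    (D : ℕ) (hD : ringKrullDim A = D) :
    -- Noetherian filtrations of homogeneous ideals
    (∀ F : IdealFiltration A, F.IsHomogeneousFiltration 𝒜 → F.IsNoetherianFiltration →
      1 ≤ F.dim →
      ∀ (l : ℕ) (d e : ℕ → ℕ), F.IsGeneratedInBidegrees 𝒜 l d e →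
      (∃ h : F.rees, F.HasBidegree 𝒜 h (d 1) (e 1) ∧ h ∈ nonZeroDivisors F.rees) →
      -- the limit exists away from `d₁/e₁` and is the density function
      (∀ x : ℝ, 0 ≤ x → x ≠ (d 1 : ℝ) / e 1 →
        Filter.Tendsto (fun n : ℕ => (F.len 𝒜 n ⌊x * n⌋₊ : ℝ) /
            ((n : ℝ) ^ (D - 1) / (Nat.factorial D : ℝ)))
          Filter.atTop (nhds (F.density 𝒜 x))) ∧
      ContinuousOn (F.density 𝒜) (Set.Ioi ((d 1 : ℝ) / e 1)) ∧
      (∀ x : ℝ, 0 ≤ x → x < (d 1 : ℝ) / e 1 → F.density 𝒜 x = 0) ∧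
      ∃ p : ℕ → Polynomial ℚ,
        (∀ j, 1 ≤ j → j ≤ l → p j ≠ 0 ∧ (p j).natDegree ≤ D - 1) ∧
        (p l).natDegree = D - 1 ∧
        (∀ j, 1 ≤ j → j ≤ l → ∀ x : ℝ, (d 1 : ℝ) / e 1 < x → (d j : ℝ) / e j ≤ x →
          (j < l → x ≤ (d (j + 1) : ℝ) / e (j + 1)) →
          F.density 𝒜 x = Polynomial.aeval x (p j))) ∧
    -- powers of a homogeneous ideal in a domain
    (IsDomain A → 2 ≤ D →
      ∀ I : Ideal A, I.IsHomogeneous 𝒜 → I ≠ ⊥ → I ≠ ⊤ →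
      ∀ (l : ℕ) (d : ℕ → ℕ), IsMinimallyGeneratedInDegrees 𝒜 I l d →
      (∀ x : ℝ, 0 ≤ x →
        Filter.Tendsto (fun n : ℕ => ((IdealFiltration.powers I).len 𝒜 n ⌊x * n⌋₊ : ℝ) /
            ((n : ℝ) ^ (D - 1) / (Nat.factorial D : ℝ)))
          Filter.atTop (nhds ((IdealFiltration.powers I).density 𝒜 x))) ∧
      ContinuousOn ((IdealFiltration.powers I).density 𝒜) (Set.Ici 0 \ {(d 1 : ℝ)}) ∧
      (∀ x : ℝ, 0 ≤ x → x < d 1 → (IdealFiltration.powers I).density 𝒜 x = 0) ∧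
      (∃ p : ℕ → Polynomial ℚ,
        (∀ j, 1 ≤ j → j ≤ l → p j ≠ 0 ∧ (p j).natDegree ≤ D - 1) ∧
        (p l).natDegree = D - 1 ∧
        (∀ j, 1 ≤ j → j ≤ l → ∀ x : ℝ, (d 1 : ℝ) < x → (d j : ℝ) ≤ x →
          (j < l → x ≤ d (j + 1)) →
          (IdealFiltration.powers I).density 𝒜 x = Polynomial.aeval x (p j))) ∧
      (∀ c : ℕ, 0 < c →
        IntervalIntegrable ((IdealFiltration.powers I).density 𝒜)
          MeasureTheory.volume 0 (c : ℝ) ∧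
        Filter.Tendsto (fun n : ℕ =>
            (∑ m ∈ Finset.range (c * n + 1), ((IdealFiltration.powers I).len 𝒜 n m : ℝ)) /
              ((n : ℝ) ^ D / (Nat.factorial D : ℝ)))
          Filter.atTop
          (nhds (∫ x in (0 : ℝ)..(c : ℝ), (IdealFiltration.powers I).density 𝒜 x)))) := by
  refine ⟨?_, ?_⟩
  · intro F _ _ hF l d e hgen hreg
    obtain ⟨a, had, hae, ha⟩ := IdealFiltration.exists_nonZeroDivisor hreg
    have hdim : F.dim = D := F.dim_eq hD (hgen.pos le_rfl hgen.1) hae ha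
    exact IdealFiltration.density_piecewise_polynomial hA hD (hdim ▸ hF) hdim hgen had hae ha
  · intro _ hD2 I _ hI0 hI1 l d hmin
    obtain ⟨hgen, hd1, ⟨s, hsd, hsI, hs0⟩, G, p, hadj, hG, hGd⟩ :=
      hmin.exists_rees_generators hA hI0 hI1
    have hD1 : 1 ≤ D := by omega
    have hsI' : s ∈ (IdealFiltration.powers I).ideal 1 := by
      change s ∈ I ^ 1
      rwa [pow_one]
    have hsreg : ∀ x, s * x = 0 → x = 0 := fun x hx => (mul_eq_zero.1 hx).resolve_left hs0
    have hdim : (IdealFiltration.powers I).dim = D :=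
      IdealFiltration.dim_eq hD one_pos hsI' hsreg
    obtain ⟨hlim, hcont, hzero, q, hq, hql, hqf⟩ :=
      IdealFiltration.density_piecewise_polynomial hA hD hD1 hdim hgen hsd hsI' hsreg
    simp only [Nat.cast_one, div_one] at hlim hcont hzero hqf
    obtain ⟨L, hL⟩ := IdealFiltration.exists_tendsto_len_mul hA hD hD1 hadj hG hGd
    have hall : ∀ x : ℝ, 0 ≤ x →
        Filter.Tendsto (fun n : ℕ => ((IdealFiltration.powers I).len 𝒜 n ⌊x * n⌋₊ : ℝ) /
            ((n : ℝ) ^ (D - 1) / (Nat.factorial D : ℝ)))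
          Filter.atTop (nhds ((IdealFiltration.powers I).density 𝒜 x)) := by
      intro x hx
      -- The general result leaves out `x = d 1`, which is the ray of smallest slope and is handled
      -- by `exists_tendsto_len_mul`.
      by_cases hxd : x = d 1
      · rw [hxd]
        exact (IdealFiltration.tendsto_density hdim hL).2
      · exact hlim x hx hxd
    obtain ⟨-, C, -, -, -, hle, -, -⟩ := hA.exists_hilbert_bounds hD hD1
    -- The density may jump at `d 1`, so integrability is obtained from monotonicity. Here `d 1 >
    -- 0`, so lengths increase in `m` from the start.
    have hmono : MonotoneOn ((IdealFiltration.powers I).density 𝒜) (Set.Ici 0) := by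
      intro x hx y hy hxy
      refine le_of_tendsto_of_tendsto' (hall x hx) (hall y hy) fun n => ?_
      refine div_le_div_of_nonneg_right (Nat.cast_le.2 ?_) (by positivity)
      exact monotone_nat_of_le_succ
        (fun m => (IdealFiltration.powers I).len_le_len_succ hA hd1 hsd hsreg n m)
        (Nat.floor_mono (by gcongr))
    refine ⟨hall, ?_, hzero, ⟨q, hq, hql, hqf⟩, fun c _ => ⟨?_, ?_⟩⟩
    -- Left of `d 1` the density is locally zero within `[0, ∞)`; right of it the general continuity
    -- applies.
    · rintro x ⟨hx0, hxd⟩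
      rcases (show x ≠ d 1 from hxd).lt_or_gt with h | h
      · refine ContinuousWithinAt.congr_of_eventuallyEq (f := fun _ => (0 : ℝ))
          continuousWithinAt_const ?_ (hzero x hx0 h)
        filter_upwards [self_mem_nhdsWithin,
          mem_nhdsWithin_of_mem_nhds (Iio_mem_nhds h)] with y hy1 hy2
        exact hzero y hy1.1 hy2
      · exact (hcont.continuousAt (Ioi_mem_nhds h)).continuousWithinAt
    · refine MonotoneOn.intervalIntegrable (hmono.mono ?_)
      rw [Set.uIcc_of_le (Nat.cast_nonneg c)]
      exact Set.Icc_subset_Ici_self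
    · refine tendsto_sum_div_integral
        (H := fun n m => ((IdealFiltration.powers I).len 𝒜 n m : ℝ)) (C := C) hD1
        (by exact_mod_cast D.factorial_pos) (fun n m => ⟨Nat.cast_nonneg _, ?_⟩) hall c
      exact (Nat.cast_le.2 ((IdealFiltration.powers I).len_le_finrank hA n m)).trans (hle m)
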